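/- Let $(M,D,g)$ be a statistical manifold of constant curvature $c\neq 0$: $M$ is a smooth $n$-dimensional manifold (Hausdorff, second countable, without boundary), $g$ is a smooth Riemannian metric on $M$, $D$ is a smooth torsion-free affine connection on $M$, the 3-tensor $Dg$ is totally symmetric, and the curvature tensor $\Theta_D(X,Y)Z=D_XD_YZ-D_YD_XZ-D_{[X,Y]}Z$ satisfies $$\Theta_D(X,Y)Z=c\,\bigl(g(Y,Z)X-g(X,Z)Y\bigr)$$ for all vector fields $X,Y,Z$. Then the manifold $TM\times\mathbb R$ admits a structure of a Sasakian manifold. That is, there is a smooth Riemannian metric $G$ on $TM\times\mathbb R$ such that the cone metric $s^2G+ds^2$ on $(TM\times\mathbb R)\times\mathbb R^{>0}$, where $s$ is the coordinate on $\mathbb R^{>0}$, is Kähler with respect to a complex structure $I$ that is invariant under all dilations $(x,s)\mapsto(x,qs)$, $q>0$. -/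

import Mathlib

open Bundle Set
open scoped Manifold ContDiff Topology

noncomputable section

namespace SasakiTangent

/-! ### Riemannian metrics and statistical manifolds -/

section Statistical

variable {E : Type*} [NormedAddCommGroup E] [NormedSpace ℝ E]
  {H : Type*} [TopologicalSpace H]

/-- Smooth Riemannian metrics on a manifold. -/
abbrev RiemMetric (I : ModelWithCorners ℝ E H) (M : Type*) [TopologicalSpace M]
    [ChartedSpace H M] [IsManifold I ∞ M] :=
  ContMDiffRiemannianMetric I ∞ E (fun x : M => TangentSpace I x)

/-- Affine connections on (the tangent bundle of) a manifold. In Mathlib's notation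
`D Y x (X x)` is the value of `D_X Y` at `x`. -/
abbrev AffineConnection (I : ModelWithCorners ℝ E H) (M : Type*) [TopologicalSpace M]
    [ChartedSpace H M] [IsManifold I ∞ M] :=
  CovariantDerivative I E (fun x : M => TangentSpace I x)

variable {I : ModelWithCorners ℝ E H} {M : Type*} [TopologicalSpace M]
  [ChartedSpace H M] [IsManifold I ∞ M]

/-- Smooth vector fields. -/
def IsSmoothField (I : ModelWithCorners ℝ E H) {M : Type*} [TopologicalSpace M]
    [ChartedSpace H M] [IsManifold I ∞ M] (X : Π x : M, TangentSpace I x) : Prop :=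
  ContMDiff I I.tangent ∞ (fun x => (⟨x, X x⟩ : TangentBundle I M))

/-- The vector field `D_X Y`. -/
def AffineConnection.along (D : AffineConnection I M) (X Y : Π x : M, TangentSpace I x) :
    Π x : M, TangentSpace I x :=
  fun x => D Y x (X x)

/-- The curvature `Θ_D(X, Y) Z = D_X D_Y Z - D_Y D_X Z - D_[X,Y] Z`. -/
def AffineConnection.curvature (D : AffineConnection I M) (X Y Z : Π x : M, TangentSpace I x) :
    Π x : M, TangentSpace I x :=
  fun x => D.along X (D.along Y Z) x - D.along Y (D.along X Z) x
    - D.along (VectorField.mlieBracket I X Y) Z x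

/-- The covariant derivative of a metric:
`(D_X g)(Y, Z) = X (g(Y, Z)) - g(D_X Y, Z) - g(Y, D_X Z)`. -/
def AffineConnection.derivMetric (D : AffineConnection I M) (g : RiemMetric I M)
    (X Y Z : Π x : M, TangentSpace I x) (x : M) : ℝ :=
  mvfderiv I (fun y => g.inner y (Y y) (Z y)) x (X x)
    - g.inner x (D.along X Y x) (Z x) - g.inner x (Y x) (D.along X Z x)

variable [FiniteDimensional ℝ E] [CompleteSpace E]

/-- `(M, D, g)` is a statistical manifold: `D` is a smooth torsion-free connection and the
tensor `D g` is totally symmetric. (The two transpositions generate all permutations.) -/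
structure IsStatistical (D : AffineConnection I M) (g : RiemMetric I M) : Prop where
  smooth : CovariantDerivative.ContMDiffCovariantDerivative D ∞
  torsion_free : ∀ x, D.torsion x = 0
  symm_left : ∀ X Y Z : Π x : M, TangentSpace I x, IsSmoothField I X → IsSmoothField I Y →
    IsSmoothField I Z → ∀ x, D.derivMetric g X Y Z x = D.derivMetric g Y X Z x
  symm_right : ∀ X Y Z : Π x : M, TangentSpace I x, IsSmoothField I X → IsSmoothField I Y →
    IsSmoothField I Z → ∀ x, D.derivMetric g X Y Z x = D.derivMetric g X Z Y x

/-- `(M, D, g)` is of constant curvature `c`: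
`Θ_D(X, Y) Z = c (g(Y, Z) X - g(X, Z) Y)` for all `X`, `Y`, `Z`. -/
def HasConstantCurvature (D : AffineConnection I M) (g : RiemMetric I M) (c : ℝ) : Prop :=
  ∀ X Y Z : Π x : M, TangentSpace I x, IsSmoothField I X → IsSmoothField I Y →
    IsSmoothField I Z → ∀ x, D.curvature X Y Z x =
      c • (g.inner x (Y x) (Z x) • X x - g.inner x (X x) (Z x) • Y x)

end Statistical

/-! ### Complex structures, closed forms, Kähler structures -/

section Kahler

variable {F : Type*} [NormedAddCommGroup F] [NormedSpace ℝ F]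
  {H : Type*} [TopologicalSpace H]

/-- A complex structure on a manifold, as a field `A` of endomorphisms of the tangent spaces with
`A ^ 2 = -1` which near each point is multiplication by `i` in suitable smooth complex coordinates
`ψ`. (The transition maps between two such `ψ` are then holomorphic.) -/
structure IsComplexStructure (J : ModelWithCorners ℝ F H) {N : Type*} [TopologicalSpace N]
    [ChartedSpace H N] (A : Π x : N, TangentSpace J x →L[ℝ] TangentSpace J x) : Prop where
  sq : ∀ x v, A x (A x v) = -v
  integrable : ∀ x₀ : N, ∃ (m : ℕ) (ψ : OpenPartialHomeomorph N (EuclideanSpace ℂ (Fin m))),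
    x₀ ∈ ψ.source ∧
    ContMDiffOn J 𝓘(ℝ, EuclideanSpace ℂ (Fin m)) ∞ ψ ψ.source ∧
    ContMDiffOn 𝓘(ℝ, EuclideanSpace ℂ (Fin m)) J ∞ ψ.symm ψ.target ∧
    ∀ x ∈ ψ.source, ∀ v : TangentSpace J x,
      mvfderiv J ψ x (A x v) = Complex.I • mvfderiv J ψ x v

/-- Differential `k`-forms (as not necessarily continuous families). -/
abbrev DForm (J : ModelWithCorners ℝ F H) (N : Type*) [TopologicalSpace N]
    [ChartedSpace H N] (k : ℕ) :=
  Π x : N, TangentSpace J x [⋀^Fin k]→L[ℝ] ℝ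

/-- The expression of a form in the preferred chart at `x₀`, i.e. its pullback under the inverse of
that chart. -/
def DForm.inChart {J : ModelWithCorners ℝ F H} {N : Type*} [TopologicalSpace N]
    [ChartedSpace H N] {k : ℕ} (Ω : DForm J N k) (x₀ : N) : F → F [⋀^Fin k]→L[ℝ] ℝ :=
  fun y => (Ω ((extChartAt J x₀).symm y)).compContinuousLinearMap
    (mfderivWithin 𝓘(ℝ, F) J (extChartAt J x₀).symm (range J) y)

/-- `dΩ = 0`, the exterior derivative at each point being computed in the preferred chart there. -/
def DForm.IsClosed {J : ModelWithCorners ℝ F H} {N : Type*} [TopologicalSpace N]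
    [ChartedSpace H N] {k : ℕ} (Ω : DForm J N k) : Prop :=
  ∀ x₀ : N, extDerivWithin (Ω.inChart x₀) (range J) (extChartAt J x₀ x₀) = 0

/-- `(N, g, A)` is Kähler: `A` is a complex structure, `g` is `A`-invariant, and the fundamental
form `Ω(v, w) = g(A v, w)` is closed. -/
structure IsKahler {J : ModelWithCorners ℝ F H} {N : Type*} [TopologicalSpace N]
    [ChartedSpace H N] [IsManifold J ∞ N] (g : RiemMetric J N)
    (A : Π x : N, TangentSpace J x →L[ℝ] TangentSpace J x) : Prop where
  complex : IsComplexStructure J A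
  hermitian : ∀ x v w, g.inner x (A x v) (A x w) = g.inner x v w
  closed : ∃ Ω : DForm J N 2, (∀ x v w, Ω x ![v, w] = g.inner x (A x v) w) ∧ Ω.IsClosed

end Kahler

/-! ### Riemannian cones and Sasakian manifolds -/

section Cone

/-- The manifold `ℝ^{>0}`, an open subset of `ℝ`. -/
abbrev PosReal : TopologicalSpace.Opens ℝ := ⟨Ioi 0, isOpen_Ioi⟩

variable {F : Type*} [NormedAddCommGroup F] [NormedSpace ℝ F]
  {H : Type*} [TopologicalSpace H] {J : ModelWithCorners ℝ F H}
  {N : Type*} [TopologicalSpace N] [ChartedSpace H N]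

/-- The pullback of a bilinear form under a linear map. -/
def pullForm {V W : Type*} [AddCommGroup V] [Module ℝ V] [TopologicalSpace V]
    [IsTopologicalAddGroup V] [ContinuousSMul ℝ V]
    [AddCommGroup W] [Module ℝ W] [TopologicalSpace W]
    [IsTopologicalAddGroup W] [ContinuousSMul ℝ W]
    (b : W →L[ℝ] W →L[ℝ] ℝ) (L : V →L[ℝ] W) : V →L[ℝ] V →L[ℝ] ℝ :=
  (ContinuousLinearMap.precomp ℝ L) ∘L (b ∘L L)

@[simp] lemma pullForm_apply {V W : Type*} [AddCommGroup V] [Module ℝ V] [TopologicalSpace V]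
    [IsTopologicalAddGroup V] [ContinuousSMul ℝ V]
    [AddCommGroup W] [Module ℝ W] [TopologicalSpace W]
    [IsTopologicalAddGroup W] [ContinuousSMul ℝ W]
    (b : W →L[ℝ] W →L[ℝ] ℝ) (L : V →L[ℝ] W) (v w : V) :
    pullForm b L v w = b (L v) (L w) := rfl

/-- The pullback of a smooth field of bilinear forms under a smooth map is smooth. -/
lemma contMDiff_pullForm {F' : Type*} [NormedAddCommGroup F'] [NormedSpace ℝ F']
    {H' : Type*} [TopologicalSpace H'] {J' : ModelWithCorners ℝ F' H'}
    {C : Type*} [TopologicalSpace C] [ChartedSpace H' C]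
    [IsManifold J ∞ N] [IsManifold J' ∞ C] {f : C → N} (hf : ContMDiff J' J ∞ f)
    {b : Π x : N, TangentSpace J x →L[ℝ] TangentSpace J x →L[ℝ] ℝ}
    (hb : ContMDiff J (J.prod 𝓘(ℝ, F →L[ℝ] F →L[ℝ] ℝ)) ∞
      (fun x ↦ TotalSpace.mk' (F →L[ℝ] F →L[ℝ] ℝ) x (b x))) :
    ContMDiff J' (J'.prod 𝓘(ℝ, F' →L[ℝ] F' →L[ℝ] ℝ)) ∞
      (fun p ↦ TotalSpace.mk' (F' →L[ℝ] F' →L[ℝ] ℝ) p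
        (pullForm (b (f p)) (mfderiv J' J f p) :
          TangentSpace J' p →L[ℝ] TangentSpace J' p →L[ℝ] ℝ)) := by
  intro p₀
  have h1 := (contMDiffAt_hom_bundle _).1 (hb (f p₀))
  have h2 := h1.2.comp p₀ (hf p₀)
  have h3 := (hf p₀).mfderiv_const (m := ∞) (by simp)
  have h4 : ContMDiffAt J' 𝓘(ℝ, F' →L[ℝ] F →L[ℝ] ℝ) ∞ _ p₀ := h2.clm_comp h3
  have h5 : ContMDiffAt J' 𝓘(ℝ, (F →L[ℝ] ℝ) →L[ℝ] (F' →L[ℝ] ℝ)) ∞ _ p₀ :=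
    h3.clm_precomp (F₃ := ℝ)
  have h6 : ContMDiffAt J' 𝓘(ℝ, F' →L[ℝ] F' →L[ℝ] ℝ) ∞ _ p₀ := h5.clm_comp h4
  refine (contMDiffAt_hom_bundle _).2 ⟨contMDiffAt_id, h6.congr_of_eventuallyEq ?_⟩
  have hC : ∀ᶠ p in 𝓝 p₀, p ∈ (trivializationAt F' (TangentSpace J') p₀).baseSet :=
    (trivializationAt F' (TangentSpace J') p₀).open_baseSet.mem_nhds
      (mem_baseSet_trivializationAt F' (TangentSpace J') p₀)
  have hN : ∀ᶠ p in 𝓝 p₀, f p ∈ (trivializationAt F (TangentSpace J) (f p₀)).baseSet :=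
    (hf p₀).continuousAt.eventually
      ((trivializationAt F (TangentSpace J) (f p₀)).open_baseSet.mem_nhds
        (mem_baseSet_trivializationAt F (TangentSpace J) (f p₀)))
  filter_upwards [hC, hN] with p hp hq
  ext v w
  rw [inCoordinates_apply_eq₂ hp hp (mem_univ _)]
  simp only [ContinuousLinearMap.comp_apply, ContinuousLinearMap.precomp_apply,
    inTangentCoordinates, Function.comp_apply, id]
  rw [inCoordinates_apply_eq₂ hq hq (mem_univ _)]
  rw [ContinuousLinearMap.inCoordinates_eq hp hq]
  have key : ∀ u : TangentSpace J (f p), (trivializationAt F (TangentSpace J) (f p₀)).symm (f p)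
      ((trivializationAt F (TangentSpace J) (f p₀)) ⟨f p, u⟩).2 = u := fun u =>
    Trivialization.symm_apply_apply_mk _ hq u
  simp [key]

lemma contMDiff_smul_add_form {F' : Type*} [NormedAddCommGroup F'] [NormedSpace ℝ F']
    {H' : Type*} [TopologicalSpace H'] {J' : ModelWithCorners ℝ F' H'}
    {C : Type*} [TopologicalSpace C] [ChartedSpace H' C]
    [IsManifold J' ∞ C] {f : C → ℝ} (hf : ContMDiff J' 𝓘(ℝ, ℝ) ∞ f)
    {a b : Π x : C, TangentSpace J' x →L[ℝ] TangentSpace J' x →L[ℝ] ℝ}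
    (ha : ContMDiff J' (J'.prod 𝓘(ℝ, F' →L[ℝ] F' →L[ℝ] ℝ)) ∞
      (fun x ↦ TotalSpace.mk' (F' →L[ℝ] F' →L[ℝ] ℝ) x (a x)))
    (hb : ContMDiff J' (J'.prod 𝓘(ℝ, F' →L[ℝ] F' →L[ℝ] ℝ)) ∞
      (fun x ↦ TotalSpace.mk' (F' →L[ℝ] F' →L[ℝ] ℝ) x (b x))) :
    ContMDiff J' (J'.prod 𝓘(ℝ, F' →L[ℝ] F' →L[ℝ] ℝ)) ∞
      (fun x ↦ TotalSpace.mk' (F' →L[ℝ] F' →L[ℝ] ℝ) x (f x • a x + b x)) :=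
  ContMDiff.add_section (ContMDiff.smul_section hf ha) hb

/-- The radial coordinate of the cone `N × ℝ^{>0}`. -/
def radius {N : Type*} (p : N × PosReal) : ℝ := (p.2 : ℝ)

lemma radius_pos {N : Type*} (p : N × PosReal) : 0 < radius p := p.2.2

lemma contMDiff_radius :
    ContMDiff (J.prod 𝓘(ℝ, ℝ)) 𝓘(ℝ, ℝ) ∞ (radius : N × PosReal → ℝ) :=
  contMDiff_subtype_val.comp contMDiff_snd

lemma mfderiv_cone_fst (p : N × PosReal) (v : TangentSpace (J.prod 𝓘(ℝ, ℝ)) p) :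
    mfderiv (J.prod 𝓘(ℝ, ℝ)) J (Prod.fst : N × PosReal → N) p v = v.1 := by
  rw [mfderiv_fst]; rfl

lemma mfderiv_posReal_coe (s : PosReal) :
    mfderiv 𝓘(ℝ, ℝ) 𝓘(ℝ, ℝ) ((↑) : PosReal → ℝ) s = ContinuousLinearMap.id ℝ ℝ := by
  have h : HasMFDerivAt 𝓘(ℝ, ℝ) 𝓘(ℝ, ℝ) ((↑) : PosReal → ℝ) s
      (ContinuousLinearMap.id ℝ ℝ) := by
    refine ⟨continuous_subtype_val.continuousAt, ?_⟩
    have h1 : ((↑) : PosReal → ℝ) ∘ (chartAt ℝ s).symm =ᶠ[𝓝 (s : ℝ)] id :=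
      (TopologicalSpace.Opens.chartAt_subtype_val_symm_eventuallyEq PosReal (x := s)).symm
    have h2 : (writtenInExtChartAt 𝓘(ℝ, ℝ) 𝓘(ℝ, ℝ) s ((↑) : PosReal → ℝ))
        = ((↑) : PosReal → ℝ) ∘ (chartAt ℝ s).symm := by
      ext y
      simp only [writtenInExtChartAt, mfld_simps]
      rfl
    have h3 : extChartAt 𝓘(ℝ, ℝ) s s = (s : ℝ) := by
      simp [TopologicalSpace.Opens.chartAt_eq, OpenPartialHomeomorph.subtypeRestr]
      rfl
    rw [h2, h3]
    exact (hasFDerivWithinAt_id _ _).congr_of_eventuallyEq (h1.filter_mono nhdsWithin_le_nhds)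
      h1.eq_of_nhds
  exact h.mfderiv

lemma mfderiv_cone_radius (p : N × PosReal) (v : TangentSpace (J.prod 𝓘(ℝ, ℝ)) p) :
    mfderiv (J.prod 𝓘(ℝ, ℝ)) 𝓘(ℝ, ℝ) radius p v = v.2 := by
  have : (radius : N × PosReal → ℝ) = ((↑) : PosReal → ℝ) ∘ Prod.snd := rfl
  rw [this, mfderiv_comp (I' := 𝓘(ℝ, ℝ)) p
    ((contMDiff_subtype_val (n := ∞)).mdifferentiable (by simp) p.2) mdifferentiableAt_snd,
    mfderiv_posReal_coe, mfderiv_snd]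
  rfl

variable [IsManifold J ∞ N]

/-- The cone form `s² g_N + ds²` on `N × ℝ^{>0}`, `s` being the radial coordinate. -/
def coneForm (g : RiemMetric J N) (p : N × PosReal) :
    TangentSpace (J.prod 𝓘(ℝ, ℝ)) p →L[ℝ] TangentSpace (J.prod 𝓘(ℝ, ℝ)) p →L[ℝ] ℝ :=
  (radius p) ^ 2 • pullForm (g.inner p.1)
      (mfderiv (J.prod 𝓘(ℝ, ℝ)) J (Prod.fst : N × PosReal → N) p)
    + pullForm ((riemannianMetricVectorSpace ℝ).inner (radius p))
      (mfderiv (J.prod 𝓘(ℝ, ℝ)) 𝓘(ℝ, ℝ) radius p)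

lemma coneForm_apply (g : RiemMetric J N) (p : N × PosReal)
    (v w : TangentSpace (J.prod 𝓘(ℝ, ℝ)) p) :
    coneForm g p v w = radius p ^ 2 * g.inner p.1 v.1 w.1 + (v.2 : ℝ) * (w.2 : ℝ) := by
  simp only [coneForm, add_apply, smul_apply, pullForm_apply, smul_eq_mul]
  rw [mfderiv_cone_fst, mfderiv_cone_fst, mfderiv_cone_radius, mfderiv_cone_radius]
  congr 1
  exact mul_comm (w.2 : ℝ) (v.2 : ℝ)

lemma inner_self_nonneg (g : RiemMetric J N) (x : N) (v : TangentSpace J x) :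
    0 ≤ g.inner x v v := by
  by_cases h : v = 0
  · simp [h]
  · exact (g.pos x v h).le

/-- The cone metric `s² g_N + ds²` on `N × ℝ^{>0}` as a smooth Riemannian metric. -/
def coneMetric (g : RiemMetric J N) : RiemMetric (J.prod 𝓘(ℝ, ℝ)) (N × PosReal) where
  inner := coneForm g
  symm p v w := by
    rw [coneForm_apply, coneForm_apply]
    exact congrArg₂ (· + ·) (congrArg (radius p ^ 2 * ·) (g.symm p.1 v.1 w.1))
      (mul_comm (v.2 : ℝ) (w.2 : ℝ))
  pos p v hv := by
    rw [coneForm_apply]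
    have hs := radius_pos p
    by_cases h1 : v.1 = 0
    · have h2 : (v.2 : ℝ) ≠ 0 := fun h2 => hv (Prod.ext h1 h2)
      exact add_pos_of_nonneg_of_pos (mul_nonneg (sq_nonneg _) (inner_self_nonneg g p.1 v.1))
        (mul_self_pos.2 h2)
    · exact add_pos_of_pos_of_nonneg (mul_pos (pow_pos hs 2) (g.pos p.1 v.1 h1))
        (mul_self_nonneg _)
  isVonNBounded p := by
    have hs := radius_pos p
    obtain ⟨R, hR⟩ := ((NormedSpace.isVonNBounded_iff ℝ).1
      (show Bornology.IsVonNBounded ℝ {v : F | g.inner p.1 v v < 1} from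
        g.isVonNBounded p.1)).exists_norm_le
    refine (NormedSpace.isVonNBounded_iff ℝ (E := F × ℝ)).2
      (isBounded_iff_forall_norm_le.2 ⟨max (R / radius p) 1, fun v hv => ?_⟩)
    have hv' : radius p ^ 2 * g.inner p.1 v.1 v.1 + v.2 * v.2 < 1 := by
      rw [← coneForm_apply g p v v]
      exact hv
    have hg : 0 ≤ g.inner p.1 v.1 v.1 := inner_self_nonneg g p.1 v.1
    refine max_le_max ?_ ?_
    · have h1 : g.inner p.1 (radius p • v.1 : F) (radius p • v.1 : F) < 1 := by
        have : g.inner p.1 (radius p • v.1 : F) (radius p • v.1 : F)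
            = radius p * (radius p * g.inner p.1 v.1 v.1) := by
          erw [map_smul, map_smul]
          rfl
        rw [this]
        nlinarith [mul_self_nonneg v.2]
      have h2 := hR _ h1
      rw [norm_smul, Real.norm_of_nonneg hs.le] at h2
      rw [le_div_iff₀ hs]
      linarith
    · rw [Real.norm_eq_abs]
      refine abs_le.2 ⟨?_, ?_⟩ <;> nlinarith [mul_nonneg (sq_nonneg (radius p)) hg]
  contMDiff := by
    have h1 := contMDiff_pullForm (J' := J.prod 𝓘(ℝ, ℝ)) (contMDiff_fst (M := N) (N := PosReal))
      g.contMDiff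
    have h2 := contMDiff_pullForm (J' := J.prod 𝓘(ℝ, ℝ)) (contMDiff_radius (J := J) (N := N))
      ((riemannianMetricVectorSpace ℝ).contMDiff.of_le (by simp))
    exact contMDiff_smul_add_form ((contMDiff_radius (J := J)).pow 2) h1 h2

/-- The dilation `(x, s) ↦ (x, q s)` of `N × ℝ^{>0}`, for `q > 0`. -/
def dilation {N : Type*} (q : PosReal) (p : N × PosReal) : N × PosReal :=
  (p.1, ⟨(q : ℝ) * (p.2 : ℝ), mul_pos (mem_Ioi.1 q.2) (mem_Ioi.1 p.2.2)⟩)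

/-- A field of endomorphisms of the tangent spaces of `N × ℝ^{>0}` is dilation invariant: it
commutes with the differentials of all dilations. -/
def IsDilationInvariant
    (A : Π p : N × PosReal,
      TangentSpace (J.prod 𝓘(ℝ, ℝ)) p →L[ℝ] TangentSpace (J.prod 𝓘(ℝ, ℝ)) p) : Prop :=
  ∀ (q : PosReal) (p : N × PosReal) (v : TangentSpace (J.prod 𝓘(ℝ, ℝ)) p),
    mfderiv (J.prod 𝓘(ℝ, ℝ)) (J.prod 𝓘(ℝ, ℝ)) (dilation q) p (A p v) =
      A (dilation q p) (mfderiv (J.prod 𝓘(ℝ, ℝ)) (J.prod 𝓘(ℝ, ℝ)) (dilation q) p v)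

/-- `(N, g)` is Sasakian: the cone metric `s² g + ds²` on `N × ℝ^{>0}` is Kähler with respect to a
dilation-invariant complex structure. -/
def IsSasakian (g : RiemMetric J N) : Prop :=
  ∃ A : Π p : N × PosReal,
      TangentSpace (J.prod 𝓘(ℝ, ℝ)) p →L[ℝ] TangentSpace (J.prod 𝓘(ℝ, ℝ)) p,
    IsKahler (coneMetric g) A ∧ IsDilationInvariant A

end Cone

end SasakiTangent

end

open Bundle Set
open scoped Manifold ContDiff Topology

noncomputable section

set_option synthInstance.maxHeartbeats 400000

namespace SasakiTangent


/-! The hypotheses say exactly that a connection of rank n + 1 is flat. On the sum of TM and a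
trivial line bundle put ∇_a (b, r) = (D_a b + r a, a(r) - c g(a, b)). The TM-component of its
curvature vanishes by the constant curvature identity and torsion-freeness, the scalar component by
the Codazzi symmetry of Dg (`IsLocalStatistical.tractor_flat`). Hence there is locally an invertible
T with dT = T B, where B is the connection form (`exists_parallel_frame`), and T carries parallel
sections to constants.

Let y be the fibre coordinate of TM, rescaled to v / √(1 + |c| g(v, v)) so that c g(y, y) < 1 on all
of TM; let t be the coordinate on ℝ and s the radius. The cone has dimension 2n + 2, and Z = s^(c/2)
e^(i c t/2) (T(0, 1) + i T(y, 0)) takes values in the complexification of ℝ^(n+1). In the coframe a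
= dq, b = Dy, η = dt - 2 g(y, dq), r = ds, the differential of Z is injective, because c ≠ 0, and
multiplication by i becomes J(a, b, η, r) = (-P⁻¹ b, P a, r / s, -s η), with P a = a - c g(y, a) y
(`fderiv_coneCoord`, `coneCoordFrame_rot`). So Z is a holomorphic chart for J
(`exists_holomorphic_chart`). J itself does not involve T, hence is globally defined.

The metric on TM × ℝ is G = g(P a, a) + g(P⁻¹ b, b) + η². It is positive because P is, by
Cauchy-Schwarz and c g(y, y) < 1. The cone metric s² G + ds² is J-invariant and its fundamental form
is s² (g(a, b') - g(b, a')) + s (r η' - η r') (`coneFrame_fundamental`). Since Dg is Codazzi and D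
is torsion-free, this is d(s² η / 2), so it is closed (`extDeriv_conePotential`). The radius enters
J only through r / s and s η, which gives dilation invariance (`coneRot_smul`).

All this is done in coordinates, from metric coefficients γ and Christoffel symbols Γ. The global
objects at a point use the preferred chart there, and the transition lemmas show that any other
chart gives the same answer. -/

/-! ### Positive definite forms -/

section Forms

variable {E : Type*} [NormedAddCommGroup E] [NormedSpace ℝ E]

/-- Inner products, as continuous bilinear forms. -/
structure IsInnerForm (h : E →L[ℝ] E →L[ℝ] ℝ) : Prop where
  symm : ∀ a b, h a b = h b a
  pos : ∀ a, a ≠ 0 → 0 < h a a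

lemma IsInnerForm.nonneg {h : E →L[ℝ] E →L[ℝ] ℝ} (hh : IsInnerForm h) (a : E) : 0 ≤ h a a := by
  by_cases ha : a = 0
  · simp [ha]
  · exact (hh.pos a ha).le

lemma IsInnerForm.cauchySchwarz {h : E →L[ℝ] E →L[ℝ] ℝ} (hh : IsInnerForm h) (a b : E) :
    h a b ^ 2 ≤ h a a * h b b := by
  by_cases hb : b = 0
  · simp [hb]
  have h1 := hh.nonneg (h b b • a - h a b • b)
  simp only [map_sub, map_smul, sub_apply, smul_apply, smul_eq_mul] at h1
  rw [hh.symm b a] at h1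
  have h2 := hh.pos b hb
  by_contra! h3
  nlinarith [mul_pos h2 (sub_pos.2 h3)]

/-- The unit ball of an inner product on a finite-dimensional space is bounded. -/
lemma IsInnerForm.isVonNBounded [FiniteDimensional ℝ E] {h : E →L[ℝ] E →L[ℝ] ℝ}
    (hh : IsInnerForm h) : Bornology.IsVonNBounded ℝ {v : E | h v v < 1} := by
  have hprop : ProperSpace E := FiniteDimensional.proper ℝ E
  rw [NormedSpace.isVonNBounded_iff]
  rcases (Metric.sphere (0 : E) 1).eq_empty_or_nonempty with he | hne
  · refine (Bornology.isBounded_singleton (x := (0 : E))).subset fun v _ => ?_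
    by_contra hv
    have : ‖v‖⁻¹ • v ∈ Metric.sphere (0 : E) 1 := by
      simp [norm_smul, inv_mul_cancel₀ (norm_ne_zero_iff.2 hv)]
    rw [he] at this
    exact this
  · obtain ⟨u, hu, hmin⟩ := (isCompact_sphere (0 : E) 1).exists_isMinOn hne
      (f := fun v => h v v) (h.continuous.clm_apply continuous_id).continuousOn
    have hu0 : u ≠ 0 := by
      rintro rfl
      simp at hu
    have hm := hh.pos u hu0
    -- With m = h u u the minimum on the unit sphere, m ‖v‖² ≤ h v v < 1. The bound 1 + 1/m avoids a
    -- square root, through 2 ‖v‖ ≤ 1 + ‖v‖².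
    refine isBounded_iff_forall_norm_le.2 ⟨1 + (h u u)⁻¹, fun v hv => ?_⟩
    by_cases hv0 : v = 0
    · simp only [hv0, norm_zero]; positivity
    have hn : 0 < ‖v‖ := norm_pos_iff.2 hv0
    have hs : ‖v‖⁻¹ • v ∈ Metric.sphere (0 : E) 1 := by
      simp [norm_smul, inv_mul_cancel₀ hn.ne']
    have h1 : h u u ≤ h (‖v‖⁻¹ • v) (‖v‖⁻¹ • v) := hmin hs
    simp only [map_smul, smul_apply, smul_eq_mul] at h1
    have h2 : h u u * (‖v‖ * ‖v‖) ≤ h v v := by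
      calc h u u * (‖v‖ * ‖v‖) ≤ (‖v‖⁻¹ * (‖v‖⁻¹ * h v v)) * (‖v‖ * ‖v‖) := by gcongr
        _ = h v v := by field_simp
    have h3 : ‖v‖ * ‖v‖ ≤ (h u u)⁻¹ := by
      rw [← one_div, le_div_iff₀ hm]
      have : h v v < 1 := hv
      linarith
    nlinarith [sq_nonneg (‖v‖ - 1)]

/-- The endomorphism `a ↦ a - c h(y, a) y`. -/
def deform (c : ℝ) (h : E →L[ℝ] E →L[ℝ] ℝ) (y : E) : E →L[ℝ] E :=
  ContinuousLinearMap.id ℝ E - c • (h y).smulRight y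

/-- The inverse of `deform c h y`. -/
def deformInv (c : ℝ) (h : E →L[ℝ] E →L[ℝ] ℝ) (y : E) : E →L[ℝ] E :=
  ContinuousLinearMap.id ℝ E + (c / (1 - c * h y y)) • (h y).smulRight y

@[simp] lemma deform_apply (c : ℝ) (h : E →L[ℝ] E →L[ℝ] ℝ) (y a : E) :
    deform c h y a = a - (c * h y a) • y := by
  simp [deform, smul_smul]

@[simp] lemma deformInv_apply (c : ℝ) (h : E →L[ℝ] E →L[ℝ] ℝ) (y a : E) :
    deformInv c h y a = a + (c / (1 - c * h y y) * h y a) • y := by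
  simp [deformInv, smul_smul]

section

variable {c : ℝ} {h : E →L[ℝ] E →L[ℝ] ℝ} {y : E}

/-- The Sherman-Morrison formula for a rank-one perturbation of the identity. -/
lemma deform_deformInv (hy : c * h y y < 1) (b : E) : deform c h y (deformInv c h y b) = b := by
  have : 1 - c * h y y ≠ 0 := by linarith
  rw [deform_apply, deformInv_apply, map_add, map_smul, smul_eq_mul, add_sub_assoc, ← sub_smul,
    add_eq_left]
  convert zero_smul ℝ y
  field_simp
  ring

lemma deformInv_deform (hy : c * h y y < 1) (a : E) : deformInv c h y (deform c h y a) = a := by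
  have : 1 - c * h y y ≠ 0 := by linarith
  rw [deform_apply, deformInv_apply, map_sub, map_smul, smul_eq_mul, sub_add, ← sub_smul,
    sub_eq_self]
  convert zero_smul ℝ y
  field_simp
  ring

lemma form_deform_comm (hh : IsInnerForm h) (a a' : E) :
    h (deform c h y a) a' = h a (deform c h y a') := by
  simp only [deform_apply, map_sub, map_smul, sub_apply, smul_apply, smul_eq_mul]
  rw [hh.symm a y]
  ring

lemma form_deformInv_comm (hh : IsInnerForm h) (a a' : E) :
    h (deformInv c h y a) a' = h a (deformInv c h y a') := by
  simp only [deformInv_apply, map_add, map_smul, add_apply, smul_apply, smul_eq_mul]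
  rw [hh.symm a y]
  ring

/-- The value is h a a - c (h y a)². For c ≤ 0 the second term only helps; for c ≥ 0 Cauchy-Schwarz
bounds c (h y a)² by c (h y y) (h a a), which is less than h a a. -/
lemma form_deform_pos (hh : IsInnerForm h) (hy : c * h y y < 1) {a : E} (ha : a ≠ 0) :
    0 < h (deform c h y a) a := by
  simp only [deform_apply, map_sub, map_smul, sub_apply, smul_apply, smul_eq_mul]
  have h1 := hh.pos a ha
  have h2 := hh.cauchySchwarz y a
  have h3 := hh.nonneg y
  rcases le_total c 0 with hc | hc
  · nlinarith [mul_nonneg (neg_nonneg.2 hc) (sq_nonneg (h y a))]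
  · nlinarith [mul_le_mul_of_nonneg_left h2 hc]

/-- Substituting a = `deformInv c h y b` turns the value into that of `form_deform_pos`. -/
lemma form_deformInv_pos (hh : IsInnerForm h) (hy : c * h y y < 1) {b : E} (hb : b ≠ 0) :
    0 < h (deformInv c h y b) b := by
  have h1 : deformInv c h y b ≠ 0 := fun h0 => hb <| by
    rw [← deform_deformInv hy b, h0, map_zero]
  have h2 := form_deform_pos hh hy h1
  rwa [deform_deformInv hy, hh.symm] at h2

end

/-- The model of the Sasakian metric, in an adapted frame. -/
def frameForm (c : ℝ) (h : E →L[ℝ] E →L[ℝ] ℝ) (y : E) :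
    (E × E) × ℝ →L[ℝ] (E × E) × ℝ →L[ℝ] ℝ :=
  pullForm (h ∘L deform c h y)
      (ContinuousLinearMap.fst ℝ E E ∘L ContinuousLinearMap.fst ℝ (E × E) ℝ)
    + pullForm (h ∘L deformInv c h y)
      (ContinuousLinearMap.snd ℝ E E ∘L ContinuousLinearMap.fst ℝ (E × E) ℝ)
    + pullForm (ContinuousLinearMap.mul ℝ ℝ) (ContinuousLinearMap.snd ℝ (E × E) ℝ)

lemma frameForm_apply (c : ℝ) (h : E →L[ℝ] E →L[ℝ] ℝ) (y : E) (w w' : (E × E) × ℝ) :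
    frameForm c h y w w' = h (deform c h y w.1.1) w'.1.1 + h (deformInv c h y w.1.2) w'.1.2
      + w.2 * w'.2 := by
  simp only [frameForm, add_apply, pullForm_apply]
  rfl

lemma isInnerForm_frameForm {c : ℝ} {h : E →L[ℝ] E →L[ℝ] ℝ} {y : E} (hh : IsInnerForm h)
    (hy : c * h y y < 1) : IsInnerForm (frameForm c h y) where
  symm w w' := by
    rw [frameForm_apply, frameForm_apply, form_deform_comm hh, form_deformInv_comm hh,
      hh.symm w.1.1, hh.symm w.1.2, mul_comm]
  pos w hw := by
    rw [frameForm_apply]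
    have h1 : 0 ≤ h (deform c h y w.1.1) w.1.1 := by
      by_cases h0 : w.1.1 = 0
      · simp [h0]
      · exact (form_deform_pos hh hy h0).le
    have h2 : 0 ≤ h (deformInv c h y w.1.2) w.1.2 := by
      by_cases h0 : w.1.2 = 0
      · simp [h0]
      · exact (form_deformInv_pos hh hy h0).le
    have h3 := mul_self_nonneg w.2
    by_contra! hle
    apply hw
    refine Prod.ext (Prod.ext ?_ ?_) ?_
    · by_contra h0
      linarith [form_deform_pos hh hy h0]
    · by_contra h0
      linarith [form_deformInv_pos hh hy h0]
    · exact mul_self_eq_zero.1 (by linarith)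

/-- The model of the complex structure of the cone, in an adapted frame, at radius `s`. -/
def frameRot (c : ℝ) (h : E →L[ℝ] E →L[ℝ] ℝ) (y : E) (s : ℝ) :
    ((E × E) × ℝ) × ℝ →L[ℝ] ((E × E) × ℝ) × ℝ :=
  let a := ContinuousLinearMap.fst ℝ E E ∘L ContinuousLinearMap.fst ℝ (E × E) ℝ ∘L
    ContinuousLinearMap.fst ℝ ((E × E) × ℝ) ℝ
  let b := ContinuousLinearMap.snd ℝ E E ∘L ContinuousLinearMap.fst ℝ (E × E) ℝ ∘L
    ContinuousLinearMap.fst ℝ ((E × E) × ℝ) ℝ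
  let η := ContinuousLinearMap.snd ℝ (E × E) ℝ ∘L ContinuousLinearMap.fst ℝ ((E × E) × ℝ) ℝ
  let r := ContinuousLinearMap.snd ℝ ((E × E) × ℝ) ℝ
  (((-(deformInv c h y ∘L b)).prod (deform c h y ∘L a)).prod (s⁻¹ • r)).prod (-(s • η))

lemma frameRot_apply (c : ℝ) (h : E →L[ℝ] E →L[ℝ] ℝ) (y : E) (s : ℝ) (w : ((E × E) × ℝ) × ℝ) :
    frameRot c h y s w = (((-deformInv c h y w.1.1.2, deform c h y w.1.1.1), s⁻¹ * w.2),
      -(s * w.1.2)) := rfl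

lemma frameRot_frameRot {c : ℝ} {h : E →L[ℝ] E →L[ℝ] ℝ} {y : E} (hy : c * h y y < 1) {s : ℝ}
    (hs : s ≠ 0) (w : ((E × E) × ℝ) × ℝ) :
    frameRot c h y s (frameRot c h y s w) = -w := by
  rw [frameRot_apply, frameRot_apply]
  refine Prod.ext (Prod.ext (Prod.ext ?_ ?_) ?_) ?_
  · simp only [deformInv_deform hy]; rfl
  · simp only [map_neg, deform_deformInv hy]; rfl
  · change s⁻¹ * -(s * w.1.2) = -w.1.2
    field_simp
  · change -(s * (s⁻¹ * w.2)) = -w.2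
    field_simp

/-- The fundamental form of the cone in an adapted frame. -/
lemma coneFrame_fundamental {c : ℝ} {h : E →L[ℝ] E →L[ℝ] ℝ} {y : E}
    (hy : c * h y y < 1) {s : ℝ} (hs : s ≠ 0) (w w' : ((E × E) × ℝ) × ℝ) :
    s ^ 2 * frameForm c h y (frameRot c h y s w).1 w'.1 + (frameRot c h y s w).2 * w'.2
      = s ^ 2 * (h w.1.1.1 w'.1.1.2 - h w.1.1.2 w'.1.1.1) + s * (w.2 * w'.1.2 - w.1.2 * w'.2) := by
  rw [frameForm_apply, frameRot_apply]
  simp only [map_neg, neg_apply, deform_deformInv hy, deformInv_deform hy]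
  field_simp
  ring

/-- The left side is the fundamental form at (w, J w'). The explicit formula for that form, together
with self-adjointness of `deform` and `deformInv`, gives back the metric. -/
lemma coneFrame_hermitian {c : ℝ} {h : E →L[ℝ] E →L[ℝ] ℝ} {y : E} (hh : IsInnerForm h)
    (hy : c * h y y < 1) {s : ℝ} (hs : s ≠ 0) (w w' : ((E × E) × ℝ) × ℝ) :
    s ^ 2 * frameForm c h y (frameRot c h y s w).1 (frameRot c h y s w').1
        + (frameRot c h y s w).2 * (frameRot c h y s w').2
      = s ^ 2 * frameForm c h y w.1 w'.1 + w.2 * w'.2 := by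
  rw [coneFrame_fundamental hy hs, frameForm_apply, frameRot_apply]
  simp only [map_neg]
  rw [form_deformInv_comm hh, form_deform_comm hh]
  field_simp
  ring

end Forms


/-! ### Parallel frames of flat connections -/

section Frobenius

variable {E : Type*} [NormedAddCommGroup E] [NormedSpace ℝ E]
  {𝔸 : Type*} [NormedRing 𝔸] [NormedAlgebra ℝ 𝔸]

/-- Linear differential equations `Y' = Y b` with small coefficients are solvable on `[0, 1]`. -/
lemma exists_linear_ode_solution [CompleteSpace 𝔸] {b : ℝ → 𝔸} {K : ℝ} (hK : 0 ≤ K)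
    (hb : ContinuousOn b (Icc 0 1)) (hbK : ∀ t ∈ Icc (0 : ℝ) 1, ‖b t‖ ≤ K)
    (hK1 : (‖(1 : 𝔸)‖ + 1) * K ≤ 1) :
    ∃ Y : ℝ → 𝔸, Y 0 = 1 ∧ ∀ t ∈ Icc (0 : ℝ) 1, HasDerivWithinAt Y (Y t * b t) (Icc 0 1) t := by
  -- On the unit ball about the initial value, ‖Y‖ ≤ ‖1‖ + 1, so the speed is at most (‖1‖ + 1) K.
  -- By `hK1` the solution cannot leave this ball within unit time.
  have hpl : IsPicardLindelof (fun t Y => Y * b t) (⟨0, by simp⟩ : Icc (0 : ℝ) 1) (1 : 𝔸) 1 0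
      ⟨(‖(1 : 𝔸)‖ + 1) * K, by positivity⟩ ⟨K, hK⟩ := by
    refine ⟨fun t ht => ?_, fun Y _ => continuousOn_const.mul hb, fun t ht Y hY => ?_, ?_⟩
    · refine LipschitzOnWith.of_dist_le_mul fun Y _ Z _ => ?_
      rw [dist_eq_norm, dist_eq_norm, ← sub_mul]
      refine (norm_mul_le _ _).trans ?_
      rw [mul_comm]
      exact mul_le_mul_of_nonneg_right (hbK t ht) (norm_nonneg _)
    · refine (norm_mul_le _ _).trans ?_
      refine mul_le_mul ?_ (hbK t ht) (norm_nonneg _) (by positivity)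
      have h1 : ‖Y - 1‖ ≤ 1 := by simpa [dist_eq_norm] using hY
      linarith [norm_le_norm_add_norm_sub' Y 1]
    · change (‖(1 : 𝔸)‖ + 1) * K * max (1 - 0) (0 - 0) ≤ 1 - 0
      simpa using hK1
  exact hpl.exists_eq_forall_mem_Icc_hasDerivWithinAt₀

lemma _root_.HasDerivWithinAt.Ici_of_Icc_zero_one {F : Type*} [NormedAddCommGroup F] [NormedSpace ℝ F]
    {f : ℝ → F} {f' : F} {t : ℝ}
    (h : HasDerivWithinAt f f' (Icc 0 1) t) (ht : t ∈ Ico (0 : ℝ) 1) :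
    HasDerivWithinAt f f' (Ici t) t :=
  h.mono_of_mem_nhdsWithin (Filter.mem_of_superset (Icc_mem_nhdsGE ht.2)
    (Icc_subset_Icc_left ht.1))

/-- Grönwall's inequality. The factor ‖1‖ stays because the norm of the unit of 𝔸 need not be 1. -/
lemma norm_le_of_linear_ode {b : ℝ → 𝔸} {K : ℝ} (hbK : ∀ t ∈ Icc (0 : ℝ) 1, ‖b t‖ ≤ K)
    {Y : ℝ → 𝔸} (hY0 : Y 0 = 1)
    (hY : ∀ t ∈ Icc (0 : ℝ) 1, HasDerivWithinAt Y (Y t * b t) (Icc 0 1) t) :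
    ∀ t ∈ Icc (0 : ℝ) 1, ‖Y t‖ ≤ ‖(1 : 𝔸)‖ * Real.exp K := by
  intro t ht
  have hK : 0 ≤ K := (norm_nonneg _).trans (hbK t ht)
  have := norm_le_gronwallBound_of_norm_deriv_right_le (f := Y) (f' := fun t => Y t * b t)
    (δ := ‖(1 : 𝔸)‖) (K := K) (ε := 0) (a := 0) (b := 1)
    (fun t ht => (hY t ht).continuousWithinAt)
    (fun t ht => (hY t (Ico_subset_Icc_self ht)).Ici_of_Icc_zero_one ht) (by rw [hY0])
    (fun t ht => by
      rw [add_zero, mul_comm]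
      exact (norm_mul_le _ _).trans
        (mul_le_mul_of_nonneg_left (hbK t (Ico_subset_Icc_self ht)) (norm_nonneg _))) t ht
  refine this.trans ?_
  rw [gronwallBound_ε0]
  refine mul_le_mul_of_nonneg_left (Real.exp_le_exp.2 ?_) (norm_nonneg _)
  nlinarith [ht.2]

/-- The comparison of two solutions along neighbouring rays, from flatness. -/
lemma ray_estimate {B : E → E →L[ℝ] 𝔸} {q₀ x h : E} {C : ℝ} {Y Z : ℝ → 𝔸} {β : ℝ → E →L[ℝ] E →L[ℝ] 𝔸}
    (hC : 0 ≤ C) (hC1 : C * ‖x + h‖ ≤ 1) (hCx : C * ‖x‖ ≤ 1) (hxh : ‖x + h‖ ≤ 1) (hh : ‖h‖ ≤ 2)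
    (hB : ∀ t ∈ Icc (0 : ℝ) 1, HasFDerivAt B (β t) (q₀ + t • x))
    (hBx : ∀ t ∈ Icc (0 : ℝ) 1, ‖B (q₀ + t • x)‖ ≤ C)
    (hBxh : ∀ t ∈ Icc (0 : ℝ) 1, ‖B (q₀ + t • (x + h))‖ ≤ C)
    (hβ : ∀ t ∈ Icc (0 : ℝ) 1, ‖β t‖ ≤ C)
    (hρ : ∀ t ∈ Icc (0 : ℝ) 1,
      ‖B (q₀ + t • (x + h)) - B (q₀ + t • x) - t • β t h‖ ≤ C * ‖h‖ ^ 2)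
    (hflat : ∀ t ∈ Icc (0 : ℝ) 1, β t x h + B (q₀ + t • x) x * B (q₀ + t • x) h
      = β t h x + B (q₀ + t • x) h * B (q₀ + t • x) x)
    (hY0 : Y 0 = 1) (hZ0 : Z 0 = 1)
    (hY : ∀ t ∈ Icc (0 : ℝ) 1, HasDerivWithinAt Y (Y t * B (q₀ + t • x) x) (Icc 0 1) t)
    (hZ : ∀ t ∈ Icc (0 : ℝ) 1,
      HasDerivWithinAt Z (Z t * B (q₀ + t • (x + h)) (x + h)) (Icc 0 1) t) :
    ‖Z 1 - Y 1 - Y 1 * B (q₀ + x) h‖ ≤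
      gronwallBound 0 1 (‖(1 : 𝔸)‖ * Real.exp 1 *
        (C + C ^ 2 + C ^ 2 + (‖(1 : 𝔸)‖ + 2 * C) * C)) 1 * ‖h‖ ^ 2 := by
  set N := ‖(1 : 𝔸)‖ * Real.exp 1 with hN
  set D := C + C ^ 2 + C ^ 2 + (‖(1 : 𝔸)‖ + 2 * C) * C with hD
  have hYN : ∀ t ∈ Icc (0 : ℝ) 1, ‖Y t‖ ≤ N := by
    refine norm_le_of_linear_ode (fun t ht => ?_) hY0 hY
    exact ((B _).le_opNorm x).trans
      ((mul_le_mul_of_nonneg_right (hBx t ht) (norm_nonneg _)).trans hCx)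
  -- The expected first-order approximation to Z: at time t the two rays are t h apart, and dT = T B
  -- predicts Z ≈ Y (1 + t B(h)).
  set W : ℝ → 𝔸 := fun t => Y t * (1 + t • B (q₀ + t • x) h) with hW
  set W' : ℝ → 𝔸 := fun t => Y t * B (q₀ + t • x) x * (1 + t • B (q₀ + t • x) h)
    + Y t * (t • β t x h + B (q₀ + t • x) h) with hW'
  have hWd : ∀ t ∈ Icc (0 : ℝ) 1, HasDerivWithinAt W (W' t) (Icc 0 1) t := by
    intro t ht
    have h1 : HasDerivAt (fun t : ℝ => q₀ + t • x) x t := by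
      simpa using ((hasDerivAt_id t).smul_const x).const_add q₀
    have h2 : HasDerivAt (fun t : ℝ => B (q₀ + t • x)) (β t x) t := (hB t ht).comp_hasDerivAt t h1
    have h3 : HasDerivAt (fun t : ℝ => B (q₀ + t • x) h) (β t x h) t := by
      simpa using h2.clm_apply (hasDerivAt_const t h)
    have h4 := ((hasDerivAt_id t).smul h3).const_add (1 : 𝔸)
    have h5 := (hY t ht).mul h4.hasDerivWithinAt
    have h6 : W = Y * fun t : ℝ => 1 + t • B (q₀ + t • x) h := rfl
    rw [h6]
    simpa [hW'] using h5
  have hWb : ∀ t ∈ Icc (0 : ℝ) 1,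
      dist (W' t) (W t * B (q₀ + t • (x + h)) (x + h)) ≤ N * D * ‖h‖ ^ 2 := by
    intro t ht
    set b := B (q₀ + t • x)
    set b' := B (q₀ + t • (x + h))
    set ρ := b' - b - t • β t h with hρd
    have hb' : b' = b + t • β t h + ρ := by rw [hρd]; abel
    have hfl := hflat t ht
    -- Flatness exchanges β(x, h) for β(h, x) plus a commutator. Then all terms of first order in h
    -- cancel, and each surviving summand is of second order, ρ being the Taylor remainder.
    have key : W' t - W t * b' (x + h) = - (Y t * (t • β t h h + t • (b h * b h)
        + t • (b h * (t • β t h (x + h))) + (1 + t • b h) * ρ (x + h))) := by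
      simp only [hW, hW']
      rw [hb']
      have hfl' : t • β t x h = t • (β t h x + b h * b x - b x * b h) := by
        rw [← hfl]; congr 1; abel
      rw [hfl']
      simp only [add_apply, smul_apply, map_add, mul_add, add_mul, smul_add, smul_sub, mul_sub,
        mul_one, one_mul, mul_smul_comm, smul_mul_assoc, mul_assoc]
      abel
    have ht0 := ht.1
    have ht1 := ht.2
    have hn (u : 𝔸) : ‖t • u‖ ≤ ‖u‖ := by
      rw [norm_smul, Real.norm_of_nonneg ht0]
      exact mul_le_of_le_one_left (norm_nonneg _) ht1
    have hbh : ‖b h‖ ≤ C * ‖h‖ :=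
      (b.le_opNorm h).trans (mul_le_mul_of_nonneg_right (hBx t ht) (norm_nonneg _))
    have hβh (u : E) : ‖β t h u‖ ≤ C * ‖h‖ * ‖u‖ :=
      ((β t).le_opNorm₂ h u).trans (by gcongr; exact hβ t ht)
    have e1 : ‖t • β t h h‖ ≤ C * ‖h‖ ^ 2 := (hn _).trans ((hβh h).trans (by rw [sq, mul_assoc]))
    have e2 : ‖t • (b h * b h)‖ ≤ C ^ 2 * ‖h‖ ^ 2 := by
      refine (hn _).trans ((norm_mul_le _ _).trans ?_)
      calc ‖b h‖ * ‖b h‖ ≤ (C * ‖h‖) * (C * ‖h‖) := by gcongr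
        _ = _ := by ring
    have e3 : ‖t • (b h * (t • β t h (x + h)))‖ ≤ C ^ 2 * ‖h‖ ^ 2 := by
      refine (hn _).trans ((norm_mul_le _ _).trans ?_)
      calc ‖b h‖ * ‖t • β t h (x + h)‖ ≤ (C * ‖h‖) * (C * ‖h‖ * ‖x + h‖) := by
            gcongr
            exact (hn _).trans (hβh _)
        _ ≤ (C * ‖h‖) * (C * ‖h‖ * 1) := by gcongr
        _ = _ := by ring
    have e4 : ‖(1 + t • b h) * ρ (x + h)‖ ≤ (‖(1 : 𝔸)‖ + 2 * C) * C * ‖h‖ ^ 2 := by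
      have h1 : ‖1 + t • b h‖ ≤ ‖(1 : 𝔸)‖ + 2 * C := by
        refine (norm_add_le _ _).trans (add_le_add_right ((hn _).trans (hbh.trans ?_)) _)
        nlinarith
      have h2 : ‖ρ (x + h)‖ ≤ C * ‖h‖ ^ 2 := by
        refine (ρ.le_opNorm _).trans ?_
        calc ‖ρ‖ * ‖x + h‖ ≤ C * ‖h‖ ^ 2 * 1 := by gcongr; exact hρ t ht
          _ = _ := mul_one _
      refine (norm_mul_le _ _).trans ?_
      calc ‖1 + t • b h‖ * ‖ρ (x + h)‖ ≤ (‖(1 : 𝔸)‖ + 2 * C) * (C * ‖h‖ ^ 2) := by gcongr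
        _ = _ := by ring
    rw [dist_eq_norm, key, norm_neg]
    refine (norm_mul_le _ _).trans ?_
    rw [mul_assoc]
    refine mul_le_mul (hYN t ht) ?_ (norm_nonneg _) (by positivity)
    refine (norm_add_le _ _).trans ?_
    have := norm_add₃_le (a := t • β t h h) (b := t • (b h * b h))
      (c := t • (b h * (t • β t h (x + h))))
    rw [hD]
    linarith
  have hlip : ∀ t ∈ Ico (0 : ℝ) 1, LipschitzOnWith 1
      (fun Z => Z * B (q₀ + t • (x + h)) (x + h)) (univ : Set 𝔸) := by
    intro t ht
    refine LipschitzOnWith.of_dist_le_mul fun Y _ Z _ => ?_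
    rw [dist_eq_norm, dist_eq_norm, ← sub_mul]
    refine (norm_mul_le _ _).trans ?_
    rw [mul_comm]
    refine mul_le_mul_of_nonneg_right ?_ (norm_nonneg _)
    exact ((B _).le_opNorm _).trans ((mul_le_mul_of_nonneg_right
      (hBxh t (Ico_subset_Icc_self ht)) (norm_nonneg _)).trans hC1)
  -- Z solves the equation along the ray x + h exactly and W up to N D ‖h‖², with equal initial
  -- values. The Lipschitz constant is 1 because C ‖x + h‖ ≤ 1.
  have := dist_le_of_approx_trajectories_ODE_of_mem (a := 0) (b := 1) (εf := 0)
    (εg := N * D * ‖h‖ ^ 2) (δ := 0) (s := fun _ => univ)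
    (v := fun t Z => Z * B (q₀ + t • (x + h)) (x + h)) hlip
    (fun t ht => (hZ t ht).continuousWithinAt)
    (fun t ht => (hZ t (Ico_subset_Icc_self ht)).Ici_of_Icc_zero_one ht)
    (fun t _ => (dist_self _).le) (fun _ _ => trivial)
    (fun t ht => (hWd t ht).continuousWithinAt)
    (fun t ht => (hWd t (Ico_subset_Icc_self ht)).Ici_of_Icc_zero_one ht)
    (fun t ht => hWb t (Ico_subset_Icc_self ht)) (fun _ _ => trivial)
    (by simp [hW, hY0, hZ0]) 1 (by simp)
  rw [dist_eq_norm] at this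
  have e : Z 1 - W 1 = Z 1 - Y 1 - Y 1 * B (q₀ + x) h := by
    simp only [hW, one_smul, mul_add, mul_one]
    abel
  rw [e] at this
  refine this.trans (le_of_eq ?_)
  -- With zero initial error the Grönwall bound is linear in the defect, so ‖h‖² factors out.
  rw [gronwallBound_of_K_ne_0 (by simp), gronwallBound_of_K_ne_0 (by simp)]
  simp
  ring

/-- Uniform bounds for the first-order Taylor expansion of a smooth map. -/
lemma exists_taylor_bounds {F : Type*} [NormedAddCommGroup F] [NormedSpace ℝ F] {B : E → F}
    {U : Set E} (hU : IsOpen U) (hB : ContDiffOn ℝ ∞ B U) {q₀ : E} (hq₀ : q₀ ∈ U) :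
    ∃ C δ : ℝ, 0 ≤ C ∧ 0 < δ ∧ (∀ q ∈ Metric.ball q₀ δ, q ∈ U ∧ ‖B q‖ ≤ C ∧ ‖fderiv ℝ B q‖ ≤ C) ∧
      ∀ p ∈ Metric.ball q₀ δ, ∀ p' ∈ Metric.ball q₀ δ,
        ‖B p' - B p - fderiv ℝ B p (p' - p)‖ ≤ C * ‖p' - p‖ ^ 2 := by
  have hBat : ∀ q ∈ U, ContDiffAt ℝ ∞ B q := fun q hq => hB.contDiffAt (hU.mem_nhds hq)
  have hB' : ContDiffAt ℝ 1 (fderiv ℝ B) q₀ := (hBat q₀ hq₀).fderiv_right (by norm_cast)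
  obtain ⟨K, s, hs, hK⟩ := hB'.exists_lipschitzOnWith
  -- The Lipschitz constant K of the derivative controls the quadratic remainder. The summand 1
  -- makes the other two bounds strict at q₀, so that they persist nearby.
  set C : ℝ := ‖B q₀‖ + ‖fderiv ℝ B q₀‖ + K + 1 with hCdef
  have hn1 := norm_nonneg (fderiv ℝ B q₀)
  have hn2 := norm_nonneg (B q₀)
  have hn3 := K.coe_nonneg
  have hC0 : 0 ≤ C := by positivity
  have hev : ∀ᶠ q in 𝓝 q₀, q ∈ s ∧ q ∈ U ∧ ‖B q‖ < C ∧ ‖fderiv ℝ B q‖ < C := by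
    have h1 : ‖B q₀‖ < C := by linarith
    have h2 : ‖fderiv ℝ B q₀‖ < C := by linarith
    filter_upwards [hs, hU.mem_nhds hq₀, (hBat q₀ hq₀).continuousAt.norm.eventually_lt_const h1,
      hB'.continuousAt.norm.eventually_lt_const h2] with q a1 a2 a3 a4
    exact ⟨a1, a2, a3, a4⟩
  obtain ⟨δ, hδ, hball⟩ := Metric.eventually_nhds_iff_ball.1 hev
  refine ⟨C, δ, hC0, hδ, fun q hq => ⟨(hball q hq).2.1, (hball q hq).2.2.1.le,
    (hball q hq).2.2.2.le⟩, fun p hp p' hp' => ?_⟩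
  have hseg : segment ℝ p p' ⊆ Metric.ball q₀ δ := (convex_ball q₀ δ).segment_subset hp hp'
  have := (convex_segment p p').norm_image_sub_le_of_norm_fderiv_le' (𝕜 := ℝ) (f := B)
    (φ := fderiv ℝ B p) (C := K * ‖p' - p‖)
    (fun z hz => (hBat z (hball z (hseg hz)).2.1).differentiableAt (by simp))
    (fun z hz => by
      have h1 := hK.dist_le_mul z (hball z (hseg hz)).1 p (hball p hp).1
      rw [dist_eq_norm, dist_eq_norm] at h1
      exact h1.trans (mul_le_mul_of_nonneg_left (norm_sub_le_of_mem_segment hz) K.2))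
    (left_mem_segment ℝ p p') (right_mem_segment ℝ p p')
  refine this.trans ?_
  rw [sq, ← mul_assoc]
  gcongr
  linarith

/-- Flat connections have parallel frames. -/
theorem exists_parallel_frame [CompleteSpace 𝔸] {B : E → E →L[ℝ] 𝔸} {U : Set E}
    (hU : IsOpen U) (hB : ContDiffOn ℝ ∞ B U) {q₀ : E} (hq₀ : q₀ ∈ U)
    (hflat : ∀ q ∈ U, ∀ a a', fderiv ℝ B q a a' + B q a * B q a'
      = fderiv ℝ B q a' a + B q a' * B q a) :
    ∃ (V : Set E) (T : E → 𝔸), IsOpen V ∧ q₀ ∈ V ∧ V ⊆ U ∧ T q₀ = 1 ∧ ContDiffOn ℝ ∞ T V ∧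
      ∀ q ∈ V, HasFDerivAt T (ContinuousLinearMap.mul ℝ 𝔸 (T q) ∘L B q) q := by
  have hBat : ∀ q ∈ U, ContDiffAt ℝ ∞ B q := fun q hq => hB.contDiffAt (hU.mem_nhds hq)
  obtain ⟨C, δ, hC0, hδ, hball, htay⟩ := exists_taylor_bounds hU hB hq₀
  -- The radius δ keeps rays in the region of uniform bounds. The second entry ensures the
  -- Picard-Lindelöf condition, r ≤ 1, and the smallness C ‖x‖ ≤ 1 required by `ray_estimate`.
  set r : ℝ := min δ (((‖(1 : 𝔸)‖ + 1) * (C + 1))⁻¹) with hr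
  have hr0 : 0 < r := by positivity
  have hrδ : r ≤ δ := min_le_left _ _
  have hrC : (‖(1 : 𝔸)‖ + 1) * (C + 1) * r ≤ 1 := by
    calc _ ≤ (‖(1 : 𝔸)‖ + 1) * (C + 1) * ((‖(1 : 𝔸)‖ + 1) * (C + 1))⁻¹ := by
          gcongr; exact min_le_right _ _
      _ = 1 := mul_inv_cancel₀ (by positivity)
  have hCr : (C + 1) * r ≤ 1 := by
    have : 0 ≤ ‖(1 : 𝔸)‖ * ((C + 1) * r) := by positivity
    nlinarith
  have hmem : ∀ {x : E}, ‖x‖ < r → ∀ t ∈ Icc (0 : ℝ) 1, q₀ + t • x ∈ Metric.ball q₀ δ := by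
    intro x hx t ht
    rw [mem_ball_iff_norm, add_sub_cancel_left, norm_smul, Real.norm_of_nonneg ht.1]
    nlinarith [ht.2, norm_nonneg x]
  have hsol : ∀ x : E, ∃ Y : ℝ → 𝔸, ‖x‖ < r → Y 0 = 1 ∧
      ∀ t ∈ Icc (0 : ℝ) 1, HasDerivWithinAt Y (Y t * B (q₀ + t • x) x) (Icc 0 1) t := by
    intro x
    by_cases hx : ‖x‖ < r
    · have hb1 : ContinuousOn (fun t : ℝ => B (q₀ + t • x) x) (Icc 0 1) := by
        intro t ht
        have h1 : ContinuousAt B (q₀ + t • x) := (hBat _ (hball _ (hmem hx t ht)).1).continuousAt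
        have h2 : ContinuousAt (fun t : ℝ => q₀ + t • x) t := by fun_prop
        exact ((ContinuousAt.comp (f := fun t : ℝ => q₀ + t • x) h1 h2).clm_apply
          continuousAt_const).continuousWithinAt
      have hb2 : ∀ t ∈ Icc (0 : ℝ) 1, ‖B (q₀ + t • x) x‖ ≤ C * r := fun t ht =>
        ((B _).le_opNorm x).trans
          (mul_le_mul (hball _ (hmem hx t ht)).2.1 hx.le (norm_nonneg _) hC0)
      have hb3 : (‖(1 : 𝔸)‖ + 1) * (C * r) ≤ 1 := by
        have : 0 ≤ (‖(1 : 𝔸)‖ + 1) * r := by positivity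
        nlinarith
      obtain ⟨Y, h1, h2⟩ := exists_linear_ode_solution (by positivity) hb1 hb2 hb3
      exact ⟨Y, fun _ => ⟨h1, h2⟩⟩
    · exact ⟨fun _ => 1, fun h => absurd h hx⟩
  choose Y hY using hsol
  -- T(q) is the solution transported along the straight segment from q₀ to q.
  set T : E → 𝔸 := fun q => Y (q - q₀) 1 with hT
  have hder : ∀ q ∈ Metric.ball q₀ r,
      HasFDerivAt T (ContinuousLinearMap.mul ℝ 𝔸 (T q) ∘L B q) q := by
    intro q hq
    have hx : ‖q - q₀‖ < r := by rwa [mem_ball_iff_norm] at hq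
    have hest : ∀ᶠ q' in 𝓝 q, ‖T q' - T q - (ContinuousLinearMap.mul ℝ 𝔸 (T q) ∘L B q) (q' - q)‖ ≤
        gronwallBound 0 1 (‖(1 : 𝔸)‖ * Real.exp 1 *
        (C + C ^ 2 + C ^ 2 + (‖(1 : 𝔸)‖ + 2 * C) * C)) 1 * ‖‖q' - q‖ ^ 2‖ := by
      filter_upwards [Metric.isOpen_ball.mem_nhds hq] with q' hq'
      have hx' : ‖q' - q₀‖ < r := by rwa [mem_ball_iff_norm] at hq'
      have he : q' - q₀ = (q - q₀) + (q' - q) := by abel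
      have hr1 : r ≤ 1 := by nlinarith
      obtain ⟨hY0, hYd⟩ := hY (q - q₀) hx
      obtain ⟨hZ0, hZd⟩ := hY (q' - q₀) hx'
      rw [he] at hx'
      have hCle : ∀ {z : E}, ‖z‖ < r → C * ‖z‖ ≤ 1 := by
        intro z hz
        nlinarith [norm_nonneg z]
      have main := ray_estimate (B := B) (q₀ := q₀) (x := q - q₀) (h := q' - q) (C := C)
        (Y := Y (q - q₀)) (Z := Y (q' - q₀)) (β := fun t => fderiv ℝ B (q₀ + t • (q - q₀)))
        hC0 (hCle hx') (hCle hx) (hx'.le.trans hr1) ?_ ?_ ?_ ?_ ?_ ?_ ?_ hY0 hZ0 hYd ?_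
      · rw [Real.norm_of_nonneg (sq_nonneg _)]
        have e : q₀ + (q - q₀) = q := by abel
        rw [e] at main
        exact main
      · have : q' - q = (q - q₀ + (q' - q)) - (q - q₀) := by abel
        rw [this]
        refine (norm_sub_le _ _).trans ?_
        linarith
      · intro t ht
        exact ((hBat _ (hball _ (hmem hx t ht)).1).differentiableAt (by simp)).hasFDerivAt
      · exact fun t ht => (hball _ (hmem hx t ht)).2.1
      · exact fun t ht => (hball _ (hmem hx' t ht)).2.1
      · exact fun t ht => (hball _ (hmem hx t ht)).2.2
      · intro t ht
        set p := q₀ + t • (q - q₀)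
        set p' := q₀ + t • (q - q₀ + (q' - q))
        have hpp : p' - p = t • (q' - q) := by simp only [p, p']; module
        have hp := hmem hx t ht
        have hp' := hmem hx' t ht
        have hle : ‖p' - p‖ ≤ ‖q' - q‖ := by
          rw [hpp, norm_smul, Real.norm_of_nonneg ht.1]
          exact mul_le_of_le_one_left (norm_nonneg _) ht.2
        have := htay p hp p' hp'
        rw [hpp, map_smul, ← hpp] at this
        refine this.trans ?_
        gcongr
      · exact fun t ht => hflat _ (hball _ (hmem hx t ht)).1 _ _
      · rw [← he]
        exact hZd
    rw [hasFDerivAt_iff_isLittleO]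
    refine (Asymptotics.IsBigO.of_bound _ hest).trans_isLittleO ?_
    have h1 : (fun q' => q' - q) =o[𝓝 q] fun _ => (1 : ℝ) := by
      rw [Asymptotics.isLittleO_one_iff]
      have : Filter.Tendsto (fun q' => q' - q) (𝓝 q) (𝓝 (q - q)) := by
        apply ContinuousAt.tendsto; fun_prop
      simpa using this
    have h2 := (h1.norm_left.mul_isBigO
      (Asymptotics.isBigO_refl (fun q' => ‖q' - q‖) (𝓝 q)))
    simp only [one_mul] at h2
    simpa [sq] using h2.norm_right
  have hsub : Metric.ball q₀ r ⊆ U := fun q hq => (hball q (Metric.ball_subset_ball hrδ hq)).1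
  refine ⟨Metric.ball q₀ r, T, Metric.isOpen_ball, Metric.mem_ball_self hr0, hsub, ?_, ?_, hder⟩
  · obtain ⟨h0, h1⟩ := hY 0 (by simpa using hr0)
    simp only [hT, sub_self]
    rw [← h0]
    -- Along the degenerate ray the equation reads Y' = Y B(0) = 0.
    refine constant_of_has_deriv_right_zero (fun t ht => (h1 t ht).continuousWithinAt)
      (fun t ht => ?_) 1 (by simp)
    simpa using (h1 t (Ico_subset_Icc_self ht)).Ici_of_Icc_zero_one ht
  · have hBr := hB.mono hsub
    -- Bootstrapping: dT = T B is of class Cⁿ as soon as T is, and then T is of class Cⁿ⁺¹.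
    refine contDiffOn_infty.2 fun n => ?_
    induction n with
    | zero =>
      exact contDiffOn_zero.2 fun q hq => (hder q hq).continuousAt.continuousWithinAt
    | succ n ih =>
      push_cast
      refine (contDiffOn_succ_iff_fderiv_of_isOpen Metric.isOpen_ball).2
        ⟨fun q hq => (hder q hq).differentiableAt.differentiableWithinAt, by simp, ?_⟩
      have : ContDiffOn ℝ n (fun q => ContinuousLinearMap.mul ℝ 𝔸 (T q) ∘L B q)
          (Metric.ball q₀ r) :=
        ((ContinuousLinearMap.mul ℝ 𝔸).contDiff.comp_contDiffOn ih).clm_comp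
          (hBr.of_le (by exact_mod_cast le_top))
      exact this.congr fun q hq => (hder q hq).fderiv

end Frobenius


/-! ### Statistical structures of constant curvature in coordinates -/

section Local

variable {E : Type*} [NormedAddCommGroup E] [NormedSpace ℝ E]

/-- A statistical structure of constant curvature `c` on an open set `U` of a vector space, given by
the metric `γ` and the Christoffel symbols `Γ`: the covariant derivative of a vector field `Y` in
the direction `a` is `dY(a) + Γ Y a`. -/
structure IsLocalStatistical (c : ℝ) (U : Set E) (γ : E → E →L[ℝ] E →L[ℝ] ℝ)
    (Γ : E → E →L[ℝ] E →L[ℝ] E) : Prop where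
  isOpen : IsOpen U
  contDiffOn_metric : ContDiffOn ℝ ∞ γ U
  contDiffOn_christoffel : ContDiffOn ℝ ∞ Γ U
  isInnerForm : ∀ q ∈ U, IsInnerForm (γ q)
  symm : ∀ q ∈ U, ∀ a b, Γ q a b = Γ q b a
  codazzi : ∀ q ∈ U, ∀ a b d,
    fderiv ℝ γ q a b d - γ q (Γ q b a) d - γ q b (Γ q d a)
      = fderiv ℝ γ q b a d - γ q (Γ q a b) d - γ q a (Γ q d b)
  curvature : ∀ q ∈ U, ∀ a b d,
    fderiv ℝ Γ q a d b - fderiv ℝ Γ q b d a + Γ q (Γ q d b) a - Γ q (Γ q d a) b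
      = c • (γ q b d • a - γ q a d • b)

/-- The factor `(1 + |c| t) ^ (-1/2)`. -/
def shrink (c t : ℝ) : ℝ := (√(1 + |c| * t))⁻¹

lemma shrink_pos (c : ℝ) {t : ℝ} (ht : 0 ≤ t) : 0 < shrink c t :=
  inv_pos.2 (Real.sqrt_pos.2 (by positivity))

lemma shrink_sq (c : ℝ) {t : ℝ} (ht : 0 ≤ t) : shrink c t ^ 2 = (1 + |c| * t)⁻¹ := by
  rw [shrink, inv_pow, Real.sq_sqrt (by positivity)]

lemma contDiffAt_shrink (c : ℝ) {t : ℝ} (ht : 0 ≤ t) : ContDiffAt ℝ ∞ (shrink c) t := by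
  have h : 0 < 1 + |c| * t := by positivity
  exact ((contDiffAt_const.add (contDiffAt_const.mul contDiffAt_id)).sqrt h.ne').inv
    (Real.sqrt_pos.2 h).ne'

lemma hasDerivAt_shrink (c : ℝ) {t : ℝ} (ht : 0 ≤ t) :
    HasDerivAt (shrink c) (-(|c| / 2) * shrink c t ^ 3) t := by
  have h : 0 < 1 + |c| * t := by positivity
  have h1 : HasDerivAt (fun t => 1 + |c| * t) |c| t := by
    simpa using ((hasDerivAt_id t).const_mul |c|).const_add 1
  have h2 := (h1.sqrt h.ne').inv (Real.sqrt_pos.2 h).ne'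
  refine h2.congr_deriv ?_
  simp only [shrink]
  have := (Real.sqrt_pos.2 h).ne'
  field_simp

/-- The fibrewise embedding of the tangent bundle onto a disc bundle. -/
def fib (c : ℝ) (γ : E → E →L[ℝ] E →L[ℝ] ℝ) (z : E × E) : E :=
  shrink c (γ z.1 z.2 z.2) • z.2

/-- The covariant derivative of the fibre coordinate `fib`. -/
def conn (c : ℝ) (γ : E → E →L[ℝ] E →L[ℝ] ℝ) (Γ : E → E →L[ℝ] E →L[ℝ] E) (z : E × E) :
    E × E →L[ℝ] E :=
  fderiv ℝ (fib c γ) z + Γ z.1 (fib c γ z) ∘L ContinuousLinearMap.fst ℝ E E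

lemma conn_apply (c : ℝ) (γ : E → E →L[ℝ] E →L[ℝ] ℝ) (Γ : E → E →L[ℝ] E →L[ℝ] E) (z w : E × E) :
    conn c γ Γ z w = fderiv ℝ (fib c γ) z w + Γ z.1 (fib c γ z) w.1 := rfl

/-- The contact form on the product of the tangent bundle and the line. -/
def contact (c : ℝ) (γ : E → E →L[ℝ] E →L[ℝ] ℝ) (z : E × E) : (E × E) × ℝ →L[ℝ] ℝ :=
  ContinuousLinearMap.snd ℝ (E × E) ℝ - (2 : ℝ) • (γ z.1 (fib c γ z) ∘L
    ContinuousLinearMap.fst ℝ E E ∘L ContinuousLinearMap.fst ℝ (E × E) ℝ)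

lemma contact_apply (c : ℝ) (γ : E → E →L[ℝ] E →L[ℝ] ℝ) (z : E × E) (w : (E × E) × ℝ) :
    contact c γ z w = w.2 - 2 * γ z.1 (fib c γ z) w.1.1 := rfl

/-- The adapted frame. -/
def frame (c : ℝ) (γ : E → E →L[ℝ] E →L[ℝ] ℝ) (Γ : E → E →L[ℝ] E →L[ℝ] E) (z : E × E) :
    (E × E) × ℝ →L[ℝ] (E × E) × ℝ :=
  ((ContinuousLinearMap.fst ℝ E E ∘L ContinuousLinearMap.fst ℝ (E × E) ℝ).prod
    (conn c γ Γ z ∘L ContinuousLinearMap.fst ℝ (E × E) ℝ)).prod (contact c γ z)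

lemma frame_apply (c : ℝ) (γ : E → E →L[ℝ] E →L[ℝ] ℝ) (Γ : E → E →L[ℝ] E →L[ℝ] E) (z : E × E)
    (w : (E × E) × ℝ) :
    frame c γ Γ z w = ((w.1.1, conn c γ Γ z w.1), contact c γ z w) := rfl

/-- The adapted frame of the cone. -/
def coneFrame (c : ℝ) (γ : E → E →L[ℝ] E →L[ℝ] ℝ) (Γ : E → E →L[ℝ] E →L[ℝ] E) (z : E × E) :
    ((E × E) × ℝ) × ℝ →L[ℝ] ((E × E) × ℝ) × ℝ :=
  (frame c γ Γ z).prodMap (ContinuousLinearMap.id ℝ ℝ)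

lemma coneFrame_apply (c : ℝ) (γ : E → E →L[ℝ] E →L[ℝ] ℝ) (Γ : E → E →L[ℝ] E →L[ℝ] E) (z : E × E)
    (w : ((E × E) × ℝ) × ℝ) :
    coneFrame c γ Γ z w = (frame c γ Γ z w.1, w.2) := rfl

/-- The Sasakian metric in coordinates. -/
def sasakiForm (c : ℝ) (γ : E → E →L[ℝ] E →L[ℝ] ℝ) (Γ : E → E →L[ℝ] E →L[ℝ] E) (z : E × E) :
    (E × E) × ℝ →L[ℝ] (E × E) × ℝ →L[ℝ] ℝ :=
  pullForm (frameForm c (γ z.1) (fib c γ z)) (frame c γ Γ z)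

/-- With t = γ(v, v) for the original fibre vector v, the left side is c t / (1 + |c| t), which is
below 1 for either sign of c. This is the purpose of the rescaling: `deform` stays invertible and
positive over the whole tangent bundle. -/
lemma fib_bound {c : ℝ} {γ : E → E →L[ℝ] E →L[ℝ] ℝ} {z : E × E} (h : IsInnerForm (γ z.1)) :
    c * γ z.1 (fib c γ z) (fib c γ z) < 1 := by
  have ht := h.nonneg z.2
  simp only [fib, map_smul, smul_apply, smul_eq_mul]
  rw [← mul_assoc (shrink _ _), ← sq, shrink_sq c ht, ← mul_assoc, mul_comm c, mul_assoc,
    inv_mul_lt_iff₀ (by positivity)]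
  nlinarith [le_abs_self c]

variable {c : ℝ} {U : Set E} {γ : E → E →L[ℝ] E →L[ℝ] ℝ} {Γ : E → E →L[ℝ] E →L[ℝ] E}

namespace IsLocalStatistical

variable (hS : IsLocalStatistical c U γ Γ)
include hS

lemma isOpen_tangent : IsOpen {z : E × E | z.1 ∈ U} := hS.isOpen.preimage continuous_fst

lemma contDiffAt_metric {q : E} (hq : q ∈ U) : ContDiffAt ℝ ∞ γ q :=
  hS.contDiffOn_metric.contDiffAt (hS.isOpen.mem_nhds hq)

lemma contDiffAt_fib {z : E × E} (hz : z.1 ∈ U) : ContDiffAt ℝ ∞ (fib c γ) z := by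
  have h1 : ContDiffAt ℝ ∞ (fun z : E × E => γ z.1) z :=
    (hS.contDiffAt_metric hz).comp z contDiffAt_fst
  have h2 : ContDiffAt ℝ ∞ (fun z : E × E => γ z.1 z.2 z.2) z :=
    (h1.clm_apply contDiffAt_snd).clm_apply contDiffAt_snd
  exact ((contDiffAt_shrink c ((hS.isInnerForm _ hz).nonneg z.2)).comp z h2).smul contDiffAt_snd

lemma contDiffAt_conn {z : E × E} (hz : z.1 ∈ U) : ContDiffAt ℝ ∞ (conn c γ Γ) z := by
  have h1 : ContDiffAt ℝ ∞ (fun z : E × E => Γ z.1) z :=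
    (hS.contDiffOn_christoffel.contDiffAt (hS.isOpen.mem_nhds hz)).comp z contDiffAt_fst
  exact ((hS.contDiffAt_fib hz).fderiv_right (by simp)).add
    ((h1.clm_apply (hS.contDiffAt_fib hz)).clm_comp contDiffAt_const)

lemma contDiffAt_contact_apply {z : E × E} (hz : z.1 ∈ U) (w : (E × E) × ℝ) :
    ContDiffAt ℝ ∞ (fun z => contact c γ z w) z := by
  have h1 : ContDiffAt ℝ ∞ (fun z : E × E => γ z.1) z :=
    (hS.contDiffAt_metric hz).comp z contDiffAt_fst
  exact contDiffAt_const.sub (contDiffAt_const.mul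
    ((h1.clm_apply (hS.contDiffAt_fib hz)).clm_apply contDiffAt_const))

lemma contDiffAt_frame_apply {z : E × E} (hz : z.1 ∈ U) (w : (E × E) × ℝ) :
    ContDiffAt ℝ ∞ (fun z => frame c γ Γ z w) z :=
  (contDiffAt_const.prodMk ((hS.contDiffAt_conn hz).clm_apply contDiffAt_const)).prodMk
    (hS.contDiffAt_contact_apply hz w)

lemma contDiffAt_sasakiForm_apply {z : E × E} (hz : z.1 ∈ U) (w w' : (E × E) × ℝ) :
    ContDiffAt ℝ ∞ (fun z => sasakiForm c γ Γ z w w') z := by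
  have hγ : ContDiffAt ℝ ∞ (fun z : E × E => γ z.1) z :=
    (hS.contDiffAt_metric hz).comp z contDiffAt_fst
  have hf := hS.contDiffAt_frame_apply hz w
  have hf' := hS.contDiffAt_frame_apply hz w'
  have hy := hS.contDiffAt_fib hz
  have ha := hf.fst.fst
  have ha' := hf'.fst.fst
  have hb := hf.fst.snd
  have hb' := hf'.fst.snd
  have hlt : 1 - c * γ z.1 (fib c γ z) (fib c γ z) ≠ 0 := by
    linarith [fib_bound (c := c) (hS.isInnerForm _ hz)]
  have h1 : ContDiffAt ℝ ∞ (fun z => deform c (γ z.1) (fib c γ z) (frame c γ Γ z w).1.1) z := by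
    simp only [deform_apply]
    exact ha.sub ((contDiffAt_const.mul ((hγ.clm_apply hy).clm_apply ha)).smul hy)
  have h2 : ContDiffAt ℝ ∞ (fun z => deformInv c (γ z.1) (fib c γ z) (frame c γ Γ z w).1.2) z := by
    simp only [deformInv_apply]
    exact hb.add (((contDiffAt_const.div (contDiffAt_const.sub
      (contDiffAt_const.mul ((hγ.clm_apply hy).clm_apply hy))) hlt).mul
      ((hγ.clm_apply hy).clm_apply hb)).smul hy)
  simp only [sasakiForm, pullForm_apply, frameForm_apply]
  exact (((hγ.clm_apply h1).clm_apply ha').add ((hγ.clm_apply h2).clm_apply hb')).add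
    (hf.snd.mul hf'.snd)

/-- The derivative of `fib` along the fibres. -/
lemma fderiv_fib_vertical {z : E × E} (hz : z.1 ∈ U) (b : E) :
    fderiv ℝ (fib c γ) z (0, b) = shrink c (γ z.1 z.2 z.2) • b
      + (-(|c| / 2) * shrink c (γ z.1 z.2 z.2) ^ 3 * (2 * γ z.1 z.2 b)) • z.2 := by
  have hd := (hS.contDiffAt_fib hz).differentiableAt (by simp)
  have h1 : HasDerivAt (fun r : ℝ => (z.1, z.2 + r • b)) ((0 : E), b) 0 := by
    refine (hasDerivAt_const _ _).prodMk ?_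
    simpa using ((hasDerivAt_id (0 : ℝ)).smul_const b).const_add z.2
  have h2 : HasFDerivAt (fib c γ) (fderiv ℝ (fib c γ) z) (z.1, z.2 + (0 : ℝ) • b) := by
    simpa using hd.hasFDerivAt
  have h3 := h2.comp_hasDerivAt (0 : ℝ) h1
  have h4 : HasDerivAt (fun r : ℝ => z.2 + r • b) b 0 := by
    simpa using ((hasDerivAt_id (0 : ℝ)).smul_const b).const_add z.2
  have h5 : HasDerivAt (fun r : ℝ => γ z.1 (z.2 + r • b) (z.2 + r • b)) (2 * γ z.1 z.2 b) 0 := by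
    have := ((γ z.1).hasFDerivAt.comp_hasDerivAt (0 : ℝ) h4).clm_apply h4
    refine this.congr_deriv ?_
    simp only [zero_smul, add_zero, Function.comp_apply]
    rw [(hS.isInnerForm _ hz).symm b, two_mul]
  have ht := (hS.isInnerForm _ hz).nonneg z.2
  have h6 : HasDerivAt (shrink c) (-(|c| / 2) * shrink c (γ z.1 z.2 z.2) ^ 3)
      (γ z.1 (z.2 + (0 : ℝ) • b) (z.2 + (0 : ℝ) • b)) := by
    simpa using hasDerivAt_shrink c ht
  have h7 := (h6.comp (0 : ℝ) h5).smul h4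
  have h8 := h3.unique h7
  rw [h8]
  simp

/-- Pairing the derivative with the fibre vector z.2 gives φ γ(z.2, b) / (1 + |c| γ(z.2, z.2)) = 0.
So b is orthogonal to z.2, and on such b the derivative is multiplication by φ > 0. -/
lemma conn_injective_vertical {z : E × E} (hz : z.1 ∈ U) {b : E} (hb : conn c γ Γ z (0, b) = 0) :
    b = 0 := by
  have hh := hS.isInnerForm _ hz
  have ht := hh.nonneg z.2
  rw [conn_apply, map_zero, add_zero, hS.fderiv_fib_vertical hz] at hb
  have hp := shrink_pos c ht
  have hsq := shrink_sq c ht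
  have hden : 0 < 1 + |c| * γ z.1 z.2 z.2 := by positivity
  set φ := shrink c (γ z.1 z.2 z.2)
  have h1 := congrArg (γ z.1 z.2) hb
  simp only [map_add, map_smul, smul_eq_mul, map_zero] at h1
  have h2 : φ * γ z.1 z.2 b * (1 - |c| * φ ^ 2 * γ z.1 z.2 z.2) = 0 := by
    rw [← h1]; ring
  have h3 : 1 - |c| * φ ^ 2 * γ z.1 z.2 z.2 = (1 + |c| * γ z.1 z.2 z.2)⁻¹ := by
    rw [hsq]
    field_simp
    ring
  rw [h3] at h2
  have h4 : γ z.1 z.2 b = 0 := by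
    rcases mul_eq_zero.1 h2 with h | h
    · exact (mul_eq_zero.1 h).resolve_left hp.ne'
    · exact absurd h (inv_pos.2 hden).ne'
  rw [h4] at hb
  simp only [mul_zero, zero_smul, add_zero] at hb
  exact (smul_eq_zero.1 hb).resolve_left hp.ne'

/-- The frame is block triangular: the base component is read off first, then the vertical one, then
the component along the line. -/
lemma frame_injective {z : E × E} (hz : z.1 ∈ U) : Function.Injective (frame c γ Γ z) := by
  refine (injective_iff_map_eq_zero _).2 fun w hw => ?_
  rw [frame_apply] at hw
  simp only [Prod.mk_eq_zero] at hw
  obtain ⟨⟨h1, h2⟩, h3⟩ := hw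
  have h4 : w.1 = (0, w.1.2) := Prod.ext h1 rfl
  rw [h4] at h2
  have h5 := hS.conn_injective_vertical hz h2
  rw [contact_apply, h1] at h3
  exact Prod.ext (Prod.ext h1 h5) (by simpa using h3)

lemma isInnerForm_sasakiForm {z : E × E} (hz : z.1 ∈ U) : IsInnerForm (sasakiForm c γ Γ z) := by
  have h := isInnerForm_frameForm (hS.isInnerForm _ hz) (fib_bound (c := c) (hS.isInnerForm _ hz))
  refine ⟨fun a b => h.symm _ _, fun a ha => h.pos _ fun h0 => ha ?_⟩
  exact hS.frame_injective hz (h0.trans (map_zero _).symm)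

lemma coneFrame_injective {z : E × E} (hz : z.1 ∈ U) :
    Function.Injective (coneFrame c γ Γ z) :=
  (hS.frame_injective hz).prodMap Function.injective_id

lemma isInvertible_coneFrame [FiniteDimensional ℝ E] {z : E × E} (hz : z.1 ∈ U) :
    (coneFrame c γ Γ z).IsInvertible :=
  ⟨(LinearEquiv.ofInjectiveEndo (coneFrame c γ Γ z).toLinearMap
    (hS.coneFrame_injective hz)).toContinuousLinearEquiv, rfl⟩

end IsLocalStatistical

/-! ### The fundamental form -/

/-- The potential `s² η / 2` of the fundamental form of the cone. -/
def conePotential (c : ℝ) (γ : E → E →L[ℝ] E →L[ℝ] ℝ) (p : ((E × E) × ℝ) × ℝ) :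
    (((E × E) × ℝ) × ℝ) [⋀^Fin 1]→L[ℝ] ℝ :=
  ContinuousAlternatingMap.ofSubsingleton ℝ _ ℝ (0 : Fin 1)
    ((p.2 ^ 2 / 2) • (contact c γ p.1.1 ∘L ContinuousLinearMap.fst ℝ ((E × E) × ℝ) ℝ))

namespace IsLocalStatistical

variable (hS : IsLocalStatistical c U γ Γ)
include hS

lemma contDiffAt_contact {z : E × E} (hz : z.1 ∈ U) : ContDiffAt ℝ ∞ (contact c γ) z := by
  have h1 : ContDiffAt ℝ ∞ (fun z : E × E => γ z.1) z :=
    (hS.contDiffAt_metric hz).comp z contDiffAt_fst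
  exact contDiffAt_const.sub
    (((h1.clm_apply (hS.contDiffAt_fib hz)).clm_comp contDiffAt_const).const_smul (2 : ℝ))

lemma contDiffAt_conePotential {p : ((E × E) × ℝ) × ℝ} (hp : p.1.1.1 ∈ U) :
    ContDiffAt ℝ ∞ (conePotential c γ) p := by
  have h0 : ContDiffAt ℝ ∞ (fun p : ((E × E) × ℝ) × ℝ => p.1.1) p := by fun_prop
  have h1 : ContDiffAt ℝ ∞ (contact c γ ∘ fun p : ((E × E) × ℝ) × ℝ => p.1.1) p :=
    (hS.contDiffAt_contact hp).comp p h0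
  have h2 : ContDiffAt ℝ ∞ (fun p : ((E × E) × ℝ) × ℝ => (p.2 ^ 2 / 2) •
      (contact c γ p.1.1 ∘L ContinuousLinearMap.fst ℝ ((E × E) × ℝ) ℝ)) p :=
    ((contDiffAt_snd.pow 2).div_const 2).smul (h1.clm_comp contDiffAt_const)
  have h3 : ContDiff ℝ ∞ (ContinuousAlternatingMap.ofSubsingletonLIE (𝕜 := ℝ) (E := ((E × E) × ℝ) × ℝ) (F := ℝ)
    (0 : Fin 1)) := LinearIsometryEquiv.contDiff _
  exact ContDiffAt.comp p h3.contDiffAt h2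

lemma fderiv_contact {z : E × E} (hz : z.1 ∈ U) (w' : (E × E) × ℝ) (w : E × E) :
    fderiv ℝ (fun z => contact c γ z w') z w =
      -2 * (fderiv ℝ γ z.1 w.1 (fib c γ z) w'.1.1
        + γ z.1 (fderiv ℝ (fib c γ) z w) w'.1.1) := by
  have h1 : HasFDerivAt (fun z : E × E => γ z.1)
      (fderiv ℝ γ z.1 ∘L ContinuousLinearMap.fst ℝ E E) z :=
    ((hS.contDiffAt_metric hz).differentiableAt (by simp)).hasFDerivAt.comp z hasFDerivAt_fst
  have h2 := ((hS.contDiffAt_fib hz).differentiableAt (by simp)).hasFDerivAt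
  have h3 := (((h1.clm_apply h2).clm_apply (hasFDerivAt_const w'.1.1 z)).const_mul 2).const_sub w'.2
  have h4 : (fun z => contact c γ z w') = fun z => w'.2 - 2 * γ z.1 (fib c γ z) w'.1.1 := rfl
  rw [h4, h3.fderiv]
  simp
  ring

/-- The exterior derivative of the potential, in the adapted frame. -/
lemma extDeriv_conePotential {p : ((E × E) × ℝ) × ℝ} (hp : p.1.1.1 ∈ U)
    (v v' : ((E × E) × ℝ) × ℝ) :
    extDeriv (conePotential c γ) p ![v, v'] =
      p.2 ^ 2 * (γ p.1.1.1 v.1.1.1 (conn c γ Γ p.1.1 v'.1.1)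
        - γ p.1.1.1 (conn c γ Γ p.1.1 v.1.1) v'.1.1.1)
      + p.2 * (v.2 * contact c γ p.1.1 v'.1 - contact c γ p.1.1 v.1 * v'.2) := by
  have hd : ∀ v v' : ((E × E) × ℝ) × ℝ,
      fderiv ℝ (fun p => p.2 ^ 2 / 2 * contact c γ p.1.1 v'.1) p v =
      p.2 * v.2 * contact c γ p.1.1 v'.1
        - p.2 ^ 2 * (fderiv ℝ γ p.1.1.1 v.1.1.1 (fib c γ p.1.1) v'.1.1.1
        + γ p.1.1.1 (fderiv ℝ (fib c γ) p.1.1 v.1.1) v'.1.1.1) := by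
    intro v v'
    have h1 : HasFDerivAt (fun p : ((E × E) × ℝ) × ℝ => contact c γ p.1.1 v'.1) _ p :=
      HasFDerivAt.comp (g := fun z => contact c γ z v'.1) (f := fun p => p.1.1) p
        ((hS.contDiffAt_contact_apply hp v'.1).differentiableAt (by simp)).hasFDerivAt
        (hasFDerivAt_fst.comp p hasFDerivAt_fst)
    have h2 : HasFDerivAt (fun p : ((E × E) × ℝ) × ℝ => p.2 ^ 2 / 2)
        (p.2 • ContinuousLinearMap.snd ℝ ((E × E) × ℝ) ℝ) p := by
      have := ((hasFDerivAt_snd (𝕜 := ℝ) (p := p)).pow 2).mul_const (2⁻¹ : ℝ)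
      refine (this.congr_fderiv ?_).congr_of_eventuallyEq (.of_forall fun q => div_eq_mul_inv _ _)
      ext <;> simp
    have h4 := (h2.mul h1).fderiv
    rw [show (fun p : ((E × E) × ℝ) × ℝ => p.2 ^ 2 / 2 * contact c γ p.1.1 v'.1)
      = (fun p => p.2 ^ 2 / 2) * fun p => contact c γ p.1.1 v'.1 from rfl, h4]
    have h3 := hS.fderiv_contact hp v'.1 v.1.1
    simp only [add_apply, smul_apply, ContinuousLinearMap.comp_apply,
      ContinuousLinearMap.coe_fst', ContinuousLinearMap.coe_snd', smul_eq_mul]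
    rw [h3]
    ring
  rw [extDeriv_apply ((hS.contDiffAt_conePotential hp).differentiableAt (by simp))]
  have e0 : (fun x => conePotential c γ x ((0 : Fin 2).removeNth ![v, v']))
    = fun p => p.2 ^ 2 / 2 * contact c γ p.1.1 v'.1 := rfl
  have e1 : (fun x => conePotential c γ x ((1 : Fin 2).removeNth ![v, v']))
    = fun p => p.2 ^ 2 / 2 * contact c γ p.1.1 v.1 := rfl
  rw [Fin.sum_univ_two, e0, e1]
  simp only [Fin.val_zero, Fin.val_one, pow_zero, pow_one, one_smul, neg_smul,
    Matrix.cons_val_zero, Matrix.cons_val_one]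
  rw [hd, hd]
  -- The Codazzi equation, taken at the vector y = `fib`, trades the antisymmetrised derivative of γ
  -- for Christoffel terms, which complete dy to Dy. The two terms with Γ(a, b) and Γ(b, a) cancel
  -- by symmetry of Γ.
  have hcod := hS.codazzi _ hp v.1.1.1 v'.1.1.1 (fib c γ p.1.1)
  have hh := hS.isInnerForm _ hp
  have hdsymm : ∀ u a b, fderiv ℝ γ p.1.1.1 u a b = fderiv ℝ γ p.1.1.1 u b a := by
    intro u a b
    have hγd := ((hS.contDiffAt_metric hp).differentiableAt (by simp)).hasFDerivAt
    have h1 := (hγd.clm_apply (hasFDerivAt_const a _)).clm_apply (hasFDerivAt_const b _)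
    have h2 := (hγd.clm_apply (hasFDerivAt_const b _)).clm_apply (hasFDerivAt_const a _)
    have h3 : (fun q => γ q a b) =ᶠ[𝓝 p.1.1.1] fun q => γ q b a := by
      filter_upwards [hS.isOpen.mem_nhds hp] with q hq
      exact (hS.isInnerForm q hq).symm a b
    have h4 := (h1.congr_of_eventuallyEq h3.symm).unique h2
    simpa using DFunLike.congr_fun h4 u
  rw [hdsymm _ (fib c γ p.1.1), hdsymm _ (fib c γ p.1.1)]
  simp only [conn_apply, map_add, add_apply]
  rw [hS.symm _ hp v.1.1.1 v'.1.1.1] at hcod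
  have s1 := hh.symm v.1.1.1 (fderiv ℝ (fib c γ) p.1.1 v'.1.1)
  have s2 := hh.symm v'.1.1.1 (Γ p.1.1.1 (fib c γ p.1.1) v.1.1.1)
  linear_combination (-p.2 ^ 2) * hcod - p.2 ^ 2 * s1 - p.2 ^ 2 * s2

end IsLocalStatistical

end Local


section Local

variable {E : Type*} [NormedAddCommGroup E] [NormedSpace ℝ E] [FiniteDimensional ℝ E]

/-! ### Flat sections of the sum of the tangent bundle and a line bundle -/

/-- The connection form of the flat connection `(b, r) ↦ (D b + r a, - c g(a, b))`. -/
def tractor (c : ℝ) (γ : E → E →L[ℝ] E →L[ℝ] ℝ) (Γ : E → E →L[ℝ] E →L[ℝ] E) (q : E) :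
    E →L[ℝ] (E × ℝ →L[ℝ] E × ℝ) :=
  LinearMap.toContinuousLinearMap
    { toFun := fun a => ((Γ q).flip a ∘L ContinuousLinearMap.fst ℝ E ℝ
        + (ContinuousLinearMap.snd ℝ E ℝ).smulRight a).prod
          (-c • (γ q a ∘L ContinuousLinearMap.fst ℝ E ℝ))
      map_add' := fun a a' => by ext <;> simp
      map_smul' := fun r a => by ext <;> simp; ring }

lemma tractor_apply (c : ℝ) (γ : E → E →L[ℝ] E →L[ℝ] ℝ) (Γ : E → E →L[ℝ] E →L[ℝ] E) (q a : E)
    (p : E × ℝ) : tractor c γ Γ q a p = (Γ q p.1 a + p.2 • a, -c * γ q a p.1) := rfl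

variable {c : ℝ} {U : Set E} {γ : E → E →L[ℝ] E →L[ℝ] ℝ} {Γ : E → E →L[ℝ] E →L[ℝ] E}

lemma IsLocalStatistical.contDiffOn_tractor (hS : IsLocalStatistical c U γ Γ) :
    ContDiffOn ℝ ∞ (tractor c γ Γ) U := by
  refine contDiffOn_clm_apply.2 fun a => contDiffOn_clm_apply.2 fun p => ?_
  simp only [tractor_apply]
  exact (((hS.contDiffOn_christoffel.clm_apply contDiffOn_const).clm_apply contDiffOn_const).add
    contDiffOn_const).prodMk (contDiffOn_const.mul
      ((hS.contDiffOn_metric.clm_apply contDiffOn_const).clm_apply contDiffOn_const))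

lemma IsLocalStatistical.fderiv_tractor (hS : IsLocalStatistical c U γ Γ) {q : E} (hq : q ∈ U)
    (a a' : E) (p : E × ℝ) :
    fderiv ℝ (tractor c γ Γ) q a a' p = (fderiv ℝ Γ q a p.1 a', -c * fderiv ℝ γ q a a' p.1) := by
  have hn := hS.isOpen.mem_nhds hq
  have h1 := ((hS.contDiffOn_tractor.contDiffAt hn).differentiableAt (by simp)).hasFDerivAt
  have h2 := ((hS.contDiffOn_metric.contDiffAt hn).differentiableAt (by simp)).hasFDerivAt
  have h3 := ((hS.contDiffOn_christoffel.contDiffAt hn).differentiableAt (by simp)).hasFDerivAt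
  have h4 := (h1.clm_apply (hasFDerivAt_const a' q)).clm_apply (hasFDerivAt_const p q)
  have h5 := (((h3.clm_apply (hasFDerivAt_const p.1 q)).clm_apply (hasFDerivAt_const a' q)).add_const
    (p.2 • a')).prodMk
    (((h2.clm_apply (hasFDerivAt_const a' q)).clm_apply (hasFDerivAt_const p.1 q)).const_mul (-c))
  have h6 := DFunLike.congr_fun (h4.unique h5) a
  simpa using h6

/-- In the E-component, the curvature of Γ is cancelled by the terms -c γ(a', b) a and -c γ(a, b)
a', and the terms in r agree by symmetry of Γ. The scalar component is the Codazzi equation times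
-c, with the terms in r agreeing by symmetry of γ. -/
lemma IsLocalStatistical.tractor_flat (hS : IsLocalStatistical c U γ Γ) {q : E} (hq : q ∈ U)
    (a a' : E) :
    fderiv ℝ (tractor c γ Γ) q a a' + tractor c γ Γ q a * tractor c γ Γ q a'
      = fderiv ℝ (tractor c γ Γ) q a' a + tractor c γ Γ q a' * tractor c γ Γ q a := by
  refine ContinuousLinearMap.ext fun p => ?_
  have hcurv := hS.curvature q hq a a' p.1
  have hcod := hS.codazzi q hq a a' p.1
  have hsym := hS.symm q hq a a'
  change fderiv ℝ (tractor c γ Γ) q a a' p + tractor c γ Γ q a (tractor c γ Γ q a' p)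
      = fderiv ℝ (tractor c γ Γ) q a' a p + tractor c γ Γ q a' (tractor c γ Γ q a p)
  simp only [hS.fderiv_tractor hq, tractor_apply,
    map_add, map_smul, add_apply, smul_apply, Prod.mk_add_mk, smul_eq_mul]
  refine Prod.ext ?_ ?_
  · dsimp only
    rw [← sub_eq_zero] at hcurv ⊢
    rw [← hcurv, hsym]
    module
  · dsimp only
    rw [hsym] at hcod
    rw [(hS.isInnerForm q hq).symm a a']
    linear_combination (-c) * hcod

/-! ### Holomorphic coordinates on the cone -/

section Complexify

variable (E)

/-- The complex dimension of the cone. -/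
abbrev coneDim : ℕ := Module.finrank ℝ (E × ℝ)

/-- The identification of the complexification of `E × ℝ` with a complex coordinate space. -/
def complexify : (E × ℝ) × (E × ℝ) →L[ℝ] EuclideanSpace ℂ (Fin (coneDim E)) :=
  LinearMap.toContinuousLinearMap
    { toFun := fun p => WithLp.toLp 2 fun i => ((Module.finBasis ℝ (E × ℝ)).coord i p.1 : ℂ)
        + Complex.I * ((Module.finBasis ℝ (E × ℝ)).coord i p.2 : ℂ)
      map_add' := fun p p' => by
        ext i
        simp only [Prod.fst_add, Prod.snd_add, map_add, Complex.ofReal_add, PiLp.add_apply]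
        ring
      map_smul' := fun r p => by
        ext i
        simp only [Prod.smul_fst, Prod.smul_snd, map_smul, smul_eq_mul, Complex.ofReal_mul,
          PiLp.smul_apply, RingHom.id_apply, Complex.real_smul]
        ring }

variable {E}

lemma complexify_apply (p : (E × ℝ) × (E × ℝ)) (i : Fin (coneDim E)) :
    complexify E p i = ((Module.finBasis ℝ (E × ℝ)).coord i p.1 : ℂ)
        + Complex.I * ((Module.finBasis ℝ (E × ℝ)).coord i p.2 : ℂ) := rfl

lemma I_smul_complexify (p₁ p₂ : E × ℝ) :
    Complex.I • complexify E (p₁, p₂) = complexify E (-p₂, p₁) := by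
  ext i
  rw [PiLp.smul_apply, complexify_apply, complexify_apply]
  simp only [smul_eq_mul, map_neg, Complex.ofReal_neg]
  linear_combination ((Module.finBasis ℝ (E × ℝ)).coord i p₂ : ℂ) * Complex.I_mul_I

lemma complexify_injective : Function.Injective (complexify E) := by
  refine (injective_iff_map_eq_zero _).2 fun p hp => ?_
  have h : ∀ i, (Module.finBasis ℝ (E × ℝ)).coord i p.1 = 0
      ∧ (Module.finBasis ℝ (E × ℝ)).coord i p.2 = 0 := by
    intro i
    have h1 : complexify E p i = 0 := by rw [hp]; rfl
    rw [complexify_apply] at h1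
    have h2 := congrArg Complex.re h1
    have h3 := congrArg Complex.im h1
    exact ⟨by simpa using h2, by simpa using h3⟩
  refine Prod.ext ?_ ?_
  · exact (Module.finBasis ℝ (E × ℝ)).forall_coord_eq_zero_iff.1 fun i => (h i).1
  · exact (Module.finBasis ℝ (E × ℝ)).forall_coord_eq_zero_iff.1 fun i => (h i).2

lemma finrank_cone : Module.finrank ℝ (((E × E) × ℝ) × ℝ)
    = Module.finrank ℝ (EuclideanSpace ℂ (Fin (coneDim E))) := by
  have h : Module.finrank ℝ (EuclideanSpace ℂ (Fin (coneDim E))) = 2 * coneDim E := by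
    rw [finrank_real_of_complex, finrank_euclideanSpace_fin]
  rw [h, coneDim]
  simp only [Module.finrank_prod, Module.finrank_self]
  ring

end Complexify

/-- The radial factor of the holomorphic coordinates. -/
def coneFactor (c : ℝ) (w : ((E × E) × ℝ) × ℝ) : ℂ :=
  Complex.exp ((c / 2 * Real.log w.2 : ℝ) + (c / 2 * w.1.2 : ℝ) * Complex.I)

/-- The holomorphic coordinates attached to a parallel frame `T`. -/
def coneCoord (c : ℝ) (γ : E → E →L[ℝ] E →L[ℝ] ℝ) (T : E → (E × ℝ →L[ℝ] E × ℝ))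
    (w : ((E × E) × ℝ) × ℝ) : EuclideanSpace ℂ (Fin (coneDim E)) :=
  coneFactor c w • complexify E (T w.1.1.1 (0, 1), T w.1.1.1 (fib c γ w.1.1, 0))

/-- The differential of the holomorphic coordinates in the adapted frame. -/
def coneCoordFrame (c : ℝ) (γ : E → E →L[ℝ] E →L[ℝ] ℝ) (T : E → (E × ℝ →L[ℝ] E × ℝ))
    (w : ((E × E) × ℝ) × ℝ) (u : ((E × E) × ℝ) × ℝ) : EuclideanSpace ℂ (Fin (coneDim E)) :=
  coneFactor c w • complexify E
    (T w.1.1.1 (deform c (γ w.1.1.1) (fib c γ w.1.1) u.1.1.1 - (c / 2 * u.1.2) • fib c γ w.1.1,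
      c / 2 * (w.2⁻¹ * u.2)),
     T w.1.1.1 (u.1.1.2 + (c / 2 * (w.2⁻¹ * u.2)) • fib c γ w.1.1, c / 2 * u.1.2))

/-- Multiplication by i sends a pair (real part, imaginary part) to (-imaginary part, real part).
The substitution a ↦ -P⁻¹ b, b ↦ P a, η ↦ r / s, r ↦ -s η, where P is `deform`, has the same effect
on the two parts of the differential. This is how `frameRot` is determined. -/
lemma coneCoordFrame_rot {w : ((E × E) × ℝ) × ℝ} (hh : IsInnerForm (γ w.1.1.1)) (hs : w.2 ≠ 0)
    (T : E → (E × ℝ →L[ℝ] E × ℝ)) (u : ((E × E) × ℝ) × ℝ) :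
    coneCoordFrame c γ T w (frameRot c (γ w.1.1.1) (fib c γ w.1.1) w.2 u)
      = Complex.I • coneCoordFrame c γ T w u := by
  rw [coneCoordFrame, coneCoordFrame, smul_comm, I_smul_complexify, frameRot_apply]
  simp only [map_neg, deform_deformInv (fib_bound (c := c) hh)]
  congr 3
  · rw [← map_neg]
    congr 1
    refine Prod.ext ?_ ?_
    · simp only [Prod.fst_neg]
      module
    · simp only [Prod.snd_neg]
      field_simp
  · congr 1
    refine Prod.ext ?_ rfl
    dsimp only
    have : w.2⁻¹ * -(w.2 * u.1.2) = - u.1.2 := by field_simp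
    rw [this]
    module

/-- The scalar components are (c/2) r / s and (c/2) η, so their vanishing forces r = η = 0; this is
where c ≠ 0 enters. What remains is `deform` of a, and b itself. -/
lemma coneCoordFrame_injective {w : ((E × E) × ℝ) × ℝ} (hc : c ≠ 0)
    (hh : IsInnerForm (γ w.1.1.1)) (hs : w.2 ≠ 0) {T : E → (E × ℝ →L[ℝ] E × ℝ)}
    (hT : Function.Injective (T w.1.1.1)) {u : ((E × E) × ℝ) × ℝ}
    (hu : coneCoordFrame c γ T w u = 0) : u = 0 := by
  have h1 := (smul_eq_zero.1 hu).resolve_left (Complex.exp_ne_zero _)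
  have h2 := complexify_injective (h1.trans (map_zero _).symm)
  have h3 : T w.1.1.1 _ = 0 := congrArg Prod.fst h2
  have h4 : T w.1.1.1 _ = 0 := congrArg Prod.snd h2
  have h5 := hT (h3.trans (map_zero _).symm)
  have h6 := hT (h4.trans (map_zero _).symm)
  have h7 : c / 2 * (w.2⁻¹ * u.2) = 0 := congrArg Prod.snd h5
  have h8 : c / 2 * u.1.2 = 0 := congrArg Prod.snd h6
  have hc2 : c / 2 ≠ 0 := div_ne_zero hc two_ne_zero
  have h9 : u.1.2 = 0 := (mul_eq_zero.1 h8).resolve_left hc2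
  have h10 : u.2 = 0 := ((mul_eq_zero.1 ((mul_eq_zero.1 h7).resolve_left hc2)).resolve_left
    (inv_ne_zero hs))
  have h11 := congrArg Prod.fst h5
  have h12 := congrArg Prod.fst h6
  simp only [h8, h7, zero_smul, sub_zero, add_zero, Prod.fst_zero] at h11 h12
  have h13 : u.1.1.1 = 0 := by
    rw [← deformInv_deform (fib_bound (c := c) hh) u.1.1.1, h11, map_zero]
  exact Prod.ext (Prod.ext (Prod.ext h13 h12) h9) h10

omit [FiniteDimensional ℝ E] in
lemma contDiffAt_coneFactor {w : ((E × E) × ℝ) × ℝ} (hs : w.2 ≠ 0) :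
    ContDiffAt ℝ ∞ (coneFactor c) w := by
  have h1 : ContDiffAt ℝ ∞ (fun w : ((E × E) × ℝ) × ℝ => c / 2 * Real.log w.2) w :=
    contDiffAt_const.mul (contDiffAt_snd.log hs)
  have h2 : ContDiffAt ℝ ∞ (fun w : ((E × E) × ℝ) × ℝ => c / 2 * w.1.2) w :=
    contDiffAt_const.mul contDiffAt_fst.snd
  exact ((Complex.ofRealCLM.contDiff.contDiffAt.comp w h1).add
    ((Complex.ofRealCLM.contDiff.contDiffAt.comp w h2).mul contDiffAt_const)).cexp

omit [FiniteDimensional ℝ E] in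
lemma fderiv_coneFactor {w : ((E × E) × ℝ) × ℝ} (hs : w.2 ≠ 0) (v : ((E × E) × ℝ) × ℝ) :
    fderiv ℝ (coneFactor c) w v
      = coneFactor c w * ((c / 2 * (w.2⁻¹ * v.2) : ℝ) + (c / 2 * v.1.2 : ℝ) * Complex.I) := by
  have h1 : HasFDerivAt (fun w : ((E × E) × ℝ) × ℝ => c / 2 * Real.log w.2) _ w :=
    (hasFDerivAt_snd.log hs).const_mul (c / 2)
  have h2 : HasFDerivAt (fun w : ((E × E) × ℝ) × ℝ => c / 2 * w.1.2) _ w :=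
    (ContinuousLinearMap.snd ℝ (E × E) ℝ ∘L
      ContinuousLinearMap.fst ℝ ((E × E) × ℝ) ℝ).hasFDerivAt.const_mul (c / 2)
  have h3 := ((Complex.ofRealCLM.hasFDerivAt.comp w h1).add
    ((Complex.ofRealCLM.hasFDerivAt.comp w h2).mul_const Complex.I)).cexp
  have h4 : HasFDerivAt (coneFactor c) _ w := h3
  rw [h4.fderiv]
  simp [coneFactor]
  ring

namespace IsLocalStatistical

variable (hS : IsLocalStatistical c U γ Γ)
include hS

lemma contDiffAt_coneCoord {w : ((E × E) × ℝ) × ℝ} (hq : w.1.1.1 ∈ U) (hs : w.2 ≠ 0)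
    {T : E → (E × ℝ →L[ℝ] E × ℝ)} (hT : ContDiffAt ℝ ∞ T w.1.1.1) :
    ContDiffAt ℝ ∞ (coneCoord c γ T) w := by
  have h0 : ContDiffAt ℝ ∞ (fun p : ((E × E) × ℝ) × ℝ => p.1.1) w := by fun_prop
  have h1 : ContDiffAt ℝ ∞ (T ∘ fun p : ((E × E) × ℝ) × ℝ => p.1.1.1) w := hT.comp w h0.fst
  have h2 : ContDiffAt ℝ ∞ (fib c γ ∘ fun p : ((E × E) × ℝ) × ℝ => p.1.1) w :=
    (hS.contDiffAt_fib hq).comp w h0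
  have h3 : ContDiffAt ℝ ∞ (fun w : ((E × E) × ℝ) × ℝ =>
      (T w.1.1.1 (0, 1), T w.1.1.1 (fib c γ w.1.1, 0))) w :=
    (h1.clm_apply contDiffAt_const).prodMk (h1.clm_apply (h2.prodMk contDiffAt_const))
  exact (contDiffAt_coneFactor hs).smul ((complexify E).contDiff.contDiffAt.comp w h3)

/-- The product rule with dT = T B, where B_a(0, 1) = (a, 0) and B_a(y, 0) = (Γ(y, a), -c γ(a, y)).
The scalar -c γ(a, y) combines with (c/2) dt to (c/2) η, which explains the factor 2 in `contact`.
Writing dt = η + 2 γ(y, a) in the real part turns a into a - c γ(y, a) y, which explains `deform`.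
-/
lemma fderiv_coneCoord {w : ((E × E) × ℝ) × ℝ} (hq : w.1.1.1 ∈ U) (hs : w.2 ≠ 0)
    {T : E → (E × ℝ →L[ℝ] E × ℝ)}
    (hT : HasFDerivAt T (ContinuousLinearMap.mul ℝ (E × ℝ →L[ℝ] E × ℝ) (T w.1.1.1) ∘L
      tractor c γ Γ w.1.1.1) w.1.1.1) (v : ((E × E) × ℝ) × ℝ) :
    fderiv ℝ (coneCoord c γ T) w v
      = coneCoordFrame c γ T w (coneFrame c γ Γ w.1.1 v) := by
  have h0 : HasFDerivAt (fun p : ((E × E) × ℝ) × ℝ => p.1.1)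
      (ContinuousLinearMap.fst ℝ (E × E) ℝ ∘L ContinuousLinearMap.fst ℝ ((E × E) × ℝ) ℝ) w :=
    (ContinuousLinearMap.fst ℝ (E × E) ℝ ∘L
      ContinuousLinearMap.fst ℝ ((E × E) × ℝ) ℝ).hasFDerivAt
  have h1 : HasFDerivAt (T ∘ fun p : ((E × E) × ℝ) × ℝ => p.1.1.1) _ w :=
    HasFDerivAt.comp (g := T) (f := fun p : ((E × E) × ℝ) × ℝ => p.1.1.1) w hT h0.fst
  have h2 : HasFDerivAt (fib c γ ∘ fun p : ((E × E) × ℝ) × ℝ => p.1.1) _ w :=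
    ((hS.contDiffAt_fib hq).differentiableAt (by simp)).hasFDerivAt.comp w h0
  have h3 : HasFDerivAt (fun w : ((E × E) × ℝ) × ℝ =>
      (T w.1.1.1 (0, 1), T w.1.1.1 (fib c γ w.1.1, 0))) _ w :=
    (h1.clm_apply (hasFDerivAt_const ((0 : E), (1 : ℝ)) w)).prodMk
      (h1.clm_apply (h2.prodMk (hasFDerivAt_const (0 : ℝ) w)))
  have h4 : HasFDerivAt (coneCoord c γ T) _ w :=
    ((contDiffAt_coneFactor (c := c) hs).differentiableAt (by simp)).hasFDerivAt.smul
      ((complexify E).hasFDerivAt.comp w h3)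
  rw [h4.fderiv]
  have hf := fderiv_coneFactor (c := c) hs v
  change coneFactor c w • complexify E
      (T w.1.1.1 ((0 : E), (0 : ℝ)) + T w.1.1.1 (tractor c γ Γ w.1.1.1 v.1.1.1 (0, 1)),
        T w.1.1.1 (fderiv ℝ (fib c γ) w.1.1 v.1.1, (0 : ℝ))
          + T w.1.1.1 (tractor c γ Γ w.1.1.1 v.1.1.1 (fib c γ w.1.1, 0)))
      + fderiv ℝ (coneFactor c) w v •
        complexify E (T w.1.1.1 (0, 1), T w.1.1.1 (fib c γ w.1.1, 0)) = _
  rw [hf, mul_smul, ← smul_add, coneCoordFrame, add_smul, mul_smul, I_smul_complexify,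
    Complex.coe_smul, Complex.coe_smul, ← map_smul (complexify E), ← map_smul (complexify E),
    ← map_add (complexify E), ← map_add (complexify E)]
  congr 2
  rw [coneFrame_apply, frame_apply]
  simp only [tractor_apply, contact_apply, conn_apply, deform_apply]
  have hsym := (hS.isInnerForm _ hq).symm v.1.1.1 (fib c γ w.1.1)
  refine Prod.ext ?_ ?_
  · simp only [Prod.smul_mk, Prod.mk_add_mk, ← map_smul, ← map_neg, ← map_add]
    congr 1
    refine Prod.ext ?_ ?_
    · simp only [map_zero, zero_apply, Prod.smul_mk, Prod.neg_mk, Prod.mk_add_mk]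
      module
    · simp
  · simp only [Prod.smul_mk, Prod.mk_add_mk, ← map_smul, ← map_add]
    congr 1
    refine Prod.ext ?_ ?_
    · module
    · simp only [smul_eq_mul]
      rw [hsym]
      ring

/-- The holomorphic coordinates on the cone. -/
theorem exists_holomorphic_chart (hc : c ≠ 0) {w₀ : ((E × E) × ℝ) × ℝ} (hq : w₀.1.1.1 ∈ U)
    (hs : 0 < w₀.2) :
    ∃ e : OpenPartialHomeomorph (((E × E) × ℝ) × ℝ) (EuclideanSpace ℂ (Fin (coneDim E))),
      w₀ ∈ e.source ∧ (∀ w ∈ e.source, w.1.1.1 ∈ U ∧ 0 < w.2) ∧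
      ContDiffOn ℝ ∞ e e.source ∧ ContDiffOn ℝ ∞ e.symm e.target ∧
      ∀ w ∈ e.source, ∀ v v', coneFrame c γ Γ w.1.1 v'
          = frameRot c (γ w.1.1.1) (fib c γ w.1.1) w.2 (coneFrame c γ Γ w.1.1 v) →
        fderiv ℝ e w v' = Complex.I • fderiv ℝ e w v := by
  have : CompleteSpace E := FiniteDimensional.complete ℝ E
  obtain ⟨V, T, hVo, hqV, hVU, hT1, hTs, hTd⟩ := exists_parallel_frame hS.isOpen
    hS.contDiffOn_tractor hq (fun q hq a a' => hS.tractor_flat hq a a')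
  -- T is 1 at the base point and units form an open set, so T remains invertible nearby.
  set V' := V ∩ T ⁻¹' {A | IsUnit A} with hV'
  have hV'o : IsOpen V' := hTs.continuousOn.isOpen_inter_preimage hVo Units.isOpen
  set Ω : Set (((E × E) × ℝ) × ℝ) := {w | w.1.1.1 ∈ V' ∧ 0 < w.2} with hΩ
  have hΩo : IsOpen Ω := (hV'o.preimage (by fun_prop)).inter (isOpen_Ioi.preimage continuous_snd)
  have hw₀ : w₀ ∈ Ω := ⟨⟨hqV, by simp [hT1]⟩, hs⟩
  have hsm : ∀ w ∈ Ω, ContDiffAt ℝ ∞ (coneCoord c γ T) w := fun w hw =>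
    hS.contDiffAt_coneCoord (hVU hw.1.1) hw.2.ne' (hTs.contDiffAt (hVo.mem_nhds hw.1.1))
  have hfd : ∀ w ∈ Ω, ∀ v, fderiv ℝ (coneCoord c γ T) w v
      = coneCoordFrame c γ T w (coneFrame c γ Γ w.1.1 v) := fun w hw v =>
    hS.fderiv_coneCoord (hVU hw.1.1) hw.2.ne' (hTd _ hw.1.1) v
  -- Invertibility is needed at all points of Ω: at w₀ for the inverse function theorem, elsewhere
  -- for smoothness of the inverse on the whole target.
  have hinv : ∀ w ∈ Ω, ∃ L : (((E × E) × ℝ) × ℝ) ≃L[ℝ] EuclideanSpace ℂ (Fin (coneDim E)),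
      HasFDerivAt (coneCoord c γ T)
        (L : (((E × E) × ℝ) × ℝ) →L[ℝ] EuclideanSpace ℂ (Fin (coneDim E))) w := by
    intro w hw
    have hTi : Function.Injective (T w.1.1.1) := by
      obtain ⟨u, hu⟩ := hw.1.2
      intro x y hxy
      have h1 : ((↑u⁻¹ : E × ℝ →L[ℝ] E × ℝ) * T w.1.1.1) x
          = ((↑u⁻¹ : E × ℝ →L[ℝ] E × ℝ) * T w.1.1.1) y :=
        congrArg (↑u⁻¹ : E × ℝ →L[ℝ] E × ℝ) hxy
      rw [← hu, Units.inv_mul] at h1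
      exact h1
    have hinj : Function.Injective (fderiv ℝ (coneCoord c γ T) w) := by
      refine (injective_iff_map_eq_zero _).2 fun v hv => ?_
      rw [hfd w hw] at hv
      have h1 := coneCoordFrame_injective hc (hS.isInnerForm _ (hVU hw.1.1)) hw.2.ne' hTi hv
      exact hS.coneFrame_injective (hVU hw.1.1) (h1.trans (map_zero _).symm)
    refine ⟨(LinearEquiv.ofInjectiveOfFinrankEq (fderiv ℝ (coneCoord c γ T) w).toLinearMap hinj
      finrank_cone).toContinuousLinearEquiv, ?_⟩
    exact ((hsm w hw).differentiableAt (by simp)).hasFDerivAt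
  obtain ⟨L, hL⟩ := hinv w₀ hw₀
  set e := ((hsm w₀ hw₀).toOpenPartialHomeomorph (coneCoord c γ T) hL (by simp)).restrOpen Ω hΩo
    with he
  have hcoe : (e : _ → _) = coneCoord c γ T := rfl
  have hsrc : ∀ w ∈ e.source, w ∈ Ω := fun w hw => hw.2
  refine ⟨e, ⟨(hsm w₀ hw₀).mem_toOpenPartialHomeomorph_source hL (by simp), hw₀⟩,
    fun w hw => ⟨hVU (hsrc w hw).1.1, (hsrc w hw).2⟩, ?_, ?_, ?_⟩
  · rw [hcoe]
    exact fun w hw => (hsm w (hsrc w hw)).contDiffWithinAt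
  · intro x hx
    have hx' := e.map_target hx
    obtain ⟨L', hL'⟩ := hinv _ (hsrc _ hx')
    exact (e.contDiffAt_symm hx (by rw [hcoe]; exact hL')
      (by rw [hcoe]; exact hsm _ (hsrc _ hx'))).contDiffWithinAt
  · intro w hw v v' hv
    rw [hcoe, hfd w (hsrc w hw), hfd w (hsrc w hw), hv]
    exact coneCoordFrame_rot (hS.isInnerForm _ (hVU (hsrc w hw).1.1)) (hsrc w hw).2.ne' T _

end IsLocalStatistical

/-! ### Changes of coordinates -/

-- The rescaling factor depends only on the length of the vector, so `fib` commutes with linear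
-- isometries.
omit [FiniteDimensional ℝ E] in
lemma fib_transition {γ γ' : E → E →L[ℝ] E →L[ℝ] ℝ} {q q' : E} {L : E →L[ℝ] E}
    (hγ : ∀ u, γ' q' (L u) (L u) = γ q u u) (v : E) :
    fib c γ' (q', L v) = L (fib c γ (q, v)) := by
  simp only [fib, hγ, map_smul]

omit [FiniteDimensional ℝ E] in
/-- The connection form is invariant under changes of coordinates. -/
lemma IsLocalStatistical.conn_transition {U' : Set E} {γ' : E → E →L[ℝ] E →L[ℝ] ℝ}
    {Γ' : E → E →L[ℝ] E →L[ℝ] E} (hS : IsLocalStatistical c U γ Γ)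
    (hS' : IsLocalStatistical c U' γ' Γ') {f : E → E} {q : E} (hf : ContDiffAt ℝ ∞ f q)
    (hq : q ∈ U) (hq' : f q ∈ U')
    (hγ : ∀ᶠ p in 𝓝 q, ∀ u, γ' (f p) (fderiv ℝ f p u) (fderiv ℝ f p u) = γ p u u)
    (hΓ : ∀ u a, fderiv ℝ f q (Γ q u a)
      = fderiv ℝ (fderiv ℝ f) q a u + Γ' (f q) (fderiv ℝ f q u) (fderiv ℝ f q a)) (v : E)
    (w : E × E) :
    conn c γ' Γ' (f q, fderiv ℝ f q v)
        (fderiv ℝ f q w.1, fderiv ℝ (fderiv ℝ f) q w.1 v + fderiv ℝ f q w.2)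
      = fderiv ℝ f q (conn c γ Γ (q, v) w) := by
  have hd1 : HasFDerivAt f (fderiv ℝ f q) q := (hf.differentiableAt (by simp)).hasFDerivAt
  have hd2 : HasFDerivAt (fderiv ℝ f) (fderiv ℝ (fderiv ℝ f) q) q :=
    ((hf.fderiv_right (m := 1) (by norm_cast)).differentiableAt (by simp)).hasFDerivAt
  have hdq : HasFDerivAt (fun z : E × E => fderiv ℝ f z.1)
      (fderiv ℝ (fderiv ℝ f) q ∘L ContinuousLinearMap.fst ℝ E E) (q, v) :=
    HasFDerivAt.comp (g := fderiv ℝ f) (f := Prod.fst) (q, v) hd2 hasFDerivAt_fst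
  have hF : HasFDerivAt (fun z : E × E => (f z.1, fderiv ℝ f z.1 z.2)) _ (q, v) :=
    (HasFDerivAt.comp (g := f) (f := Prod.fst) (q, v) hd1 hasFDerivAt_fst).prodMk
      (hdq.clm_apply hasFDerivAt_snd)
  have hfib' := ((hS'.contDiffAt_fib (z := (f q, fderiv ℝ f q v)) hq').differentiableAt
    (by simp)).hasFDerivAt
  have hfib := ((hS.contDiffAt_fib (z := (q, v)) hq).differentiableAt (by simp)).hasFDerivAt
  have h1 := HasFDerivAt.comp (g := fib c γ') (f := fun z : E × E => (f z.1, fderiv ℝ f z.1 z.2))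
    (q, v) hfib' hF
  have h2 := hdq.clm_apply hfib
  -- Naturality of `fib` holds near the point, so it may be differentiated. The resulting second
  -- derivative of f is absorbed by the transformation law of the Christoffel symbols.
  have heq : (fun z : E × E => fderiv ℝ f z.1 (fib c γ z))
      =ᶠ[𝓝 (q, v)] fib c γ' ∘ fun z : E × E => (f z.1, fderiv ℝ f z.1 z.2) := by
    have ht : Filter.Tendsto (Prod.fst : E × E → E) (𝓝 (q, v)) (𝓝 q) := continuousAt_fst
    filter_upwards [ht.eventually hγ] with z hz
    exact (fib_transition hz z.2).symm
  have h3 := DFunLike.congr_fun ((h1.congr_of_eventuallyEq heq).unique h2) w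
  simp only [ContinuousLinearMap.comp_apply, add_apply, ContinuousLinearMap.flip_apply,
    ContinuousLinearMap.prod_apply, ContinuousLinearMap.coe_fst',
    ContinuousLinearMap.coe_snd'] at h3
  have h4 : fib c γ' (f q, fderiv ℝ f q v) = fderiv ℝ f q (fib c γ (q, v)) :=
    fib_transition hγ.self_of_nhds v
  rw [conn_apply, conn_apply, map_add, hΓ, h4, add_comm (fderiv ℝ (fderiv ℝ f) q w.1 v), h3]
  abel

end Local


/-! ### Charts of manifolds without boundary -/

section Charts

variable {F : Type*} [NormedAddCommGroup F] [NormedSpace ℝ F]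
  {H : Type*} [TopologicalSpace H] (J : ModelWithCorners ℝ F H)
  {N : Type*} [TopologicalSpace N] [ChartedSpace H N]

/-- The differential of a preferred chart. -/
def dchart (x₀ x : N) : TangentSpace J x →L[ℝ] F :=
  mfderiv J 𝓘(ℝ, F) (extChartAt J x₀) x

/-- The differential of the inverse of a preferred chart. -/
def dchartSymm (x₀ : N) (q : F) : F →L[ℝ] TangentSpace J ((extChartAt J x₀).symm q) :=
  mfderiv 𝓘(ℝ, F) J (extChartAt J x₀).symm q

/-- The transition map between two preferred charts. -/
def chartTrans (x₀ x₁ : N) (q : F) : F := extChartAt J x₁ ((extChartAt J x₀).symm q)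

variable {J} [IsManifold J ∞ N] {x₀ x₁ : N} {q : F}

lemma contMDiffAt_extChartAt_of_mem {x : N} (hx : x ∈ (extChartAt J x₀).source) :
    ContMDiffAt J 𝓘(ℝ, F) ∞ (extChartAt J x₀) x :=
  contMDiffAt_extChartAt' (by rwa [extChartAt_source] at hx)

lemma mdifferentiableAt_extChartAt_of_mem {x : N} (hx : x ∈ (extChartAt J x₀).source) :
    MDifferentiableAt J 𝓘(ℝ, F) (extChartAt J x₀) x :=
  (contMDiffAt_extChartAt_of_mem hx).mdifferentiableAt (by simp)

variable [J.Boundaryless]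

omit [IsManifold J ∞ N] in
lemma extChartAt_target_nhds (hq : q ∈ (extChartAt J x₀).target) :
    (extChartAt J x₀).target ∈ 𝓝 q :=
  (isOpen_extChartAt_target x₀).mem_nhds hq

lemma contMDiffAt_extChartAt_symm_of_mem (hq : q ∈ (extChartAt J x₀).target) :
    ContMDiffAt 𝓘(ℝ, F) J ∞ (extChartAt J x₀).symm q :=
  (contMDiffOn_extChartAt_symm x₀).contMDiffAt (extChartAt_target_nhds hq)

lemma mdifferentiableAt_extChartAt_symm_of_mem (hq : q ∈ (extChartAt J x₀).target) :
    MDifferentiableAt 𝓘(ℝ, F) J (extChartAt J x₀).symm q :=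
  (contMDiffAt_extChartAt_symm_of_mem hq).mdifferentiableAt (by simp)

omit [IsManifold J ∞ N] in
lemma dchartSymm_eq_mfderivWithin (q : F) :
    dchartSymm J x₀ q = mfderivWithin 𝓘(ℝ, F) J (extChartAt J x₀).symm (range J) q := by
  rw [J.range_eq_univ, mfderivWithin_univ]; rfl

lemma dchart_dchartSymm (hq : q ∈ (extChartAt J x₀).target) (v : F) :
    dchart J x₀ ((extChartAt J x₀).symm q) (dchartSymm J x₀ q v) = v := by
  have : IsManifold J 1 N := .of_le (n := ∞) (by simp)
  rw [dchartSymm_eq_mfderivWithin]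
  exact congrArg (· v) (mfderiv_extChartAt_comp_mfderivWithin_extChartAt_symm hq)

lemma dchartSymm_dchart (hq : q ∈ (extChartAt J x₀).target)
    (v : TangentSpace J ((extChartAt J x₀).symm q)) :
    dchartSymm J x₀ q (dchart J x₀ ((extChartAt J x₀).symm q) v) = v := by
  have : IsManifold J 1 N := .of_le (n := ∞) (by simp)
  rw [dchartSymm_eq_mfderivWithin]
  exact congrArg (· v) (mfderivWithin_extChartAt_symm_comp_mfderiv_extChartAt hq)

omit [IsManifold J ∞ N] [J.Boundaryless] in
lemma mem_target_exists {x : N} (hx : x ∈ (extChartAt J x₀).source) :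
    ∃ q ∈ (extChartAt J x₀).target, (extChartAt J x₀).symm q = x :=
  ⟨_, (extChartAt J x₀).map_source hx, (extChartAt J x₀).left_inv hx⟩

omit [J.Boundaryless] in
lemma isInvertible_dchart {x : N} (hx : x ∈ (extChartAt J x₀).source) :
    (dchart J x₀ x).IsInvertible := by
  have : IsManifold J 1 N := .of_le (n := ∞) (by simp)
  exact isInvertible_mfderiv_extChartAt hx

lemma isInvertible_dchartSymm (hq : q ∈ (extChartAt J x₀).target) :
    (dchartSymm J x₀ q).IsInvertible := by
  have : IsManifold J 1 N := .of_le (n := ∞) (by simp)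
  rw [dchartSymm_eq_mfderivWithin]
  exact isInvertible_mfderivWithin_extChartAt_symm hq

lemma dchart_inverse (hq : q ∈ (extChartAt J x₀).target) (v : F) :
    (dchart J x₀ ((extChartAt J x₀).symm q)).inverse v = dchartSymm J x₀ q v := by
  rw [(isInvertible_dchart ((extChartAt J x₀).map_target hq)).inverse_apply_eq,
    dchart_dchartSymm hq]

lemma eventually_mem_source (hq : q ∈ (extChartAt J x₀).target)
    (hq' : (extChartAt J x₀).symm q ∈ (extChartAt J x₁).source) :
    ∀ᶠ p in 𝓝 q, p ∈ (extChartAt J x₀).target ∧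
      (extChartAt J x₀).symm p ∈ (extChartAt J x₁).source :=
  (Filter.Eventually.and (extChartAt_target_nhds hq)
    ((contMDiffAt_extChartAt_symm_of_mem hq).continuousAt.eventually_mem
      ((isOpen_extChartAt_source x₁).mem_nhds hq')))

lemma contDiffAt_chartTrans (hq : q ∈ (extChartAt J x₀).target)
    (hq' : (extChartAt J x₀).symm q ∈ (extChartAt J x₁).source) :
    ContDiffAt ℝ ∞ (chartTrans J x₀ x₁) q :=
  contMDiffAt_iff_contDiffAt.1
    ((contMDiffAt_extChartAt_of_mem hq').comp q (contMDiffAt_extChartAt_symm_of_mem hq))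

lemma fderiv_chartTrans (hq : q ∈ (extChartAt J x₀).target)
    (hq' : (extChartAt J x₀).symm q ∈ (extChartAt J x₁).source) (v : F) :
    fderiv ℝ (chartTrans J x₀ x₁) q v
      = dchart J x₁ ((extChartAt J x₀).symm q) (dchartSymm J x₀ q v) := by
  have h := mfderiv_comp q (mdifferentiableAt_extChartAt_of_mem hq')
    (mdifferentiableAt_extChartAt_symm_of_mem hq)
  rw [mfderiv_eq_fderiv] at h
  exact congrArg (· v) h

lemma mfderiv_dchartSymm {F' : Type*} [NormedAddCommGroup F'] [NormedSpace ℝ F'] {h : N → F'}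
    (hq : q ∈ (extChartAt J x₀).target)
    (hh : MDifferentiableAt J 𝓘(ℝ, F') h ((extChartAt J x₀).symm q)) (v : F) :
    mvfderiv J h ((extChartAt J x₀).symm q) (dchartSymm J x₀ q v)
      = fderiv ℝ (fun p => h ((extChartAt J x₀).symm p)) q v := by
  have h := mfderiv_comp q hh (mdifferentiableAt_extChartAt_symm_of_mem hq)
  rw [mfderiv_eq_fderiv] at h
  exact (congrArg (· v) h).symm

end Charts

/-! ### Smoothness of fields of bilinear forms: pullbacks, and forms on vector spaces -/

section PullForm

variable {F : Type*} [NormedAddCommGroup F] [NormedSpace ℝ F]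
  {H : Type*} [TopologicalSpace H] {J : ModelWithCorners ℝ F H}
  {N : Type*} [TopologicalSpace N] [ChartedSpace H N]
  {F' : Type*} [NormedAddCommGroup F'] [NormedSpace ℝ F']
  {H' : Type*} [TopologicalSpace H'] {J' : ModelWithCorners ℝ F' H'}
  {C : Type*} [TopologicalSpace C] [ChartedSpace H' C]
  [IsManifold J ∞ N] [IsManifold J' ∞ C]

/-- A version at one point, since charts are smooth only on their sources. In local trivialisations
the pulled back form is the form composed with df on one side and precomposed with df on the other,
both smooth operations. -/
lemma contMDiffAt_pullForm {f : C → N} {p₀ : C} (hf : ContMDiffAt J' J ∞ f p₀)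
    {b : Π x : N, TangentSpace J x →L[ℝ] TangentSpace J x →L[ℝ] ℝ}
    (hb : ContMDiffAt J (J.prod 𝓘(ℝ, F →L[ℝ] F →L[ℝ] ℝ)) ∞
      (fun x ↦ TotalSpace.mk' (F →L[ℝ] F →L[ℝ] ℝ) x (b x)) (f p₀)) :
    ContMDiffAt J' (J'.prod 𝓘(ℝ, F' →L[ℝ] F' →L[ℝ] ℝ)) ∞
      (fun p ↦ TotalSpace.mk' (F' →L[ℝ] F' →L[ℝ] ℝ) p
        (pullForm (b (f p)) (mfderiv J' J f p) :
          TangentSpace J' p →L[ℝ] TangentSpace J' p →L[ℝ] ℝ)) p₀ := by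
  have h1 := (contMDiffAt_hom_bundle _).1 hb
  have h2 := h1.2.comp p₀ hf
  have h3 := hf.mfderiv_const (m := ∞) (by simp)
  have h4 : ContMDiffAt J' 𝓘(ℝ, F' →L[ℝ] F →L[ℝ] ℝ) ∞ _ p₀ := h2.clm_comp h3
  have h5 : ContMDiffAt J' 𝓘(ℝ, (F →L[ℝ] ℝ) →L[ℝ] (F' →L[ℝ] ℝ)) ∞ _ p₀ :=
    h3.clm_precomp (F₃ := ℝ)
  have h6 : ContMDiffAt J' 𝓘(ℝ, F' →L[ℝ] F' →L[ℝ] ℝ) ∞ _ p₀ := h5.clm_comp h4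
  refine (contMDiffAt_hom_bundle _).2 ⟨contMDiffAt_id, h6.congr_of_eventuallyEq ?_⟩
  have hC : ∀ᶠ p in 𝓝 p₀, p ∈ (trivializationAt F' (TangentSpace J') p₀).baseSet :=
    (trivializationAt F' (TangentSpace J') p₀).open_baseSet.mem_nhds
      (mem_baseSet_trivializationAt F' (TangentSpace J') p₀)
  have hN : ∀ᶠ p in 𝓝 p₀, f p ∈ (trivializationAt F (TangentSpace J) (f p₀)).baseSet :=
    hf.continuousAt.eventually
      ((trivializationAt F (TangentSpace J) (f p₀)).open_baseSet.mem_nhds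
        (mem_baseSet_trivializationAt F (TangentSpace J) (f p₀)))
  filter_upwards [hC, hN] with p hp hq
  ext v w
  rw [inCoordinates_apply_eq₂ hp hp (mem_univ _)]
  simp only [ContinuousLinearMap.comp_apply, ContinuousLinearMap.precomp_apply,
    inTangentCoordinates, Function.comp_apply, id]
  rw [inCoordinates_apply_eq₂ hq hq (mem_univ _)]
  rw [ContinuousLinearMap.inCoordinates_eq hp hq]
  have key : ∀ u : TangentSpace J (f p), (trivializationAt F (TangentSpace J) (f p₀)).symm (f p)
      ((trivializationAt F (TangentSpace J) (f p₀)) ⟨f p, u⟩).2 = u := fun u =>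
    Trivialization.symm_apply_apply_mk _ hq u
  simp [key]

lemma trivializationAt_symm_vectorSpace (q x v : F) :
    (trivializationAt F (TangentSpace 𝓘(ℝ, F)) q).symm x v = v :=
  (Trivialization.symmL_apply (R := ℝ) (trivializationAt F (TangentSpace 𝓘(ℝ, F)) q)
    (mem_univ _) v).symm.trans (congrArg (· v) (TangentBundle.symmL_model_space (𝕜 := ℝ) q x))

omit [NormedSpace ℝ F] in
lemma linearMapAt_trivial (q x : F) (r : ℝ) :
    (trivializationAt ℝ (Trivial F ℝ) q).linearMapAt ℝ x r = r := by
  simp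

/-- The tangent trivialisations of a vector space are the identity, so the local expression of the
section is the map b itself. -/
lemma contMDiffAt_form_iff_contDiffAt {b : F → F →L[ℝ] F →L[ℝ] ℝ} {q : F} :
    ContMDiffAt 𝓘(ℝ, F) (𝓘(ℝ, F).prod 𝓘(ℝ, F →L[ℝ] F →L[ℝ] ℝ)) ∞
      (fun x ↦ TotalSpace.mk' (F →L[ℝ] F →L[ℝ] ℝ) x
        (show TangentSpace 𝓘(ℝ, F) x →L[ℝ] TangentSpace 𝓘(ℝ, F) x →L[ℝ] ℝ from b x)) q
      ↔ ContDiffAt ℝ ∞ b q := by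
  rw [contMDiffAt_section, ← contMDiffAt_iff_contDiffAt]
  refine iff_of_eq (congrArg (fun f => ContMDiffAt _ _ _ f q) ?_)
  funext x
  refine ContinuousLinearMap.ext fun v => ContinuousLinearMap.ext fun w => ?_
  rw [hom_trivializationAt_apply]
  refine (inCoordinates_apply_eq₂ (F₁ := F) (E₁ := TangentSpace 𝓘(ℝ, F)) (F₂ := F)
    (E₂ := TangentSpace 𝓘(ℝ, F)) (F₃ := ℝ) (E₃ := Trivial F ℝ) (x₀ := q) (x := x)
    (ϕ := b x) (v := v) (w := w) (mem_univ _) (mem_univ _) (mem_univ _)).trans ?_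
  rw [trivializationAt_symm_vectorSpace, trivializationAt_symm_vectorSpace]
  exact linearMapAt_trivial q x _

end PullForm


/-! ### The coordinate expression of a statistical structure -/

section ChartData

variable {E : Type*} [NormedAddCommGroup E] [NormedSpace ℝ E]
  {M : Type*} [TopologicalSpace M] [ChartedSpace E M]

/-- The vector field on a manifold which is represented by `V` in the preferred chart at `x₀`. -/
def chartField (x₀ : M) (V : E → E) : Π x : M, TangentSpace 𝓘(ℝ, E) x :=
  VectorField.mpullback 𝓘(ℝ, E) 𝓘(ℝ, E) (extChartAt 𝓘(ℝ, E) x₀) V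

/-- The expression of a vector field in the preferred chart at `x₀`. -/
def fieldRep (x₀ : M) (Y : Π x : M, TangentSpace 𝓘(ℝ, E) x) (q : E) : E :=
  dchart 𝓘(ℝ, E) x₀ ((extChartAt 𝓘(ℝ, E) x₀).symm q) (Y ((extChartAt 𝓘(ℝ, E) x₀).symm q))

variable [IsManifold 𝓘(ℝ, E) ∞ M] {x₀ : M} {q : E}

lemma chartField_symm_apply (hq : q ∈ (extChartAt 𝓘(ℝ, E) x₀).target) (V : E → E) :
    chartField x₀ V ((extChartAt 𝓘(ℝ, E) x₀).symm q) = dchartSymm 𝓘(ℝ, E) x₀ q (V q) := by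
  rw [← dchart_inverse hq]
  exact congrArg (fun p => (dchart 𝓘(ℝ, E) x₀ _).inverse (V p))
    ((extChartAt 𝓘(ℝ, E) x₀).right_inv hq)

lemma fieldRep_chartField (hq : q ∈ (extChartAt 𝓘(ℝ, E) x₀).target) (V : E → E) :
    fieldRep x₀ (chartField x₀ V) q = V q := by
  rw [fieldRep, chartField_symm_apply hq, dchart_dchartSymm hq]

lemma dchartSymm_fieldRep (hq : q ∈ (extChartAt 𝓘(ℝ, E) x₀).target)
    (Y : Π x : M, TangentSpace 𝓘(ℝ, E) x) :
    dchartSymm 𝓘(ℝ, E) x₀ q (fieldRep x₀ Y q) = Y ((extChartAt 𝓘(ℝ, E) x₀).symm q) :=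
  dchartSymm_dchart hq _

variable [CompleteSpace E]

lemma contMDiffAt_chartField {x : M} (hx : x ∈ (extChartAt 𝓘(ℝ, E) x₀).source) {V : E → E}
    (hV : ContDiffAt ℝ ∞ V (extChartAt 𝓘(ℝ, E) x₀ x)) :
    ContMDiffAt 𝓘(ℝ, E) 𝓘(ℝ, E).tangent ∞
      (fun x => (⟨x, chartField x₀ V x⟩ : TangentBundle 𝓘(ℝ, E) M)) x :=
  ContMDiffAt.mpullback_vectorField_preimage (n := ∞)
    ((contMDiffAt_vectorSpace_iff_contDiffAt (E := E)).2 hV)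
    (contMDiffAt_extChartAt_of_mem hx) (isInvertible_dchart (F := E) hx) (by simp)

lemma contDiffAt_fieldRep (hq : q ∈ (extChartAt 𝓘(ℝ, E) x₀).target)
    {Y : Π x : M, TangentSpace 𝓘(ℝ, E) x}
    (hY : ContMDiffAt 𝓘(ℝ, E) 𝓘(ℝ, E).tangent ∞
      (fun x => (⟨x, Y x⟩ : TangentBundle 𝓘(ℝ, E) M)) ((extChartAt 𝓘(ℝ, E) x₀).symm q)) :
    ContDiffAt ℝ ∞ (fieldRep x₀ Y) q := by
  have h := (contMDiffAt_vectorSpace_iff_contDiffAt (E := E)).1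
    (ContMDiffAt.mpullback_vectorField_preimage (m := ∞) (n := ∞) hY
      (contMDiffAt_extChartAt_symm_of_mem hq) (isInvertible_dchartSymm (F := E) hq) (by simp))
  refine h.congr_of_eventuallyEq ?_
  filter_upwards [extChartAt_target_nhds hq] with p hp
  rw [VectorField.mpullback_apply]
  change _ = (dchartSymm 𝓘(ℝ, E) x₀ p).inverse _
  rw [eq_comm, (isInvertible_dchartSymm hp).inverse_apply_eq]
  exact (dchartSymm_fieldRep hp Y).symm

/-- The conditions on D and g quantify over global smooth fields. A bump function supported in the
chart makes any prescribed local field global without changing its germ. -/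
lemma exists_isSmoothField_eventuallyEq_chartField [T2Space M] [FiniteDimensional ℝ E]
    (hq : q ∈ (extChartAt 𝓘(ℝ, E) x₀).target) {V : E → E} (hV : ContDiff ℝ ∞ V) :
    ∃ X : Π x : M, TangentSpace 𝓘(ℝ, E) x, IsSmoothField 𝓘(ℝ, E) X ∧
      ∀ᶠ p in 𝓝 q, fieldRep x₀ X p = V p := by
  set x := (extChartAt 𝓘(ℝ, E) x₀).symm q with hx
  have hs : x ∈ (extChartAt 𝓘(ℝ, E) x₀).source := (extChartAt 𝓘(ℝ, E) x₀).map_target hq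
  obtain ⟨ψ, -, hψ⟩ := (SmoothBumpFunction.nhds_basis_tsupport (I := 𝓘(ℝ, E)) x).mem_iff.1
    ((isOpen_extChartAt_source (I := 𝓘(ℝ, E)) x₀).mem_nhds hs)
  refine ⟨(ψ : M → ℝ) • chartField x₀ V, ?_, ?_⟩
  · exact ContMDiffOn.smul_section_of_tsupport ψ.contMDiff.contMDiffOn
      (isOpen_extChartAt_source (I := 𝓘(ℝ, E)) x₀) hψ
      (fun y hy => (contMDiffAt_chartField hy hV.contDiffAt).contMDiffWithinAt)
  · have h1 := (contMDiffAt_extChartAt_symm_of_mem (J := 𝓘(ℝ, E)) hq).continuousAt.eventually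
      ψ.eventuallyEq_one
    filter_upwards [h1, extChartAt_target_nhds hq] with p hp hp'
    rw [← fieldRep_chartField hp' V, fieldRep, fieldRep, Pi.smul_apply', hp,
      Pi.one_apply, one_smul]

/-- The Christoffel symbols of a connection in the preferred chart at `x₀`. -/
def christoffel [FiniteDimensional ℝ E] (D : AffineConnection 𝓘(ℝ, E) M) (x₀ : M) (q : E) :
    E →L[ℝ] E →L[ℝ] E :=
  ∑ i, ∑ j, (LinearMap.toContinuousLinearMap ((Module.finBasis ℝ E).coord i)).smulRight
    ((LinearMap.toContinuousLinearMap ((Module.finBasis ℝ E).coord j)).smulRight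
      (fieldRep x₀ (D.along (chartField x₀ fun _ => Module.finBasis ℝ E j)
        (chartField x₀ fun _ => Module.finBasis ℝ E i)) q))

/-- The metric coefficients in the preferred chart at `x₀`. -/
def chartMetric (g : RiemMetric 𝓘(ℝ, E) M) (x₀ : M) (q : E) : E →L[ℝ] E →L[ℝ] ℝ :=
  pullForm (g.inner ((extChartAt 𝓘(ℝ, E) x₀).symm q)) (dchartSymm 𝓘(ℝ, E) x₀ q)

omit [CompleteSpace E] in
lemma contDiffAt_chartMetric (g : RiemMetric 𝓘(ℝ, E) M)
    (hq : q ∈ (extChartAt 𝓘(ℝ, E) x₀).target) : ContDiffAt ℝ ∞ (chartMetric g x₀) q :=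
  contMDiffAt_form_iff_contDiffAt.1
    (contMDiffAt_pullForm (contMDiffAt_extChartAt_symm_of_mem hq) (g.contMDiff _))

omit [CompleteSpace E] in
lemma isInnerForm_chartMetric (g : RiemMetric 𝓘(ℝ, E) M)
    (hq : q ∈ (extChartAt 𝓘(ℝ, E) x₀).target) : IsInnerForm (chartMetric g x₀ q) where
  symm _ _ := g.symm _ _ _
  pos v hv := g.pos _ _ fun h => hv <|
    (dchart_dchartSymm hq v).symm.trans ((congrArg _ h).trans (map_zero _))

omit [CompleteSpace E] in
lemma chartMetric_fieldRep (g : RiemMetric 𝓘(ℝ, E) M)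
    (hq : q ∈ (extChartAt 𝓘(ℝ, E) x₀).target) (Y Z : Π x : M, TangentSpace 𝓘(ℝ, E) x) :
    chartMetric g x₀ q (fieldRep x₀ Y q) (fieldRep x₀ Z q)
      = g.inner _ (Y ((extChartAt 𝓘(ℝ, E) x₀).symm q)) (Z ((extChartAt 𝓘(ℝ, E) x₀).symm q)) := by
  rw [chartMetric, pullForm_apply, dchartSymm_fieldRep hq, dchartSymm_fieldRep hq]

variable [FiniteDimensional ℝ E] (D : AffineConnection 𝓘(ℝ, E) M)

omit [CompleteSpace E] in
lemma christoffel_apply (hq : q ∈ (extChartAt 𝓘(ℝ, E) x₀).target) (v a : E) :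
    christoffel D x₀ q v a = ∑ i, (Module.finBasis ℝ E).repr v i •
      dchart 𝓘(ℝ, E) x₀ ((extChartAt 𝓘(ℝ, E) x₀).symm q)
        (D (chartField x₀ fun _ => Module.finBasis ℝ E i) ((extChartAt 𝓘(ℝ, E) x₀).symm q)
          (dchartSymm 𝓘(ℝ, E) x₀ q a)) := by
  have ha : dchartSymm 𝓘(ℝ, E) x₀ q a = ∑ j, (Module.finBasis ℝ E).repr a j •
      dchartSymm 𝓘(ℝ, E) x₀ q (Module.finBasis ℝ E j) := by
    conv_lhs => rw [← (Module.finBasis ℝ E).sum_repr a]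
    simp only [map_sum, map_smul]
  rw [ha]
  simp only [christoffel, sum_apply, ContinuousLinearMap.smulRight_apply, map_sum, map_smul,
    smul_apply, Finset.smul_sum]
  refine Finset.sum_congr rfl fun i _ => Finset.sum_congr rfl fun j _ => ?_
  rw [fieldRep, AffineConnection.along, chartField_symm_apply hq]
  rfl

omit [CompleteSpace E] [FiniteDimensional ℝ E] in
lemma covariantDerivative_sum {ι : Type*} (s : Finset ι) {Y : ι → Π x : M, TangentSpace 𝓘(ℝ, E) x}
    {x : M} (hY : ∀ i ∈ s, MDifferentiableAt 𝓘(ℝ, E) 𝓘(ℝ, E).tangent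
      (fun x => (⟨x, Y i x⟩ : TangentBundle 𝓘(ℝ, E) M)) x) :
    D (∑ i ∈ s, Y i) x = ∑ i ∈ s, D (Y i) x := by
  classical
  induction s using Finset.induction_on with
  | empty => simp
  | insert i s hi ih =>
    rw [Finset.sum_insert hi, Finset.sum_insert hi,
      D.isCovariantDerivativeOnUniv.add (hY i (Finset.mem_insert_self i s)) ?_ (mem_univ x),
      ih fun j hj => hY j (Finset.mem_insert_of_mem hj)]
    have := MDifferentiableAt.sum_section (s := s) (t := Y) (x₀ := x)
      (fun j hj => hY j (Finset.mem_insert_of_mem hj))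
    simpa using this

/-- Near the point Y is a combination of coordinate fields with its chart components as
coefficients. In the Leibniz rule the differentiated coefficients give the first term, and the
differentiated coordinate fields give the Christoffel term. -/
lemma fieldRep_along (hq : q ∈ (extChartAt 𝓘(ℝ, E) x₀).target)
    (X Y : Π x : M, TangentSpace 𝓘(ℝ, E) x) (hY : DifferentiableAt ℝ (fieldRep x₀ Y) q) :
    fieldRep x₀ (D.along X Y) q = fderiv ℝ (fieldRep x₀ Y) q (fieldRep x₀ X q)
      + christoffel D x₀ q (fieldRep x₀ Y q) (fieldRep x₀ X q) := by
  set φ := extChartAt 𝓘(ℝ, E) x₀ with hφ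
  set b := Module.finBasis ℝ E with hb
  have hs : φ.symm q ∈ φ.source := φ.map_target hq
  set f : Fin (Module.finrank ℝ E) → M → ℝ := fun i y => b.repr (fieldRep x₀ Y (φ y)) i with hf
  set Z : Fin (Module.finrank ℝ E) → Π x : M, TangentSpace 𝓘(ℝ, E) x :=
    fun i => chartField x₀ fun _ => b i with hZ
  have hZd : ∀ i, MDifferentiableAt 𝓘(ℝ, E) 𝓘(ℝ, E).tangent
      (fun x => (⟨x, Z i x⟩ : TangentBundle 𝓘(ℝ, E) M)) (φ.symm q) := fun i =>
    (contMDiffAt_chartField hs contDiffAt_const).mdifferentiableAt (by simp)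
  have hfq : ∀ i, DifferentiableAt ℝ (fun p => b.repr (fieldRep x₀ Y p) i) q := fun i =>
    (LinearMap.toContinuousLinearMap (b.coord i)).differentiableAt.comp q hY
  have hfd : ∀ i, MDifferentiableAt 𝓘(ℝ, E) 𝓘(ℝ, ℝ) (f i) (φ.symm q) := fun i => by
    refine MDifferentiableAt.comp (I' := 𝓘(ℝ, E)) (g := fun p => b.repr (fieldRep x₀ Y p) i)
      _ ?_ (mdifferentiableAt_extChartAt_of_mem hs)
    rw [φ.right_inv hq]
    exact (hfq i).mdifferentiableAt
  have hfZ : ∀ i, MDifferentiableAt 𝓘(ℝ, E) 𝓘(ℝ, E).tangent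
      (fun x => (⟨x, (f i • Z i) x⟩ : TangentBundle 𝓘(ℝ, E) M)) (φ.symm q) := fun i =>
    (hfd i).smul_section (hZd i)
  have hfder : ∀ i a, mvfderiv 𝓘(ℝ, E) (f i) (φ.symm q) (dchartSymm 𝓘(ℝ, E) x₀ q a)
      = b.repr (fderiv ℝ (fieldRep x₀ Y) q a) i := fun i a => by
    rw [mfderiv_dchartSymm hq (hfd i)]
    have h1 : (fun p => f i (φ.symm p)) =ᶠ[𝓝 q] fun p => b.repr (fieldRep x₀ Y p) i := by
      filter_upwards [extChartAt_target_nhds hq] with p hp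
      simp only [hf, φ.right_inv hp]
    rw [h1.fderiv_eq]
    have h2 := (LinearMap.toContinuousLinearMap (b.coord i)).hasFDerivAt.comp q hY.hasFDerivAt
    exact congrArg (· a) h2.fderiv
  -- The expansion holds only in the source of the chart; locality of D makes this enough.
  have hsum : ∀ᶠ y in 𝓝 (φ.symm q), (∑ i, f i • Z i) y = Y y := by
    filter_upwards [(isOpen_extChartAt_source (I := 𝓘(ℝ, E)) x₀).mem_nhds hs] with y hy
    obtain ⟨p, hp, rfl⟩ := mem_target_exists hy
    rw [← dchartSymm_fieldRep hp Y]
    conv_rhs => rw [← b.sum_repr (fieldRep x₀ Y p)]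
    simp only [Finset.sum_apply, Pi.smul_apply', map_sum, map_smul, hf, hZ,
      chartField_symm_apply hp]
    rw [φ.right_inv hp]
  have hsumd : MDifferentiableAt 𝓘(ℝ, E) 𝓘(ℝ, E).tangent
      (fun x => (⟨x, (∑ i, f i • Z i) x⟩ : TangentBundle 𝓘(ℝ, E) M)) (φ.symm q) := by
    have := MDifferentiableAt.sum_section (s := Finset.univ) (t := fun i => f i • Z i)
      (x₀ := φ.symm q) (fun j _ => hfZ j)
    simpa using this
  have hD : D Y (φ.symm q) = ∑ i, D (f i • Z i) (φ.symm q) := by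
    rw [← covariantDerivative_sum D _ fun i _ => hfZ i]
    refine (D.isCovariantDerivativeOnUniv.congr_of_eventuallyEq hsumd ?_ Filter.univ_mem hsum).symm
    refine hsumd.congr_of_eventuallyEq ?_
    filter_upwards [hsum] with y hy
    rw [hy]
  rw [fieldRep, AffineConnection.along, hD, christoffel_apply D hq, ← dchartSymm_fieldRep hq X]
  simp only [sum_apply, map_sum]
  rw [Finset.sum_congr rfl fun i _ => by
    rw [D.isCovariantDerivativeOnUniv.leibniz (hZd i) (hfd i) (mem_univ _)]]
  simp only [add_apply, smul_apply, ContinuousLinearMap.smulRight_apply, hfder, map_add, map_smul,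
    Finset.sum_add_distrib]
  rw [add_comm]
  congr 1
  · conv_rhs => rw [← b.sum_repr (fderiv ℝ (fieldRep x₀ Y) q (fieldRep x₀ X q))]
    exact Finset.sum_congr rfl fun i _ => congrArg _ (fieldRep_chartField hq fun _ => b i)
  · simp only [hf, φ.right_inv hq]
    rfl

omit [CompleteSpace E] [FiniteDimensional ℝ E] in
lemma mpullback_symm_eq_fieldRep (hq : q ∈ (extChartAt 𝓘(ℝ, E) x₀).target)
    (X : Π x : M, TangentSpace 𝓘(ℝ, E) x) :
    VectorField.mpullback 𝓘(ℝ, E) 𝓘(ℝ, E) (extChartAt 𝓘(ℝ, E) x₀).symm X q = fieldRep x₀ X q := by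
  rw [VectorField.mpullback_apply]
  change (dchartSymm 𝓘(ℝ, E) x₀ q).inverse _ = _
  rw [(isInvertible_dchartSymm hq).inverse_apply_eq]
  exact (dchartSymm_fieldRep hq X).symm

omit [CompleteSpace E] [FiniteDimensional ℝ E] in
lemma mlieBracket_vectorSpace (V W : Π x : E, TangentSpace 𝓘(ℝ, E) x) :
    VectorField.mlieBracket 𝓘(ℝ, E) V W = VectorField.lieBracket ℝ V W := by
  rw [← VectorField.mlieBracketWithin_univ, VectorField.mlieBracketWithin_eq_lieBracketWithin]
  exact VectorField.lieBracketWithin_univ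

-- Naturality of the Lie bracket under pullback by the inverse chart.
omit [FiniteDimensional ℝ E] in
lemma fieldRep_mlieBracket (hq : q ∈ (extChartAt 𝓘(ℝ, E) x₀).target)
    {X Y : Π x : M, TangentSpace 𝓘(ℝ, E) x} (hX : IsSmoothField 𝓘(ℝ, E) X)
    (hY : IsSmoothField 𝓘(ℝ, E) Y) :
    fieldRep x₀ (VectorField.mlieBracket 𝓘(ℝ, E) X Y) q
      = VectorField.lieBracket ℝ (fieldRep x₀ X) (fieldRep x₀ Y) q := by
  have : IsManifold 𝓘(ℝ, E) (minSmoothness ℝ 2) M := by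
    rw [minSmoothness_of_isRCLikeNormedField]
    exact .of_le (n := ∞) ENat.LEInfty.out
  have h := VectorField.mpullback_mlieBracket (f := (extChartAt 𝓘(ℝ, E) x₀).symm) (x₀ := q)
    (n := ∞) (hX.mdifferentiable (by simp) _) (hY.mdifferentiable (by simp) _)
    (contMDiffAt_extChartAt_symm_of_mem hq) (by simpa using ENat.LEInfty.out)
  rw [mpullback_symm_eq_fieldRep hq] at h
  have hrep : ∀ W : Π x : M, TangentSpace 𝓘(ℝ, E) x,
      VectorField.mpullback 𝓘(ℝ, E) 𝓘(ℝ, E) (extChartAt 𝓘(ℝ, E) x₀).symm W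
        =ᶠ[𝓝 q] fieldRep x₀ W := fun W => by
    filter_upwards [extChartAt_target_nhds hq] with p hp
    exact mpullback_symm_eq_fieldRep hp W
  rw [h, (hrep X).mlieBracket_vectorField_eq (hrep Y)]
  exact congrFun (mlieBracket_vectorSpace _ _) q

/-- The identity is stated on a neighbourhood so that it can be differentiated once more in the
curvature computation. -/
lemma fieldRep_along_const (hq : q ∈ (extChartAt 𝓘(ℝ, E) x₀).target)
    {X Y : Π x : M, TangentSpace 𝓘(ℝ, E) x} {a b : E} (hX : ∀ᶠ p in 𝓝 q, fieldRep x₀ X p = a)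
    (hY : ∀ᶠ p in 𝓝 q, fieldRep x₀ Y p = b) :
    ∀ᶠ p in 𝓝 q, fieldRep x₀ (D.along X Y) p = christoffel D x₀ p b a := by
  filter_upwards [extChartAt_target_nhds hq, hX, hY.eventually_nhds] with p hp hXp hYp
  have h : fieldRep x₀ Y =ᶠ[𝓝 p] fun _ => b := hYp
  rw [fieldRep_along D hp X Y (h.differentiableAt_iff.2 (differentiableAt_const b)), h.fderiv_eq,
    h.eq_of_nhds, hXp]
  simp

variable {D} {g : RiemMetric 𝓘(ℝ, E) M} {c : ℝ}

lemma IsStatistical.isSmoothField_along (hstat : IsStatistical D g)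
    {X Y : Π x : M, TangentSpace 𝓘(ℝ, E) x} (hX : IsSmoothField 𝓘(ℝ, E) X)
    (hY : IsSmoothField 𝓘(ℝ, E) Y) : IsSmoothField 𝓘(ℝ, E) (D.along X Y) := by
  have h := hstat.smooth.contMDiff.contMDiff (σ := Y) (by simpa using hY.contMDiffOn)
  exact ContMDiff.clm_bundle_apply (contMDiffOn_univ.1 h) hX

variable [T2Space M]

/-- Near each point, Γ(b, a) represents D_X Y for global smooth fields X, Y with constant components
a, b, and D_X Y is smooth. -/
lemma IsStatistical.contDiffOn_christoffel (hstat : IsStatistical D g) (x₀ : M) :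
    ContDiffOn ℝ ∞ (christoffel D x₀) (extChartAt 𝓘(ℝ, E) x₀).target := by
  refine contDiffOn_clm_apply.2 fun b => contDiffOn_clm_apply.2 fun a q hq => ?_
  obtain ⟨X, hX, hXa⟩ := exists_isSmoothField_eventuallyEq_chartField hq
    (contDiff_const (c := a))
  obtain ⟨Y, hY, hYb⟩ := exists_isSmoothField_eventuallyEq_chartField hq
    (contDiff_const (c := b))
  exact ((contDiffAt_fieldRep hq (hstat.isSmoothField_along hX hY _)).congr_of_eventuallyEq
    ((fieldRep_along_const D hq hXa hYb).mono fun p hp => hp.symm)).contDiffWithinAt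

/-- Vanishing torsion is evaluated on fields with constant components, whose bracket vanishes. -/
lemma IsStatistical.christoffel_symm (hstat : IsStatistical D g)
    (hq : q ∈ (extChartAt 𝓘(ℝ, E) x₀).target) (a b : E) :
    christoffel D x₀ q a b = christoffel D x₀ q b a := by
  obtain ⟨X, hX, hXa⟩ := exists_isSmoothField_eventuallyEq_chartField hq
    (contDiff_const (c := a))
  obtain ⟨Y, hY, hYb⟩ := exists_isSmoothField_eventuallyEq_chartField hq
    (contDiff_const (c := b))
  have h1 := (fieldRep_along_const D hq hXa hYb).self_of_nhds
  have h2 := (fieldRep_along_const D hq hYb hXa).self_of_nhds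
  have h3 := D.torsion_apply (hX.mdifferentiable (by simp) ((extChartAt 𝓘(ℝ, E) x₀).symm q))
    (hY.mdifferentiable (by simp) _)
  have h4 := fieldRep_mlieBracket hq hX hY
  have hX' : fieldRep x₀ X =ᶠ[𝓝 q] fun _ => a := hXa
  have hY' : fieldRep x₀ Y =ᶠ[𝓝 q] fun _ => b := hYb
  rw [VectorField.lieBracket, hX'.fderiv_eq, hY'.fderiv_eq] at h4
  rw [hstat.torsion_free] at h3
  have h5 := congrArg (dchart 𝓘(ℝ, E) x₀ ((extChartAt 𝓘(ℝ, E) x₀).symm q)) h3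
  rw [map_sub, map_sub] at h5
  change _ = fieldRep x₀ (D.along X Y) q - fieldRep x₀ (D.along Y X) q - fieldRep x₀ _ q at h5
  rw [h1, h2, h4] at h5
  simp only [zero_apply, map_zero, fderiv_fun_const, Pi.zero_apply, sub_zero] at h5
  exact (sub_eq_zero.1 h5.symm).symm

omit [T2Space M] in
lemma derivMetric_eq (hq : q ∈ (extChartAt 𝓘(ℝ, E) x₀).target)
    {X Y Z : Π x : M, TangentSpace 𝓘(ℝ, E) x} {a b d : E}
    (hX : ∀ᶠ p in 𝓝 q, fieldRep x₀ X p = a) (hY : ∀ᶠ p in 𝓝 q, fieldRep x₀ Y p = b)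
    (hZ : ∀ᶠ p in 𝓝 q, fieldRep x₀ Z p = d) :
    D.derivMetric g X Y Z ((extChartAt 𝓘(ℝ, E) x₀).symm q)
      = fderiv ℝ (chartMetric g x₀) q a b d - chartMetric g x₀ q (christoffel D x₀ q b a) d
        - chartMetric g x₀ q b (christoffel D x₀ q d a) := by
  set φ := extChartAt 𝓘(ℝ, E) x₀ with hφ
  have hs : φ.symm q ∈ φ.source := φ.map_target hq
  have hγ := (contDiffAt_chartMetric g hq).differentiableAt (by simp)
  have hγ' : HasFDerivAt (fun p => chartMetric g x₀ p b d)
      (((fderiv ℝ (chartMetric g x₀) q).flip b).flip d) q :=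
    (hγ.hasFDerivAt.clm_apply (hasFDerivAt_const b q)).clm_apply (hasFDerivAt_const d q)
      |>.congr_fderiv (by ext; simp)
  have h1 : ∀ᶠ p in 𝓝 q, g.inner (φ.symm p) (Y (φ.symm p)) (Z (φ.symm p))
      = chartMetric g x₀ p b d := by
    filter_upwards [extChartAt_target_nhds hq, hY, hZ] with p hp hYp hZp
    rw [← hYp, ← hZp, chartMetric_fieldRep g hp]
  have h2 : MDifferentiableAt 𝓘(ℝ, E) 𝓘(ℝ, ℝ) (fun y => g.inner y (Y y) (Z y)) (φ.symm q) := by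
    have h3 : MDifferentiableAt 𝓘(ℝ, E) 𝓘(ℝ, ℝ)
        ((fun p => chartMetric g x₀ p b d) ∘ φ) (φ.symm q) := by
      refine MDifferentiableAt.comp (I' := 𝓘(ℝ, E)) _ ?_ (mdifferentiableAt_extChartAt_of_mem hs)
      rw [φ.right_inv hq]
      exact hγ'.differentiableAt.mdifferentiableAt
    refine h3.congr_of_eventuallyEq ?_
    have h4 : Filter.Tendsto φ (𝓝 (φ.symm q)) (𝓝 q) := by
      have := (mdifferentiableAt_extChartAt_of_mem (J := 𝓘(ℝ, E)) hs).continuousAt.tendsto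
      rwa [← hφ, φ.right_inv hq] at this
    filter_upwards [h4.eventually h1, (isOpen_extChartAt_source (I := 𝓘(ℝ, E)) x₀).mem_nhds hs]
      with y hy hys
    rw [φ.left_inv hys] at hy
    exact hy
  have hXq : X (φ.symm q) = dchartSymm 𝓘(ℝ, E) x₀ q a := by
    rw [← hX.self_of_nhds, dchartSymm_fieldRep hq]
  have h5 := (fieldRep_along_const D hq hX hY).self_of_nhds
  have h6 := (fieldRep_along_const D hq hX hZ).self_of_nhds
  rw [AffineConnection.derivMetric, hXq, mfderiv_dchartSymm hq h2, ← h5, ← h6]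
  have h7 : (fun p => g.inner (φ.symm p) (Y (φ.symm p)) (Z (φ.symm p)))
      =ᶠ[𝓝 q] fun p => chartMetric g x₀ p b d := h1
  rw [h7.fderiv_eq, hγ'.fderiv]
  conv_rhs => rw [← hY.self_of_nhds, ← hZ.self_of_nhds]
  rw [chartMetric_fieldRep g hq, chartMetric_fieldRep g hq, hY.self_of_nhds, hZ.self_of_nhds]
  rfl

lemma IsStatistical.christoffel_curvature (hstat : IsStatistical D g)
    (hcurv : HasConstantCurvature D g c) (hq : q ∈ (extChartAt 𝓘(ℝ, E) x₀).target) (a b d : E) :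
    fderiv ℝ (christoffel D x₀) q a d b - fderiv ℝ (christoffel D x₀) q b d a
        + christoffel D x₀ q (christoffel D x₀ q d b) a
        - christoffel D x₀ q (christoffel D x₀ q d a) b
      = c • (chartMetric g x₀ q b d • a - chartMetric g x₀ q a d • b) := by
  obtain ⟨X, hX, hXa⟩ := exists_isSmoothField_eventuallyEq_chartField hq
    (contDiff_const (c := a))
  obtain ⟨Y, hY, hYb⟩ := exists_isSmoothField_eventuallyEq_chartField hq
    (contDiff_const (c := b))
  obtain ⟨Z, hZ, hZd⟩ := exists_isSmoothField_eventuallyEq_chartField hq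
    (contDiff_const (c := d))
  have hΓ := ((hstat.contDiffOn_christoffel x₀).contDiffAt
    (extChartAt_target_nhds hq)).differentiableAt (by simp)
  have hΓ' : ∀ u v : E, HasFDerivAt (fun p => christoffel D x₀ p u v)
      (((fderiv ℝ (christoffel D x₀) q).flip u).flip v) q := fun u v =>
    (hΓ.hasFDerivAt.clm_apply (hasFDerivAt_const u q)).clm_apply (hasFDerivAt_const v q)
      |>.congr_fderiv (by ext; simp)
  have key : ∀ {X Y : Π x : M, TangentSpace 𝓘(ℝ, E) x} {a b : E},
      (∀ᶠ p in 𝓝 q, fieldRep x₀ X p = a) → (∀ᶠ p in 𝓝 q, fieldRep x₀ Y p = b) →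
      fieldRep x₀ (D.along X (D.along Y Z)) q = fderiv ℝ (christoffel D x₀) q a d b
        + christoffel D x₀ q (christoffel D x₀ q d b) a := fun {X Y a b} hXa hYb => by
    have h : fieldRep x₀ (D.along Y Z) =ᶠ[𝓝 q] fun p => christoffel D x₀ p d b :=
      fieldRep_along_const D hq hYb hZd
    rw [fieldRep_along D hq _ _ (h.differentiableAt_iff.2 (hΓ' d b).differentiableAt),
      h.fderiv_eq, h.eq_of_nhds, (hΓ' d b).fderiv, hXa.self_of_nhds]
    rfl
  -- Fields with constant components commute at the point, so the bracket term of the curvature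
  -- drops out.
  have hbr : fieldRep x₀ (D.along (VectorField.mlieBracket 𝓘(ℝ, E) X Y) Z) q = 0 := by
    have hX' : fieldRep x₀ X =ᶠ[𝓝 q] fun _ => a := hXa
    have hY' : fieldRep x₀ Y =ᶠ[𝓝 q] fun _ => b := hYb
    have hZ' : fieldRep x₀ Z =ᶠ[𝓝 q] fun _ => d := hZd
    rw [fieldRep_along D hq _ _ (hZ'.differentiableAt_iff.2 (differentiableAt_const d)),
      fieldRep_mlieBracket hq hX hY, VectorField.lieBracket, hX'.fderiv_eq, hY'.fderiv_eq,
      hZ'.fderiv_eq]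
    simp
  have h := congrArg (dchart 𝓘(ℝ, E) x₀ ((extChartAt 𝓘(ℝ, E) x₀).symm q))
    (hcurv X Y Z hX hY hZ ((extChartAt 𝓘(ℝ, E) x₀).symm q))
  rw [AffineConnection.curvature, map_sub, map_sub, map_smul, map_sub, map_smul, map_smul] at h
  change fieldRep x₀ (D.along X (D.along Y Z)) q - fieldRep x₀ (D.along Y (D.along X Z)) q
    - fieldRep x₀ (D.along (VectorField.mlieBracket 𝓘(ℝ, E) X Y) Z) q
    = c • (_ • fieldRep x₀ X q - _ • fieldRep x₀ Y q) at h
  rw [key hXa hYb, key hYb hXa, hbr, ← chartMetric_fieldRep g hq, ← chartMetric_fieldRep g hq,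
    hXa.self_of_nhds, hYb.self_of_nhds, hZd.self_of_nhds] at h
  rw [← h]
  abel

/-- A statistical manifold of constant curvature in coordinates. -/
lemma IsStatistical.isLocalStatistical (hstat : IsStatistical D g)
    (hcurv : HasConstantCurvature D g c) (x₀ : M) :
    IsLocalStatistical c (extChartAt 𝓘(ℝ, E) x₀).target (chartMetric g x₀)
      (christoffel D x₀) where
  isOpen := isOpen_extChartAt_target x₀
  contDiffOn_metric q hq := (contDiffAt_chartMetric g hq).contDiffWithinAt
  contDiffOn_christoffel := hstat.contDiffOn_christoffel x₀
  isInnerForm q hq := isInnerForm_chartMetric g hq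
  symm q hq a b := hstat.christoffel_symm hq a b
  codazzi q hq a b d := by
    obtain ⟨X, hX, hXa⟩ := exists_isSmoothField_eventuallyEq_chartField hq
      (contDiff_const (c := a))
    obtain ⟨Y, hY, hYb⟩ := exists_isSmoothField_eventuallyEq_chartField hq
      (contDiff_const (c := b))
    obtain ⟨Z, hZ, hZd⟩ := exists_isSmoothField_eventuallyEq_chartField hq
      (contDiff_const (c := d))
    rw [← derivMetric_eq hq hXa hYb hZd, ← derivMetric_eq hq hYb hXa hZd]
    exact hstat.symm_left X Y Z hX hY hZ _
  curvature q hq a b d := hstat.christoffel_curvature hcurv hq a b d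

end ChartData


/-! ### Changes of coordinates on the tangent bundle and its cone -/

section Transition

variable {E : Type*} [NormedAddCommGroup E] [NormedSpace ℝ E]

/-- The change of coordinates on the product of the tangent bundle and the line which is induced by
a change of coordinates `f`. -/
def tangentLift (f : E → E) (z : (E × E) × ℝ) : (E × E) × ℝ :=
  ((f z.1.1, fderiv ℝ f z.1.1 z.1.2), z.2)

/-- The change of coordinates on the cone which is induced by a change of coordinates `f`. -/
def coneLift (f : E → E) (p : ((E × E) × ℝ) × ℝ) : ((E × E) × ℝ) × ℝ :=
  (tangentLift f p.1, p.2)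

lemma hasFDerivAt_tangentLift {f : E → E} {z : (E × E) × ℝ} (hf : ContDiffAt ℝ ∞ f z.1.1) :
    HasFDerivAt (tangentLift f) (fderiv ℝ (tangentLift f) z) z ∧
      ∀ w, fderiv ℝ (tangentLift f) z w = ((fderiv ℝ f z.1.1 w.1.1,
        fderiv ℝ (fderiv ℝ f) z.1.1 w.1.1 z.1.2 + fderiv ℝ f z.1.1 w.1.2), w.2) := by
  have hd1 : HasFDerivAt f (fderiv ℝ f z.1.1) z.1.1 :=
    (hf.differentiableAt (by simp)).hasFDerivAt
  have hd2 : HasFDerivAt (fderiv ℝ f) (fderiv ℝ (fderiv ℝ f) z.1.1) z.1.1 :=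
    ((hf.fderiv_right (m := 1) (by norm_cast)).differentiableAt (by simp)).hasFDerivAt
  have hp : HasFDerivAt (fun z : (E × E) × ℝ => z.1.1)
      (ContinuousLinearMap.fst ℝ E E ∘L ContinuousLinearMap.fst ℝ (E × E) ℝ) z :=
    (ContinuousLinearMap.fst ℝ E E ∘L ContinuousLinearMap.fst ℝ (E × E) ℝ).hasFDerivAt
  have hp' : HasFDerivAt (fun z : (E × E) × ℝ => z.1.2)
      (ContinuousLinearMap.snd ℝ E E ∘L ContinuousLinearMap.fst ℝ (E × E) ℝ) z :=
    (ContinuousLinearMap.snd ℝ E E ∘L ContinuousLinearMap.fst ℝ (E × E) ℝ).hasFDerivAt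
  have h1 := HasFDerivAt.comp (g := f) (f := fun z : (E × E) × ℝ => z.1.1) z hd1 hp
  have h2 := (HasFDerivAt.comp (g := fderiv ℝ f) (f := fun z : (E × E) × ℝ => z.1.1) z hd2
    hp).clm_apply hp'
  have h3 : HasFDerivAt (tangentLift f) _ z := (h1.prodMk h2).prodMk hasFDerivAt_snd
  refine ⟨h3.differentiableAt.hasFDerivAt, fun w => ?_⟩
  rw [h3.fderiv]
  simp [add_comm]

lemma fderiv_coneLift {f : E → E} {p : ((E × E) × ℝ) × ℝ} (hf : ContDiffAt ℝ ∞ f p.1.1.1)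
    (w : ((E × E) × ℝ) × ℝ) :
    fderiv ℝ (coneLift f) p w = (fderiv ℝ (tangentLift f) p.1 w.1, w.2) := by
  have h1 : HasFDerivAt (coneLift f) _ p :=
    (HasFDerivAt.comp (g := tangentLift f) (f := Prod.fst) p (hasFDerivAt_tangentLift hf).1
      hasFDerivAt_fst).prodMk hasFDerivAt_snd
  rw [h1.fderiv]
  rfl

/-- A change of coordinates which transforms one set of metric coefficients and Christoffel symbols
to another one. -/
structure IsTransition (γ γ' : E → E →L[ℝ] E →L[ℝ] ℝ) (Γ Γ' : E → E →L[ℝ] E →L[ℝ] E)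
    (f : E → E) (q : E) : Prop where
  contDiffAt : ContDiffAt ℝ ∞ f q
  metric : ∀ᶠ p in 𝓝 q, ∀ u v, γ' (f p) (fderiv ℝ f p u) (fderiv ℝ f p v) = γ p u v
  christoffel : ∀ u a, fderiv ℝ f q (Γ q u a)
    = fderiv ℝ (fderiv ℝ f) q a u + Γ' (f q) (fderiv ℝ f q u) (fderiv ℝ f q a)

/-- The action of a linear map on adapted coframes. -/
def frameMap (L : E →L[ℝ] E) : (E × E) × ℝ →L[ℝ] (E × E) × ℝ :=
  (L.prodMap L).prodMap (ContinuousLinearMap.id ℝ ℝ)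

lemma frameMap_apply (L : E →L[ℝ] E) (w : (E × E) × ℝ) :
    frameMap L w = ((L w.1.1, L w.1.2), w.2) := rfl

lemma frameForm_frameMap {c : ℝ} {h h' : E →L[ℝ] E →L[ℝ] ℝ} {L : E →L[ℝ] E}
    (hL : ∀ u v, h' (L u) (L v) = h u v) (y : E) (w w' : (E × E) × ℝ) :
    frameForm c h' (L y) (frameMap L w) (frameMap L w') = frameForm c h y w w' := by
  simp only [frameForm_apply, frameMap_apply, deform_apply, deformInv_apply, hL, ← map_smul,
    ← map_sub, ← map_add]

lemma frameRot_frameMap {c : ℝ} {h h' : E →L[ℝ] E →L[ℝ] ℝ} {L : E →L[ℝ] E}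
    (hL : ∀ u v, h' (L u) (L v) = h u v) (y : E) (s : ℝ) (w : ((E × E) × ℝ) × ℝ) :
    frameRot c h' (L y) s (frameMap L w.1, w.2)
      = (frameMap L (frameRot c h y s w).1, (frameRot c h y s w).2) := by
  simp only [frameRot_apply, frameMap_apply, deform_apply, deformInv_apply, hL, map_smul,
    map_sub, map_add, map_neg]

/-- The complex structure of the cone in coordinates. -/
def coneRot (c : ℝ) (γ : E → E →L[ℝ] E →L[ℝ] ℝ) (Γ : E → E →L[ℝ] E →L[ℝ] E)
    (p : ((E × E) × ℝ) × ℝ) : ((E × E) × ℝ) × ℝ →L[ℝ] ((E × E) × ℝ) × ℝ :=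
  (coneFrame c γ Γ p.1.1).inverse ∘L
    frameRot c (γ p.1.1.1) (fib c γ p.1.1) p.2 ∘L coneFrame c γ Γ p.1.1

variable {c : ℝ} {U U' : Set E} {γ γ' : E → E →L[ℝ] E →L[ℝ] ℝ} {Γ Γ' : E → E →L[ℝ] E →L[ℝ] E}
  {f : E → E}

namespace IsLocalStatistical

variable (hS : IsLocalStatistical c U γ Γ)
include hS

/-- The three components transform separately: dq by the chain rule, Dy by `conn_transition`, and
the contact form is invariant because it involves only the metric, the natural vector y and dt. -/
lemma frame_transition (hS' : IsLocalStatistical c U' γ' Γ') {z : (E × E) × ℝ}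
    (hT : IsTransition γ γ' Γ Γ' f z.1.1) (hz : z.1.1 ∈ U) (hz' : f z.1.1 ∈ U')
    (w : (E × E) × ℝ) :
    frame c γ' Γ' (tangentLift f z).1 (fderiv ℝ (tangentLift f) z w)
      = frameMap (fderiv ℝ f z.1.1) (frame c γ Γ z.1 w) := by
  have hm : ∀ᶠ p in 𝓝 z.1.1, ∀ u, γ' (f p) (fderiv ℝ f p u) (fderiv ℝ f p u) = γ p u u :=
    hT.metric.mono fun p hp u => hp u u
  rw [(hasFDerivAt_tangentLift hT.contDiffAt).2, frame_apply, frame_apply, frameMap_apply]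
  have h1 := hS.conn_transition hS' hT.contDiffAt hz hz' hm hT.christoffel z.1.2 w.1
  have h2 := fib_transition (c := c) hm.self_of_nhds z.1.2
  refine Prod.ext (Prod.ext rfl h1) ?_
  change contact c γ' (f z.1.1, fderiv ℝ f z.1.1 z.1.2) _ = contact c γ z.1 w
  rw [contact_apply, contact_apply, h2, hT.metric.self_of_nhds]

lemma sasakiForm_transition (hS' : IsLocalStatistical c U' γ' Γ') {z : (E × E) × ℝ}
    (hT : IsTransition γ γ' Γ Γ' f z.1.1) (hz : z.1.1 ∈ U) (hz' : f z.1.1 ∈ U')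
    (w w' : (E × E) × ℝ) :
    sasakiForm c γ' Γ' (tangentLift f z).1 (fderiv ℝ (tangentLift f) z w)
      (fderiv ℝ (tangentLift f) z w') = sasakiForm c γ Γ z.1 w w' := by
  rw [sasakiForm, sasakiForm, pullForm_apply, pullForm_apply, hS.frame_transition hS' hT hz hz',
    hS.frame_transition hS' hT hz hz']
  have h2 := fib_transition (c := c) (fun u => hT.metric.self_of_nhds u u) z.1.2
  change frameForm c (γ' (f z.1.1)) (fib c γ' (f z.1.1, fderiv ℝ f z.1.1 z.1.2)) _ _ = _
  rw [h2]
  exact frameForm_frameMap hT.metric.self_of_nhds _ _ _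

lemma coneFrame_transition (hS' : IsLocalStatistical c U' γ' Γ') {p : ((E × E) × ℝ) × ℝ}
    (hT : IsTransition γ γ' Γ Γ' f p.1.1.1) (hp : p.1.1.1 ∈ U) (hp' : f p.1.1.1 ∈ U')
    (w : ((E × E) × ℝ) × ℝ) :
    coneFrame c γ' Γ' (coneLift f p).1.1 (fderiv ℝ (coneLift f) p w)
      = (frameMap (fderiv ℝ f p.1.1.1) (coneFrame c γ Γ p.1.1 w).1,
        (coneFrame c γ Γ p.1.1 w).2) := by
  rw [fderiv_coneLift hT.contDiffAt, coneFrame_apply, coneFrame_apply]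
  exact Prod.ext (hS.frame_transition hS' hT hp hp' w.1) rfl

variable [FiniteDimensional ℝ E]

lemma coneFrame_coneRot {p : ((E × E) × ℝ) × ℝ} (hp : p.1.1.1 ∈ U) (v : ((E × E) × ℝ) × ℝ) :
    coneFrame c γ Γ p.1.1 (coneRot c γ Γ p v)
      = frameRot c (γ p.1.1.1) (fib c γ p.1.1) p.2 (coneFrame c γ Γ p.1.1 v) := by
  have h := (hS.isInvertible_coneFrame hp).self_apply_inverse
    (frameRot c (γ p.1.1.1) (fib c γ p.1.1) p.2 (coneFrame c γ Γ p.1.1 v))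
  exact h

lemma coneRot_coneRot {p : ((E × E) × ℝ) × ℝ} (hp : p.1.1.1 ∈ U) (hs : p.2 ≠ 0)
    (v : ((E × E) × ℝ) × ℝ) : coneRot c γ Γ p (coneRot c γ Γ p v) = -v := by
  apply hS.coneFrame_injective hp
  rw [hS.coneFrame_coneRot hp, hS.coneFrame_coneRot hp,
    frameRot_frameRot (fib_bound (hS.isInnerForm _ hp)) hs, map_neg]

/-- The complex structure is `frameRot` conjugated by the adapted frame. The claim is checked after
applying the injective frame of the new chart, where it reduces to naturality of `frameRot` under
isometries. -/
lemma coneRot_transition (hS' : IsLocalStatistical c U' γ' Γ') {p : ((E × E) × ℝ) × ℝ}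
    (hT : IsTransition γ γ' Γ Γ' f p.1.1.1) (hp : p.1.1.1 ∈ U) (hp' : f p.1.1.1 ∈ U')
    (w : ((E × E) × ℝ) × ℝ) :
    coneRot c γ' Γ' (coneLift f p) (fderiv ℝ (coneLift f) p w)
      = fderiv ℝ (coneLift f) p (coneRot c γ Γ p w) := by
  have h2 := fib_transition (c := c) (fun u => hT.metric.self_of_nhds u u) p.1.1.2
  apply hS'.coneFrame_injective (z := (coneLift f p).1.1) hp'
  rw [hS'.coneFrame_coneRot (p := coneLift f p) hp', hS.coneFrame_transition hS' hT hp hp',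
    hS.coneFrame_transition hS' hT hp hp', hS.coneFrame_coneRot hp]
  change frameRot c (γ' (f p.1.1.1)) (fib c γ' (f p.1.1.1, fderiv ℝ f p.1.1.1 p.1.1.2)) p.2 _ = _
  rw [h2]
  exact frameRot_frameMap hT.metric.self_of_nhds _ _ _

lemma coneRot_hermitian {p : ((E × E) × ℝ) × ℝ} (hp : p.1.1.1 ∈ U) (hs : p.2 ≠ 0)
    (v w : ((E × E) × ℝ) × ℝ) :
    p.2 ^ 2 * sasakiForm c γ Γ p.1.1 (coneRot c γ Γ p v).1 (coneRot c γ Γ p w).1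
        + (coneRot c γ Γ p v).2 * (coneRot c γ Γ p w).2
      = p.2 ^ 2 * sasakiForm c γ Γ p.1.1 v.1 w.1 + v.2 * w.2 := by
  have h := coneFrame_hermitian (hS.isInnerForm _ hp) (fib_bound (c := c) (hS.isInnerForm _ hp)) hs
    (coneFrame c γ Γ p.1.1 v) (coneFrame c γ Γ p.1.1 w)
  rw [← hS.coneFrame_coneRot hp, ← hS.coneFrame_coneRot hp] at h
  exact h

/-- The Kähler form is exact in a chart: the algebraic formula `coneFrame_fundamental` agrees term
by term with the exterior derivative of s² η / 2. -/
lemma coneRot_fundamental {p : ((E × E) × ℝ) × ℝ} (hp : p.1.1.1 ∈ U) (hs : p.2 ≠ 0)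
    (v w : ((E × E) × ℝ) × ℝ) :
    p.2 ^ 2 * sasakiForm c γ Γ p.1.1 (coneRot c γ Γ p v).1 w.1 + (coneRot c γ Γ p v).2 * w.2
      = extDeriv (conePotential c γ) p ![v, w] := by
  have h := coneFrame_fundamental (fib_bound (c := c) (hS.isInnerForm _ hp)) hs
    (coneFrame c γ Γ p.1.1 v) (coneFrame c γ Γ p.1.1 w)
  rw [← hS.coneFrame_coneRot hp] at h
  rw [hS.extDeriv_conePotential hp]
  exact h

/-- Under (s, r) ↦ (t s, t r) the entry r / s of `frameRot` is unchanged and the entry -s η is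
multiplied by t, as a dilation requires. -/
lemma coneRot_smul {p : ((E × E) × ℝ) × ℝ} (hp : p.1.1.1 ∈ U) {t : ℝ} (ht : t ≠ 0)
    (w : ((E × E) × ℝ) × ℝ) :
    coneRot c γ Γ (p.1, t * p.2) (w.1, t * w.2)
      = ((coneRot c γ Γ p w).1, t * (coneRot c γ Γ p w).2) := by
  apply hS.coneFrame_injective (z := p.1.1) hp
  have h1 := hS.coneFrame_coneRot (p := (p.1, t * p.2)) hp (w.1, t * w.2)
  have h2 := hS.coneFrame_coneRot hp w
  rw [coneFrame_apply, coneFrame_apply, frameRot_apply] at h1 h2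
  rw [coneFrame_apply, coneFrame_apply, h1]
  obtain ⟨h3, h4⟩ := Prod.ext_iff.1 h2
  dsimp only at h3 h4 ⊢
  rw [h3, h4]
  refine Prod.ext (Prod.ext rfl ?_) ?_
  · dsimp only
    rw [mul_inv, mul_assoc, mul_left_comm p.2⁻¹, inv_mul_cancel_left₀ ht]
  · dsimp only
    ring

end IsLocalStatistical

end Transition


/-! ### Changes of charts on a manifold without boundary -/

section GeneralCharts

variable {F : Type*} [NormedAddCommGroup F] [NormedSpace ℝ F]
  {H : Type*} [TopologicalSpace H] {J : ModelWithCorners ℝ F H} [J.Boundaryless]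
  {N : Type*} [TopologicalSpace N] [ChartedSpace H N] [IsManifold J ∞ N] {x₀ x₁ x : N}

lemma dchart_eq_fderiv_chartTrans (hx : x ∈ (extChartAt J x₀).source)
    (hx' : x ∈ (extChartAt J x₁).source) (v : TangentSpace J x) :
    dchart J x₁ x v
      = fderiv ℝ (chartTrans J x₀ x₁) (extChartAt J x₀ x) (dchart J x₀ x v) := by
  obtain ⟨q, hq, rfl⟩ := mem_target_exists hx
  rw [(extChartAt J x₀).right_inv hq, fderiv_chartTrans hq hx', dchartSymm_dchart hq]

omit [J.Boundaryless] [IsManifold J ∞ N] in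
lemma chartTrans_apply (hx : x ∈ (extChartAt J x₀).source) :
    chartTrans J x₀ x₁ (extChartAt J x₀ x) = extChartAt J x₁ x := by
  rw [chartTrans, (extChartAt J x₀).left_inv hx]

end GeneralCharts

/-! ### Transformation laws of the metric coefficients and the Christoffel symbols -/

section BaseCharts

variable {E : Type*} [NormedAddCommGroup E] [NormedSpace ℝ E]
  {M : Type*} [TopologicalSpace M] [ChartedSpace E M] [IsManifold 𝓘(ℝ, E) ∞ M]
  {x₀ x₁ x : M} {q : E}

omit [IsManifold 𝓘(ℝ, E) ∞ M] in
lemma fieldRep_apply (hx : x ∈ (extChartAt 𝓘(ℝ, E) x₀).source)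
    (Y : Π x : M, TangentSpace 𝓘(ℝ, E) x) :
    fieldRep x₀ Y (extChartAt 𝓘(ℝ, E) x₀ x) = dchart 𝓘(ℝ, E) x₀ x (Y x) := by
  rw [fieldRep, (extChartAt 𝓘(ℝ, E) x₀).left_inv hx]

lemma fieldRep_chartTrans (hq : q ∈ (extChartAt 𝓘(ℝ, E) x₀).target)
    (hq' : (extChartAt 𝓘(ℝ, E) x₀).symm q ∈ (extChartAt 𝓘(ℝ, E) x₁).source)
    (Y : Π x : M, TangentSpace 𝓘(ℝ, E) x) :
    fieldRep x₁ Y (chartTrans 𝓘(ℝ, E) x₀ x₁ q)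
      = fderiv ℝ (chartTrans 𝓘(ℝ, E) x₀ x₁) q (fieldRep x₀ Y q) := by
  rw [fderiv_chartTrans hq hq', dchartSymm_fieldRep hq]
  exact fieldRep_apply hq' Y

lemma chartMetric_dchart (g : RiemMetric 𝓘(ℝ, E) M) (hx : x ∈ (extChartAt 𝓘(ℝ, E) x₀).source)
    (u v : TangentSpace 𝓘(ℝ, E) x) :
    chartMetric g x₀ (extChartAt 𝓘(ℝ, E) x₀ x) (dchart 𝓘(ℝ, E) x₀ x u) (dchart 𝓘(ℝ, E) x₀ x v)
      = g.inner x u v := by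
  obtain ⟨q, hq, rfl⟩ := mem_target_exists hx
  rw [(extChartAt 𝓘(ℝ, E) x₀).right_inv hq, chartMetric, pullForm_apply, dchartSymm_dchart hq,
    dchartSymm_dchart hq]

lemma chartMetric_chartTrans (g : RiemMetric 𝓘(ℝ, E) M)
    (hq : q ∈ (extChartAt 𝓘(ℝ, E) x₀).target)
    (hq' : (extChartAt 𝓘(ℝ, E) x₀).symm q ∈ (extChartAt 𝓘(ℝ, E) x₁).source) (u v : E) :
    chartMetric g x₁ (chartTrans 𝓘(ℝ, E) x₀ x₁ q) (fderiv ℝ (chartTrans 𝓘(ℝ, E) x₀ x₁) q u)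
      (fderiv ℝ (chartTrans 𝓘(ℝ, E) x₀ x₁) q v) = chartMetric g x₀ q u v := by
  rw [fderiv_chartTrans hq hq', fderiv_chartTrans hq hq']
  exact chartMetric_dchart g hq' _ _

variable [FiniteDimensional ℝ E] [CompleteSpace E] [T2Space M]

lemma isTransition_chartTrans (D : AffineConnection 𝓘(ℝ, E) M) (g : RiemMetric 𝓘(ℝ, E) M)
    (hq : q ∈ (extChartAt 𝓘(ℝ, E) x₀).target)
    (hq' : (extChartAt 𝓘(ℝ, E) x₀).symm q ∈ (extChartAt 𝓘(ℝ, E) x₁).source) :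
    IsTransition (chartMetric g x₀) (chartMetric g x₁) (christoffel D x₀) (christoffel D x₁)
      (chartTrans 𝓘(ℝ, E) x₀ x₁) q where
  contDiffAt := contDiffAt_chartTrans hq hq'
  metric := (eventually_mem_source hq hq').mono fun p hp u v =>
    chartMetric_chartTrans g hp.1 hp.2 u v
  christoffel u a := by
    set f := chartTrans 𝓘(ℝ, E) x₀ x₁ with hf
    have hfq : f q ∈ (extChartAt 𝓘(ℝ, E) x₁).target := (extChartAt 𝓘(ℝ, E) x₁).map_source hq'
    have hfs : (extChartAt 𝓘(ℝ, E) x₁).symm (f q) = (extChartAt 𝓘(ℝ, E) x₀).symm q :=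
      (extChartAt 𝓘(ℝ, E) x₁).left_inv hq'
    obtain ⟨X, hX, hXa⟩ := exists_isSmoothField_eventuallyEq_chartField hq
      (contDiff_const (c := a))
    obtain ⟨Y, hY, hYu⟩ := exists_isSmoothField_eventuallyEq_chartField hq
      (contDiff_const (c := u))
    have hcd := contDiffAt_chartTrans hq hq'
    have hd1 : HasFDerivAt f (fderiv ℝ f q) q := (hcd.differentiableAt (by simp)).hasFDerivAt
    have hd2 : HasFDerivAt (fderiv ℝ f) (fderiv ℝ (fderiv ℝ f) q) q :=
      ((hcd.fderiv_right (m := 1) (by norm_cast)).differentiableAt (by simp)).hasFDerivAt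
    have hYd : DifferentiableAt ℝ (fieldRep x₁ Y) (f q) :=
      (contDiffAt_fieldRep hfq (hY _)).differentiableAt (by simp)
    -- A field constant in the first chart has components df(u) in the second; differentiating them
    -- produces the second derivative of f in the transformation law.
    have h1 : (fun p => fieldRep x₁ Y (f p)) =ᶠ[𝓝 q] fun p => fderiv ℝ f p u := by
      filter_upwards [eventually_mem_source hq hq', hYu] with p hp hpu
      rw [fieldRep_chartTrans hp.1 hp.2, hpu]
    have h2 := ((hYd.hasFDerivAt.comp q hd1).congr_of_eventuallyEq h1.symm).unique
      (hd2.clm_apply (hasFDerivAt_const u q))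
    have h3 := DFunLike.congr_fun h2 a
    have h4 := fieldRep_along D hfq X Y hYd
    rw [fieldRep_chartTrans hq hq', (fieldRep_along_const D hq hXa hYu).self_of_nhds,
      fieldRep_chartTrans hq hq', fieldRep_chartTrans hq hq', hXa.self_of_nhds,
      hYu.self_of_nhds] at h4
    rw [h4]
    congr 1
    simpa using h3

end BaseCharts

/-! ### Charts of the tangent bundle, of its product with the line, and of the cone -/

section BundleCharts

variable {E : Type*} [NormedAddCommGroup E] [NormedSpace ℝ E]
  {M : Type*} [TopologicalSpace M] [ChartedSpace E M] [IsManifold 𝓘(ℝ, E) ∞ M]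

/-- The fibre part of a preferred chart of the tangent bundle is the differential of the chart of
the base. -/
lemma tangentBundle_chart_apply {p₀ p : TangentBundle 𝓘(ℝ, E) M}
    (hp : p.1 ∈ (extChartAt 𝓘(ℝ, E) p₀.1).source) :
    extChartAt 𝓘(ℝ, E).tangent p₀ p
      = (extChartAt 𝓘(ℝ, E) p₀.1 p.1, dchart 𝓘(ℝ, E) p₀.1 p.1 p.2) := by
  have hp' : p.1 ∈ (chartAt E p₀.1).source := by rwa [extChartAt_source] at hp
  have hb : p.1 ∈ (trivializationAt E (TangentSpace 𝓘(ℝ, E)) p₀.1).baseSet := hp'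
  have : IsManifold 𝓘(ℝ, E) 1 M := .of_le (n := ∞) (by simp)
  have h1 := TangentBundle.continuousLinearMapAt_trivializationAt (I := 𝓘(ℝ, E)) hp'
  have h2 := FiberBundle.extChartAt (IB := 𝓘(ℝ, E)) p₀
  change extChartAt (𝓘(ℝ, E).prod 𝓘(ℝ, E)) p₀ p = _
  rw [h2, dchart, ← h1, Trivialization.continuousLinearMapAt_apply,
    Trivialization.coe_linearMapAt_of_mem _ hb]
  refine Prod.ext ?_ rfl
  exact congrArg (extChartAt 𝓘(ℝ, E) p₀.1) ((trivializationAt E (TangentSpace 𝓘(ℝ, E)) p₀.1).coe_fst' hb)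

lemma mem_tangentBundle_source {p₀ p : TangentBundle 𝓘(ℝ, E) M} :
    p ∈ (extChartAt 𝓘(ℝ, E).tangent p₀).source ↔ p.1 ∈ (extChartAt 𝓘(ℝ, E) p₀.1).source := by
  simp [ModelWithCorners.tangent]

lemma mem_tangentLine_source {p₀ p : TangentBundle 𝓘(ℝ, E) M × ℝ} :
    p ∈ (extChartAt (𝓘(ℝ, E).tangent.prod 𝓘(ℝ, ℝ)) p₀).source
      ↔ p.1.1 ∈ (extChartAt 𝓘(ℝ, E) p₀.1.1).source := by
  rw [extChartAt_prod, PartialEquiv.prod_source, mem_prod, mem_tangentBundle_source,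
    extChartAt_model_space_eq_id]
  exact and_iff_left (mem_univ _)

lemma tangentLine_chart_apply {p₀ p : TangentBundle 𝓘(ℝ, E) M × ℝ}
    (hp : p.1.1 ∈ (extChartAt 𝓘(ℝ, E) p₀.1.1).source) :
    extChartAt (𝓘(ℝ, E).tangent.prod 𝓘(ℝ, ℝ)) p₀ p
      = ((extChartAt 𝓘(ℝ, E) p₀.1.1 p.1.1, dchart 𝓘(ℝ, E) p₀.1.1 p.1.1 p.1.2), p.2) := by
  rw [extChartAt_prod, PartialEquiv.prod_coe]
  exact Prod.ext (tangentBundle_chart_apply hp) rfl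

section Cone

variable {N F H : Type*} [NormedAddCommGroup F] [NormedSpace ℝ F]
  [TopologicalSpace H] {J : ModelWithCorners ℝ F H} [TopologicalSpace N] [ChartedSpace H N]

lemma posReal_chart_source (s : PosReal) : (extChartAt 𝓘(ℝ, ℝ) s).source = univ := by
  simp [TopologicalSpace.Opens.chartAt_eq]
  exact subset_univ _

lemma posReal_chart_apply (s r : PosReal) : extChartAt 𝓘(ℝ, ℝ) s r = (r : ℝ) := by
  simp [TopologicalSpace.Opens.chartAt_eq, OpenPartialHomeomorph.subtypeRestr]
  rfl

lemma mem_cone_source {p₀ p : N × PosReal} :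
    p ∈ (extChartAt (J.prod 𝓘(ℝ, ℝ)) p₀).source ↔ p.1 ∈ (extChartAt J p₀.1).source := by
  rw [extChartAt_prod, PartialEquiv.prod_source, mem_prod, posReal_chart_source]
  exact and_iff_left (mem_univ _)

lemma cone_chart_apply (p₀ p : N × PosReal) :
    extChartAt (J.prod 𝓘(ℝ, ℝ)) p₀ p = (extChartAt J p₀.1 p.1, (p.2 : ℝ)) := by
  rw [extChartAt_prod, PartialEquiv.prod_coe]
  exact Prod.ext rfl (posReal_chart_apply _ _)

end Cone

/-- The model of the product of a tangent bundle and the line. -/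
abbrev lineModel (E : Type*) [NormedAddCommGroup E] [NormedSpace ℝ E] :
    ModelWithCorners ℝ ((E × E) × ℝ) (ModelProd (ModelProd E E) ℝ) :=
  𝓘(ℝ, E).tangent.prod 𝓘(ℝ, ℝ)

/-- The model of the cone over the product of a tangent bundle and the line. -/
abbrev coneModel (E : Type*) [NormedAddCommGroup E] [NormedSpace ℝ E] :
    ModelWithCorners ℝ (((E × E) × ℝ) × ℝ) (ModelProd (ModelProd (ModelProd E E) ℝ) ℝ) :=
  (lineModel E).prod 𝓘(ℝ, ℝ)

instance : (𝓘(ℝ, E).tangent).Boundaryless :=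
  inferInstanceAs (𝓘(ℝ, E).prod 𝓘(ℝ, E)).Boundaryless

lemma lineModel_chartTrans {p₀ p₁ : TangentBundle 𝓘(ℝ, E) M × ℝ} {z : (E × E) × ℝ}
    (hz : z ∈ (extChartAt (lineModel E) p₀).target)
    (hz' : (extChartAt (lineModel E) p₀).symm z ∈ (extChartAt (lineModel E) p₁).source) :
    z.1.1 ∈ (extChartAt 𝓘(ℝ, E) p₀.1.1).target ∧
    (extChartAt 𝓘(ℝ, E) p₀.1.1).symm z.1.1 ∈ (extChartAt 𝓘(ℝ, E) p₁.1.1).source ∧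
    chartTrans (lineModel E) p₀ p₁ z = tangentLift (chartTrans 𝓘(ℝ, E) p₀.1.1 p₁.1.1) z := by
  obtain ⟨p, hp, rfl⟩ : ∃ p ∈ (extChartAt (lineModel E) p₀).source,
      extChartAt (lineModel E) p₀ p = z :=
    ⟨_, (extChartAt (lineModel E) p₀).map_target hz, (extChartAt (lineModel E) p₀).right_inv hz⟩
  rw [(extChartAt (lineModel E) p₀).left_inv hp, mem_tangentLine_source] at hz'
  rw [chartTrans_apply hp]
  rw [mem_tangentLine_source] at hp
  rw [tangentLine_chart_apply hp, tangentLine_chart_apply hz']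
  refine ⟨(extChartAt 𝓘(ℝ, E) p₀.1.1).map_source hp, ?_, ?_⟩
  · dsimp only
    rwa [(extChartAt 𝓘(ℝ, E) p₀.1.1).left_inv hp]
  · rw [tangentLift, chartTrans_apply hp, ← dchart_eq_fderiv_chartTrans hp hz']

lemma coneModel_chartTrans {p₀ p₁ : (TangentBundle 𝓘(ℝ, E) M × ℝ) × PosReal}
    {z : ((E × E) × ℝ) × ℝ} (hz : z ∈ (extChartAt (coneModel E) p₀).target)
    (hz' : (extChartAt (coneModel E) p₀).symm z ∈ (extChartAt (coneModel E) p₁).source) :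
    z.1.1.1 ∈ (extChartAt 𝓘(ℝ, E) p₀.1.1.1).target ∧
    (extChartAt 𝓘(ℝ, E) p₀.1.1.1).symm z.1.1.1 ∈ (extChartAt 𝓘(ℝ, E) p₁.1.1.1).source ∧
    chartTrans (coneModel E) p₀ p₁ z = coneLift (chartTrans 𝓘(ℝ, E) p₀.1.1.1 p₁.1.1.1) z := by
  obtain ⟨p, hp, rfl⟩ : ∃ p ∈ (extChartAt (coneModel E) p₀).source,
      extChartAt (coneModel E) p₀ p = z :=
    ⟨_, (extChartAt (coneModel E) p₀).map_target hz, (extChartAt (coneModel E) p₀).right_inv hz⟩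
  rw [(extChartAt (coneModel E) p₀).left_inv hp, mem_cone_source] at hz'
  rw [chartTrans_apply hp]
  rw [mem_cone_source] at hp
  rw [cone_chart_apply, cone_chart_apply]
  have h := lineModel_chartTrans (p₁ := p₁.1) ((extChartAt (lineModel E) p₀.1).map_source hp)
    (by rwa [(extChartAt (lineModel E) p₀.1).left_inv hp])
  refine ⟨h.1, h.2.1, ?_⟩
  rw [coneLift, ← h.2.2, chartTrans_apply hp]

end BundleCharts

/-! ### The global metric and complex structure, and their independence of charts -/

section Global

variable {E : Type*} [NormedAddCommGroup E] [NormedSpace ℝ E] [FiniteDimensional ℝ E]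
  {M : Type*} [TopologicalSpace M] [ChartedSpace E M] [IsManifold 𝓘(ℝ, E) ∞ M]

/-- The Sasakian metric on the product of the tangent bundle and the line. -/
def sasakiInner (c : ℝ) (D : AffineConnection 𝓘(ℝ, E) M) (g : RiemMetric 𝓘(ℝ, E) M)
    (p : TangentBundle 𝓘(ℝ, E) M × ℝ) :
    TangentSpace (lineModel E) p →L[ℝ] TangentSpace (lineModel E) p →L[ℝ] ℝ :=
  pullForm (sasakiForm c (chartMetric g p.1.1) (christoffel D p.1.1)
    (extChartAt (lineModel E) p p).1) (dchart (lineModel E) p p)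

/-- The complex structure on the cone. -/
def coneComplex (c : ℝ) (D : AffineConnection 𝓘(ℝ, E) M) (g : RiemMetric 𝓘(ℝ, E) M)
    (p : (TangentBundle 𝓘(ℝ, E) M × ℝ) × PosReal) :
    TangentSpace (coneModel E) p →L[ℝ] TangentSpace (coneModel E) p :=
  (dchart (coneModel E) p p).inverse ∘L
    coneRot c (chartMetric g p.1.1.1) (christoffel D p.1.1.1) (extChartAt (coneModel E) p p) ∘L
    dchart (coneModel E) p p

variable [CompleteSpace E] [T2Space M]
  {D : AffineConnection 𝓘(ℝ, E) M} {g : RiemMetric 𝓘(ℝ, E) M} {c : ℝ}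

namespace IsStatistical

variable (hstat : IsStatistical D g) (hcurv : HasConstantCurvature D g c)
include hstat hcurv

/-- The definition uses a chart that varies with p. Expressing the form near p₀ in one fixed chart
is what makes its smoothness accessible. -/
lemma sasakiInner_apply {p₀ p : TangentBundle 𝓘(ℝ, E) M × ℝ}
    (hp : p ∈ (extChartAt (lineModel E) p₀).source) (v w : TangentSpace (lineModel E) p) :
    sasakiInner c D g p v w = sasakiForm c (chartMetric g p₀.1.1) (christoffel D p₀.1.1)
      (extChartAt (lineModel E) p₀ p).1 (dchart (lineModel E) p₀ p v)
      (dchart (lineModel E) p₀ p w) := by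
  have hpp := mem_extChartAt_source (I := lineModel E) p
  have hz := (extChartAt (lineModel E) p).map_source hpp
  have hz' : (extChartAt (lineModel E) p).symm (extChartAt (lineModel E) p p)
      ∈ (extChartAt (lineModel E) p₀).source := by
    rwa [(extChartAt (lineModel E) p).left_inv hpp]
  obtain ⟨h1, h2, h3⟩ := lineModel_chartTrans hz hz'
  have h4 : chartTrans (lineModel E) p p₀ =ᶠ[𝓝 (extChartAt (lineModel E) p p)]
      tangentLift (chartTrans 𝓘(ℝ, E) p.1.1 p₀.1.1) :=
    (eventually_mem_source hz hz').mono fun z hz => (lineModel_chartTrans hz.1 hz.2).2.2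
  have h5 := (hstat.isLocalStatistical hcurv p.1.1).sasakiForm_transition
    (hstat.isLocalStatistical hcurv p₀.1.1) (isTransition_chartTrans D g h1 h2) h1
    ((extChartAt 𝓘(ℝ, E) p₀.1.1).map_source h2) (dchart (lineModel E) p p v)
    (dchart (lineModel E) p p w)
  rw [← h3, ← h4.fderiv_eq, ← dchart_eq_fderiv_chartTrans hpp hp,
    ← dchart_eq_fderiv_chartTrans hpp hp, chartTrans_apply hpp] at h5
  exact h5.symm

/-- Allows the complex structure to be compared at different points, such as a point and its
dilation, in one fixed chart. -/
lemma dchart_coneComplex {p₀ p : (TangentBundle 𝓘(ℝ, E) M × ℝ) × PosReal}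
    (hp : p ∈ (extChartAt (coneModel E) p₀).source) (v : TangentSpace (coneModel E) p) :
    dchart (coneModel E) p₀ p (coneComplex c D g p v)
      = coneRot c (chartMetric g p₀.1.1.1) (christoffel D p₀.1.1.1)
        (extChartAt (coneModel E) p₀ p) (dchart (coneModel E) p₀ p v) := by
  have hpp := mem_extChartAt_source (I := coneModel E) p
  have hz := (extChartAt (coneModel E) p).map_source hpp
  have hz' : (extChartAt (coneModel E) p).symm (extChartAt (coneModel E) p p)
      ∈ (extChartAt (coneModel E) p₀).source := by
    rwa [(extChartAt (coneModel E) p).left_inv hpp]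
  obtain ⟨h1, h2, h3⟩ := coneModel_chartTrans hz hz'
  have h4 : chartTrans (coneModel E) p p₀ =ᶠ[𝓝 (extChartAt (coneModel E) p p)]
      coneLift (chartTrans 𝓘(ℝ, E) p.1.1.1 p₀.1.1.1) :=
    (eventually_mem_source hz hz').mono fun z hz => (coneModel_chartTrans hz.1 hz.2).2.2
  have h5 := (hstat.isLocalStatistical hcurv p.1.1.1).coneRot_transition
    (hstat.isLocalStatistical hcurv p₀.1.1.1) (isTransition_chartTrans D g h1 h2) h1
    ((extChartAt 𝓘(ℝ, E) p₀.1.1.1).map_source h2) (dchart (coneModel E) p p v)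
  have h6 := (isInvertible_dchart hpp).self_apply_inverse
    (coneRot c (chartMetric g p.1.1.1) (christoffel D p.1.1.1)
      (extChartAt (coneModel E) p p) (dchart (coneModel E) p p v))
  rw [← h3, ← h4.fderiv_eq, ← dchart_eq_fderiv_chartTrans hpp hp, chartTrans_apply hpp,
    ← h6] at h5
  rw [h5, dchart_eq_fderiv_chartTrans hpp hp]
  rfl

end IsStatistical

end Global


/-! ### Differentials of cone charts and of dilations -/

section ConeCharts

variable {F : Type*} [NormedAddCommGroup F] [NormedSpace ℝ F]
  {H : Type*} [TopologicalSpace H] {J : ModelWithCorners ℝ F H}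
  {N : Type*} [TopologicalSpace N] [ChartedSpace H N] [IsManifold J ∞ N]

lemma dchart_cone {p₀ p : N × PosReal} (hp : p.1 ∈ (extChartAt J p₀.1).source)
    (v : TangentSpace (J.prod 𝓘(ℝ, ℝ)) p) :
    dchart (J.prod 𝓘(ℝ, ℝ)) p₀ p v = (dchart J p₀.1 p.1 v.1, v.2) := by
  have hd := mdifferentiableAt_extChartAt_of_mem (mem_cone_source.2 hp)
  refine Prod.ext ?_ ?_
  · have h1 := mfderiv_comp p (ContinuousLinearMap.fst ℝ F ℝ).differentiableAt.mdifferentiableAt hd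
    have h2 : ContinuousLinearMap.fst ℝ F ℝ ∘ extChartAt (J.prod 𝓘(ℝ, ℝ)) p₀
        = extChartAt J p₀.1 ∘ Prod.fst := by
      ext p
      exact congrArg Prod.fst (cone_chart_apply p₀ p)
    rw [h2, mfderiv_comp (I' := J) p (mdifferentiableAt_extChartAt_of_mem hp)
      mdifferentiableAt_fst, mfderiv_eq_fderiv, ContinuousLinearMap.fderiv] at h1
    exact (DFunLike.congr_fun h1 v).symm.trans
      (congrArg (dchart J p₀.1 p.1) (mfderiv_cone_fst p v))
  · have h1 := mfderiv_comp p (ContinuousLinearMap.snd ℝ F ℝ).differentiableAt.mdifferentiableAt hd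
    have h2 : ContinuousLinearMap.snd ℝ F ℝ ∘ extChartAt (J.prod 𝓘(ℝ, ℝ)) p₀ = radius := by
      ext p
      exact congrArg Prod.snd (cone_chart_apply (J := J) p₀ p)
    rw [h2, mfderiv_eq_fderiv, ContinuousLinearMap.fderiv] at h1
    exact (DFunLike.congr_fun h1 v).symm.trans (mfderiv_cone_radius (J := J) p v)

omit [IsManifold J ∞ N] in
lemma contMDiff_dilation (q : PosReal) :
    ContMDiff (J.prod 𝓘(ℝ, ℝ)) (J.prod 𝓘(ℝ, ℝ)) ∞ (dilation q : N × PosReal → N × PosReal) := by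
  refine contMDiff_fst.prodMk ?_
  rw [← ContMDiff.subtypeVal_comp_iff]
  exact (contMDiff_const (c := (q : ℝ))).mul contMDiff_radius

omit [IsManifold J ∞ N] in
lemma mfderiv_dilation (q : PosReal) (p : N × PosReal) (v : TangentSpace (J.prod 𝓘(ℝ, ℝ)) p) :
    mfderiv (J.prod 𝓘(ℝ, ℝ)) (J.prod 𝓘(ℝ, ℝ)) (dilation q) p v = (v.1, (q : ℝ) * v.2) := by
  have hd := (contMDiff_dilation (J := J) (N := N) q).mdifferentiable (by simp) p
  refine Prod.ext ?_ ?_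
  · have h1 := mfderiv_comp (I'' := J) p (g := (Prod.fst : N × PosReal → N)) mdifferentiableAt_fst hd
    have h2 : (Prod.fst : N × PosReal → N) ∘ dilation q = Prod.fst := rfl
    rw [h2] at h1
    exact ((mfderiv_cone_fst (dilation q p) _).symm.trans (DFunLike.congr_fun h1 v).symm).trans
      (mfderiv_cone_fst p v)
  · have hr := (contMDiff_radius (J := J) (N := N)).mdifferentiable (by simp)
    have h1 := mfderiv_comp p (hr (dilation q p)) hd
    have h2 : (radius : N × PosReal → ℝ) ∘ dilation q = (q : ℝ) • radius := rfl
    rw [h2] at h1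
    refine ((mfderiv_cone_radius (dilation q p) _).symm.trans (DFunLike.congr_fun h1 v).symm).trans ?_
    refine (DFunLike.congr_fun (const_smul_mfderiv (hr p) (q : ℝ)) v).trans ?_
    exact congrArg (fun r : ℝ => (q : ℝ) * r) (mfderiv_cone_radius p v)

end ConeCharts

lemma IsInnerForm.pullForm {V W : Type*} [NormedAddCommGroup V] [NormedSpace ℝ V]
    [NormedAddCommGroup W] [NormedSpace ℝ W] {b : W →L[ℝ] W →L[ℝ] ℝ} (hb : IsInnerForm b)
    {L : V →L[ℝ] W} (hL : Function.Injective L) : IsInnerForm (pullForm b L) where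
  symm _ _ := hb.symm _ _
  pos _ hv := hb.pos _ fun h0 => hv (hL (h0.trans (map_zero L).symm))

/-! ### The Sasakian structure: metric, Kähler form, integrability -/

section Global

variable {E : Type*} [NormedAddCommGroup E] [NormedSpace ℝ E] [FiniteDimensional ℝ E]
  [CompleteSpace E]
  {M : Type*} [TopologicalSpace M] [ChartedSpace E M] [IsManifold 𝓘(ℝ, E) ∞ M] [T2Space M]
  {D : AffineConnection 𝓘(ℝ, E) M} {g : RiemMetric 𝓘(ℝ, E) M} {c : ℝ}

omit [FiniteDimensional ℝ E] [CompleteSpace E] [T2Space M] in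
lemma line_chart_mem_target {p₀ p : TangentBundle 𝓘(ℝ, E) M × ℝ}
    (hp : p ∈ (extChartAt (lineModel E) p₀).source) :
    (extChartAt (lineModel E) p₀ p).1.1 ∈ (extChartAt 𝓘(ℝ, E) p₀.1.1).target := by
  rw [mem_tangentLine_source] at hp
  rw [tangentLine_chart_apply hp]
  exact (extChartAt 𝓘(ℝ, E) p₀.1.1).map_source hp

omit [FiniteDimensional ℝ E] [CompleteSpace E] [T2Space M] in
lemma cone_chart_mem_target {p₀ p : (TangentBundle 𝓘(ℝ, E) M × ℝ) × PosReal}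
    (hp : p ∈ (extChartAt (coneModel E) p₀).source) :
    (extChartAt (coneModel E) p₀ p).1.1.1 ∈ (extChartAt 𝓘(ℝ, E) p₀.1.1.1).target := by
  rw [cone_chart_apply]
  exact line_chart_mem_target (mem_cone_source.1 hp)

omit [FiniteDimensional ℝ E] [CompleteSpace E] [T2Space M] in
lemma cone_chart_snd (p₀ p : (TangentBundle 𝓘(ℝ, E) M × ℝ) × PosReal) :
    (extChartAt (coneModel E) p₀ p).2 = radius p := by
  rw [cone_chart_apply]; rfl

omit [FiniteDimensional ℝ E] [CompleteSpace E] [T2Space M] in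
/-- The fundamental form of the cone. -/
def coneFundamental (c : ℝ) (g : RiemMetric 𝓘(ℝ, E) M) :
    DForm (coneModel E) ((TangentBundle 𝓘(ℝ, E) M × ℝ) × PosReal) 2 := fun p =>
  (extDeriv (conePotential c (chartMetric g p.1.1.1))
    (extChartAt (coneModel E) p p)).compContinuousLinearMap (dchart (coneModel E) p p)

lemma comp_vecCons₂ {α β : Type*} (L : α → β) (v w : α) : L ∘ ![v, w] = ![L v, L w] := by
  ext i
  fin_cases i <;> rfl

lemma eq_vecCons₂ {α : Type*} (u : Fin 2 → α) : u = ![u 0, u 1] := by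
  ext i
  fin_cases i <;> rfl

namespace IsStatistical

variable (hstat : IsStatistical D g) (hcurv : HasConstantCurvature D g c)
include hstat hcurv

lemma isInnerForm_sasakiInner (p : TangentBundle 𝓘(ℝ, E) M × ℝ) :
    IsInnerForm (E := (E × E) × ℝ) (sasakiInner c D g p) := by
  have hpp := mem_extChartAt_source (I := lineModel E) p
  have h := (hstat.isLocalStatistical hcurv p.1.1).isInnerForm_sasakiForm
    (z := (extChartAt (lineModel E) p p).1) (line_chart_mem_target hpp)
  exact h.pullForm (V := (E × E) × ℝ) (isInvertible_dchart hpp).injective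

lemma contMDiff_sasakiInner :
    ContMDiff (lineModel E) ((lineModel E).prod 𝓘(ℝ, (E × E) × ℝ →L[ℝ] (E × E) × ℝ →L[ℝ] ℝ)) ∞
      (fun p ↦ TotalSpace.mk' ((E × E) × ℝ →L[ℝ] (E × E) × ℝ →L[ℝ] ℝ) p
        (sasakiInner c D g p)) := by
  intro p₀
  have hp₀ := mem_extChartAt_source (I := lineModel E) p₀
  have hS := hstat.isLocalStatistical hcurv p₀.1.1
  have hb : ContDiffAt ℝ ∞ (fun z : (E × E) × ℝ => sasakiForm c (chartMetric g p₀.1.1)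
      (christoffel D p₀.1.1) z.1) (extChartAt (lineModel E) p₀ p₀) := by
    have hon : ContDiffOn ℝ ∞ (sasakiForm c (chartMetric g p₀.1.1) (christoffel D p₀.1.1))
        {z : E × E | z.1 ∈ (extChartAt 𝓘(ℝ, E) p₀.1.1).target} :=
      contDiffOn_clm_apply.2 fun w => contDiffOn_clm_apply.2 fun w' z hz =>
        (hS.contDiffAt_sasakiForm_apply hz w w').contDiffWithinAt
    exact (hon.contDiffAt (hS.isOpen_tangent.mem_nhds (line_chart_mem_target hp₀))).comp _
      contDiffAt_fst
  -- Near p₀ the metric is the pullback, under the single chart at p₀, of a smooth form on a vector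
  -- space.
  refine (contMDiffAt_pullForm (contMDiffAt_extChartAt_of_mem hp₀)
    (contMDiffAt_form_iff_contDiffAt.2 hb)).congr_of_eventuallyEq ?_
  filter_upwards [(isOpen_extChartAt_source (I := lineModel E) p₀).mem_nhds hp₀] with p hp
  refine congrArg (TotalSpace.mk' _ p) ?_
  refine ContinuousLinearMap.ext fun v => ContinuousLinearMap.ext fun w => ?_
  exact hstat.sasakiInner_apply hcurv hp v w

/-- The Sasakian metric on the product of the tangent bundle and the line. -/
def sasakiMetric : RiemMetric (lineModel E) (TangentBundle 𝓘(ℝ, E) M × ℝ) where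
  inner := sasakiInner c D g
  symm p := (hstat.isInnerForm_sasakiInner hcurv p).symm
  pos p := (hstat.isInnerForm_sasakiInner hcurv p).pos
  isVonNBounded p := (hstat.isInnerForm_sasakiInner hcurv p).isVonNBounded
  contMDiff := hstat.contMDiff_sasakiInner hcurv

lemma coneMetric_apply {p₀ p : (TangentBundle 𝓘(ℝ, E) M × ℝ) × PosReal}
    (hp : p ∈ (extChartAt (coneModel E) p₀).source) (v w : TangentSpace (coneModel E) p) :
    (coneMetric (hstat.sasakiMetric hcurv)).inner p v w
      = (extChartAt (coneModel E) p₀ p).2 ^ 2 * sasakiForm c (chartMetric g p₀.1.1.1)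
          (christoffel D p₀.1.1.1) (extChartAt (coneModel E) p₀ p).1.1
          (dchart (coneModel E) p₀ p v).1 (dchart (coneModel E) p₀ p w).1
        + (dchart (coneModel E) p₀ p v).2 * (dchart (coneModel E) p₀ p w).2 := by
  have hp' := mem_cone_source.1 hp
  rw [dchart_cone hp', dchart_cone hp', cone_chart_apply]
  refine (coneForm_apply _ p v w).trans ?_
  have h := hstat.sasakiInner_apply hcurv hp' v.1 w.1
  exact congrArg (fun r : ℝ => radius p ^ 2 * r + (v.2 : ℝ) * (w.2 : ℝ)) h

lemma coneComplex_sq (p : (TangentBundle 𝓘(ℝ, E) M × ℝ) × PosReal)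
    (v : TangentSpace (coneModel E) p) :
    coneComplex c D g p (coneComplex c D g p v) = -v := by
  have hpp := mem_extChartAt_source (I := coneModel E) p
  apply (isInvertible_dchart hpp).injective
  rw [hstat.dchart_coneComplex hcurv hpp, hstat.dchart_coneComplex hcurv hpp,
    (hstat.isLocalStatistical hcurv p.1.1.1).coneRot_coneRot (cone_chart_mem_target hpp)
      (by rw [cone_chart_snd]; exact (radius_pos p).ne'), map_neg]

lemma coneMetric_coneComplex (p : (TangentBundle 𝓘(ℝ, E) M × ℝ) × PosReal)
    (v w : TangentSpace (coneModel E) p) :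
    (coneMetric (hstat.sasakiMetric hcurv)).inner p (coneComplex c D g p v)
      (coneComplex c D g p w) = (coneMetric (hstat.sasakiMetric hcurv)).inner p v w := by
  have hpp := mem_extChartAt_source (I := coneModel E) p
  rw [hstat.coneMetric_apply hcurv hpp, hstat.coneMetric_apply hcurv hpp,
    hstat.dchart_coneComplex hcurv hpp, hstat.dchart_coneComplex hcurv hpp]
  exact (hstat.isLocalStatistical hcurv p.1.1.1).coneRot_hermitian (cone_chart_mem_target hpp)
    (by rw [cone_chart_snd]; exact (radius_pos p).ne') _ _

lemma coneMetric_coneComplex_left {p₀ p : (TangentBundle 𝓘(ℝ, E) M × ℝ) × PosReal}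
    (hp : p ∈ (extChartAt (coneModel E) p₀).source) (v w : TangentSpace (coneModel E) p) :
    (coneMetric (hstat.sasakiMetric hcurv)).inner p (coneComplex c D g p v) w
      = extDeriv (conePotential c (chartMetric g p₀.1.1.1)) (extChartAt (coneModel E) p₀ p)
        ![dchart (coneModel E) p₀ p v, dchart (coneModel E) p₀ p w] := by
  rw [hstat.coneMetric_apply hcurv hp, hstat.dchart_coneComplex hcurv hp]
  exact (hstat.isLocalStatistical hcurv p₀.1.1.1).coneRot_fundamental (cone_chart_mem_target hp)
    (by rw [cone_chart_snd]; exact (radius_pos p).ne') _ _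

lemma isDilationInvariant_coneComplex :
    IsDilationInvariant (J := lineModel E) (coneComplex c D g) := by
  intro q p v
  have hpp := mem_extChartAt_source (I := coneModel E) p
  -- The radial chart is global, so the chart at p contains the whole dilation orbit of p, and both
  -- sides can be compared in it.
  have hpq : dilation q p ∈ (extChartAt (coneModel E) p).source :=
    mem_cone_source.2 (mem_cone_source.1 hpp)
  apply (isInvertible_dchart hpq).injective
  rw [hstat.dchart_coneComplex hcurv hpq, dchart_cone (mem_cone_source.1 hpq),
    dchart_cone (mem_cone_source.1 hpq), mfderiv_dilation, mfderiv_dilation, cone_chart_apply]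
  have h1 := hstat.dchart_coneComplex hcurv hpp v
  rw [dchart_cone (mem_cone_source.1 hpp), dchart_cone (mem_cone_source.1 hpp)] at h1
  have h2 := (hstat.isLocalStatistical hcurv p.1.1.1).coneRot_smul (cone_chart_mem_target hpp)
    (t := (q : ℝ)) (mem_Ioi.1 q.2).ne' (dchart (lineModel E) p.1 p.1 v.1, v.2)
  rw [← h1, cone_chart_apply] at h2
  exact h2.symm

lemma coneFundamental_apply {p₀ p : (TangentBundle 𝓘(ℝ, E) M × ℝ) × PosReal}
    (hp : p ∈ (extChartAt (coneModel E) p₀).source) (v w : TangentSpace (coneModel E) p) :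
    coneFundamental c g p ![v, w]
      = extDeriv (conePotential c (chartMetric g p₀.1.1.1)) (extChartAt (coneModel E) p₀ p)
        ![dchart (coneModel E) p₀ p v, dchart (coneModel E) p₀ p w] := by
  rw [← hstat.coneMetric_coneComplex_left hcurv hp,
    hstat.coneMetric_coneComplex_left hcurv (mem_extChartAt_source p)]
  exact congrArg (extDeriv (conePotential c (chartMetric g p.1.1.1))
    (extChartAt (coneModel E) p p)) (comp_vecCons₂ (dchart (coneModel E) p p) v w)

lemma coneFundamental_inChart (p₀ : (TangentBundle 𝓘(ℝ, E) M × ℝ) × PosReal)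
    {z : ((E × E) × ℝ) × ℝ} (hz : z ∈ (extChartAt (coneModel E) p₀).target) :
    (coneFundamental c g).inChart p₀ z
      = extDeriv (conePotential c (chartMetric g p₀.1.1.1)) z := by
  ext u
  have h1 := hstat.coneFundamental_apply hcurv ((extChartAt (coneModel E) p₀).map_target hz)
    (dchartSymm (coneModel E) p₀ z (u 0)) (dchartSymm (coneModel E) p₀ z (u 1))
  rw [dchart_dchartSymm hz, dchart_dchartSymm hz, (extChartAt (coneModel E) p₀).right_inv hz,
    ← eq_vecCons₂ u] at h1
  rw [← h1, DForm.inChart, ← dchartSymm_eq_mfderivWithin]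
  exact congrArg (coneFundamental c g _)
    ((congrArg _ (eq_vecCons₂ u)).trans (comp_vecCons₂ (dchartSymm (coneModel E) p₀ z) _ _))

/-- In each chart the form is the exterior derivative of a smooth potential, and d² = 0. -/
lemma isClosed_coneFundamental : (coneFundamental c g).IsClosed := by
  intro p₀
  have hz := mem_extChartAt_target (I := coneModel E) p₀
  have hp := mem_extChartAt_source (I := coneModel E) p₀
  have h : (coneFundamental c g).inChart p₀ =ᶠ[𝓝 (extChartAt (coneModel E) p₀ p₀)]
      extDeriv (conePotential c (chartMetric g p₀.1.1.1)) := by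
    filter_upwards [extChartAt_target_nhds hz] with z hz
    exact hstat.coneFundamental_inChart hcurv p₀ hz
  rw [(coneModel E).range_eq_univ, extDerivWithin_univ, h.extDeriv_eq]
  exact extDeriv_extDeriv_apply ((hstat.isLocalStatistical hcurv p₀.1.1.1).contDiffAt_conePotential
    (cone_chart_mem_target hp)) (by simpa using ENat.LEInfty.out)

lemma isComplexStructure_coneComplex (hc : c ≠ 0) :
    IsComplexStructure (coneModel E) (coneComplex c D g) where
  sq := hstat.coneComplex_sq hcurv
  integrable p₀ := by
    have hp₀ := mem_extChartAt_source (I := coneModel E) p₀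
    have hS := hstat.isLocalStatistical hcurv p₀.1.1.1
    obtain ⟨e, he₀, he, hesm, hesm', heI⟩ := hS.exists_holomorphic_chart hc
      (cone_chart_mem_target hp₀) (by rw [cone_chart_snd]; exact radius_pos p₀)
    have hsrc : ((chartAt _ p₀).transHomeomorph (coneModel E).toHomeomorph).source
        = (extChartAt (coneModel E) p₀).source := by
      rw [extChartAt_source]; rfl
    -- The extended chart as an open partial homeomorphism, which is possible because the model has
    -- no boundary; it can then be composed with the holomorphic chart e.
    set φ : OpenPartialHomeomorph ((TangentBundle 𝓘(ℝ, E) M × ℝ) × PosReal)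
      (((E × E) × ℝ) × ℝ) := (chartAt _ p₀).transHomeomorph (coneModel E).toHomeomorph with hφ
    have hφc : ⇑φ = extChartAt (coneModel E) p₀ := rfl
    have hφs : ⇑φ.symm = (extChartAt (coneModel E) p₀).symm := rfl
    have hψ : ∀ x ∈ (φ.trans e).source, x ∈ (extChartAt (coneModel E) p₀).source ∧
        extChartAt (coneModel E) p₀ x ∈ e.source := fun x hx => by
      rw [OpenPartialHomeomorph.trans_source] at hx
      exact ⟨hsrc ▸ hx.1, hx.2⟩
    have hesx : ∀ x ∈ (φ.trans e).source, ContMDiffAt 𝓘(ℝ, ((E × E) × ℝ) × ℝ)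
        𝓘(ℝ, EuclideanSpace ℂ (Fin (coneDim E))) ∞ e (extChartAt (coneModel E) p₀ x) :=
      fun x hx => (hesm.contDiffAt (e.open_source.mem_nhds (hψ x hx).2)).contMDiffAt
    refine ⟨coneDim E, φ.trans e, ?_, fun x hx => ?_, fun y hy => ?_, fun x hx v => ?_⟩
    · rw [OpenPartialHomeomorph.trans_source]
      exact ⟨hsrc ▸ hp₀, he₀⟩
    · exact ((hesx x hx).comp x (contMDiffAt_extChartAt_of_mem (hψ x hx).1)).contMDiffWithinAt
    · rw [OpenPartialHomeomorph.trans_target] at hy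
      have h1 : ContMDiffAt 𝓘(ℝ, EuclideanSpace ℂ (Fin (coneDim E))) 𝓘(ℝ, ((E × E) × ℝ) × ℝ) ∞
          e.symm y := (hesm'.contDiffAt (e.open_target.mem_nhds hy.1)).contMDiffAt
      have h2 : e.symm y ∈ (extChartAt (coneModel E) p₀).target := by
        have h3 : φ.symm (e.symm y) ∈ φ.source := φ.map_target hy.2
        have h4 := (extChartAt (coneModel E) p₀).map_source (hsrc ▸ h3)
        have h5 : extChartAt (coneModel E) p₀ (φ.symm (e.symm y)) = e.symm y := φ.right_inv hy.2
        rwa [h5] at h4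
      exact ((contMDiffAt_extChartAt_symm_of_mem h2).comp y h1).contMDiffWithinAt
    · obtain ⟨hx1, hx2⟩ := hψ x hx
      have h1 := mfderiv_comp x ((hesx x hx).mdifferentiableAt (by simp))
        (mdifferentiableAt_extChartAt_of_mem hx1)
      rw [mfderiv_eq_fderiv] at h1
      have h2 : ∀ v, mvfderiv (coneModel E) (φ.trans e) x v
          = fderiv ℝ e (extChartAt (coneModel E) p₀ x) (dchart (coneModel E) p₀ x v) :=
        fun v => DFunLike.congr_fun h1 v
      rw [h2, h2, hstat.dchart_coneComplex hcurv hx1]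
      -- `coneRot` applied to a vector is related to that vector through the adapted frame precisely
      -- as the complex linearity of e requires.
      exact heI _ hx2 _ _ (hS.coneFrame_coneRot (he _ hx2).1 _)

lemma isSasakian_sasakiMetric (hc : c ≠ 0) : IsSasakian (hstat.sasakiMetric hcurv) :=
  ⟨coneComplex c D g,
    { complex := hstat.isComplexStructure_coneComplex hcurv hc
      hermitian := hstat.coneMetric_coneComplex hcurv
      closed := ⟨coneFundamental c g, fun p v w => by
        rw [hstat.coneMetric_coneComplex_left hcurv (mem_extChartAt_source p),
          hstat.coneFundamental_apply hcurv (mem_extChartAt_source p)],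
        hstat.isClosed_coneFundamental hcurv⟩ },
    hstat.isDilationInvariant_coneComplex hcurv⟩

end IsStatistical

end Global

end SasakiTangent

end

theorem theoremT1 (n : ℕ) (M : Type*) [TopologicalSpace M]
    [T2Space M] [SecondCountableTopology M]
    [ChartedSpace (EuclideanSpace ℝ (Fin n)) M]
    [IsManifold 𝓘(ℝ, EuclideanSpace ℝ (Fin n)) ∞ M]
    (D : SasakiTangent.AffineConnection 𝓘(ℝ, EuclideanSpace ℝ (Fin n)) M)
    (g : SasakiTangent.RiemMetric 𝓘(ℝ, EuclideanSpace ℝ (Fin n)) M)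
    (hstat : SasakiTangent.IsStatistical D g)
    (c : ℝ) (hc : c ≠ 0) (hcurv : SasakiTangent.HasConstantCurvature D g c) :
    ∃ G : SasakiTangent.RiemMetric
        (𝓘(ℝ, EuclideanSpace ℝ (Fin n)).tangent.prod 𝓘(ℝ, ℝ))
        (TangentBundle 𝓘(ℝ, EuclideanSpace ℝ (Fin n)) M × ℝ),
      SasakiTangent.IsSasakian G := by
  exact ⟨hstat.sasakiMetric hcurv, hstat.isSasakian_sasakiMetric hcurv hc⟩
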